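/- Let $(\mathfrak{g},G,U,K,Z,H)$ be one of the following, where all groups are groups of complex matrices, $p,q,l\ge 0$ are integers and $I_{n}$ is the identity matrix of size $n$: (A) $G=\mathrm{SL}(p+q,\mathbb{C})$ with Lie algebra $\mathfrak g=\mathfrak{sl}(p+q,\mathbb C)$, $U=\mathrm{SU}(p+q)$, $K=\mathrm{S}(\mathrm{U}(p)\times\mathrm{U}(q))$ and $Z=\mathrm{S}(\mathrm{GL}(p,\mathbb{C})\times\mathrm{GL}(q,\mathbb{C}))$ (block diagonal matrices of determinant one), $H=\frac{i\pi}{p+q}\,\mathrm{diag}(qI_p,-pI_q)$ (and $H=0$ if $p=q=0$); (C) $G=\mathrm{Sp}(l,\mathbb{C})$ with Lie algebra $\mathfrak g=\mathfrak{sp}(l,\mathbb C)$, $U=\mathrm{Sp}(l)=\mathrm{Sp}(l,\mathbb{C})\cap\mathrm{SU}(2l)$, $Z=\{\mathrm{diag}(a,(a^T)^{-1}):a\in\mathrm{GL}(l,\mathbb{C})\}\cong\mathrm{GL}(l,\mathbb{C})$, $K=\{\mathrm{diag}(a,(a^T)^{-1}):a\in\mathrm{U}(l)\}\cong\mathrm{U}(l)$,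 $H=\frac{i\pi}{2}\,\mathrm{diag}(I_l,-I_l)$; (D) $G=\mathrm{SO}(2l,\mathbb{C})$ with Lie algebra $\mathfrak g=\mathfrak{so}(2l,\mathbb C)$, $U=\mathrm{SO}(2l)$, $Z=\{f^{-1}\mathrm{diag}(a,(a^T)^{-1})f:a\in\mathrm{GL}(l,\mathbb{C})\}\cong\mathrm{GL}(l,\mathbb{C})$ and $K=\{f^{-1}\mathrm{diag}(a,(a^T)^{-1})f:a\in\mathrm{U}(l)\}\cong\mathrm{U}(l)$ with $f=\begin{pmatrix} iI_l&I_l\\ I_l&iI_l\end{pmatrix}$, $H=\frac{\pi}{2}\begin{pmatrix}0&I_l\\-I_l&0\end{pmatrix}$. Let $\mathfrak p$ (resp. $\mathfrak n^+$) be the sum of the eigenspaces of $\mathrm{ad}(-iH)$ on $\mathfrak g$ for the eigenvalues $\ge 0$ (resp. $>0$), and let $P=\{g\in G:\mathrm{Ad}(g)\mathfrak p=\mathfrak p\}$. Give the groups their structures of embedded real Lie groups and the homogeneous spaces the smooth structures for which the projection from the group is a smooth submersion. Then $K\subset U\subset G$, $Z\subset G$ is the centralizer of $H$ in $G$, and 1.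 the inclusion $U\subset G$ induces a diffeomorphism of $\mathbb F=U/K$ with the flag manifold $G/P$; 2. $\exp H\in U$ and, with $\sigma(g)=\exp(H)\,g\exp(H)^{-1}$, both $(U,K,\sigma)$ and $(G,Z,\sigma)$ are symmetric spaces: the groups $U$ and $G$ are connected Lie groups, $K$ and $Z$ are closed subgroups, $\sigma$ is a smooth automorphism with $\sigma^2=\mathrm{id}$, and $K$ (resp. $Z$) lies between the fixed point group of $\sigma$ in $U$ (resp. $G$) and the identity component of that group; 3. the cotangent bundle of $\mathbb F$ is realized as $G/Z$: there is a diffeomorphism $j:G/Z\to T^*\mathbb F$ that covers the projection $G/Z\to G/P\cong\mathbb F$, that is equivariant for $U$ (which acts on $T^*\mathbb F$ by the lift of its action on $\mathbb F$), and that is an isomorphism of vector bundles: there is a real linear isomorphism $L:\mathfrak n^+\to T^*_{eK}\mathbb F$ such that every $X\in\mathfrak n^+$ has a $g\in G$ with $gHg^{-1}=H+X$ and $j(gZ)=L(X)$. Thus the flag manifolds $\mathrm{SU}(p+q)/\mathrm{S}(\mathrm{U}(p)\times\mathrm{U}(q))$, $\mathrm{Sp}(l)/\mathrm{U}(l)$,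 $\mathrm{SO}(2l)/\mathrm{U}(l)$ are symmetric spaces, and their cotangent bundles are realized as the symmetric spaces $\mathrm{SL}(p+q,\mathbb{C})/\mathrm{S}(\mathrm{GL}(p,\mathbb{C})\times\mathrm{GL}(q,\mathbb{C}))$, $\mathrm{Sp}(l,\mathbb{C})/\mathrm{GL}(l,\mathbb{C})$ and $\mathrm{SO}(2l,\mathbb{C})/\mathrm{GL}(l,\mathbb{C})$. -/

import Mathlib

open scoped Manifold ContDiff

/- The commutator bracket on matrices. -/
attribute [local instance 100] LieRing.ofAssociativeRing

noncomputable section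

namespace FlagCotangent

/-! ### Smooth structures on linear groups and on their homogeneous spaces -/

section Structures

variable {ι : Type} [Fintype ι] [DecidableEq ι]

/-- The entries of a matrix in `G`, as a point of the real normed space of families of complex
numbers indexed by `ι × ι`. -/
def entries (G : Subgroup (GL ι ℂ)) (g : G) : ι → ι → ℂ :=
  fun a b => ((g : GL ι ℂ) : Matrix ι ι ℂ) a b

/-- The charts on the matrix group `G` make it a Lie group which is an embedded submanifold of the
real vector space of complex matrices. (The topology of `G` is the subspace topology, so the
inclusion is an embedding as soon as it is an injective immersion; such a smooth structure is
unique.) -/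
structure IsLinearLieGroup {d : ℕ} (G : Subgroup (GL ι ℂ))
    [ChartedSpace (EuclideanSpace ℝ (Fin d)) G] : Prop where
  lieGroup : LieGroup (𝓡 d) ∞ G
  contMDiff_entries : ContMDiff (𝓡 d) 𝓘(ℝ, ι → ι → ℂ) ∞ (entries G)
  injective_mfderiv : ∀ g : G,
    Function.Injective (mfderiv (𝓡 d) 𝓘(ℝ, ι → ι → ℂ) (entries G) g)

end Structures

/-- The charts on `G ⧸ H` (with its quotient topology) give the homogeneous space its standard
smooth structure: the unique one for which `G → G ⧸ H` is a smooth submersion. -/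
structure IsHomogeneousManifold {d e : ℕ} (G : Type) [Group G] [TopologicalSpace G]
    [ChartedSpace (EuclideanSpace ℝ (Fin d)) G] (H : Subgroup G)
    [ChartedSpace (EuclideanSpace ℝ (Fin e)) (G ⧸ H)] : Prop where
  isManifold : IsManifold (𝓡 e) ∞ (G ⧸ H)
  contMDiff_mk : ContMDiff (𝓡 d) (𝓡 e) ∞ (QuotientGroup.mk : G → G ⧸ H)
  surjective_mfderiv : ∀ g : G,
    Function.Surjective (mfderiv (𝓡 d) (𝓡 e) (QuotientGroup.mk : G → G ⧸ H) g)

/-- A symmetric space `(G, H, σ)`: a connected Lie group `G`, a closed subgroup `H` and an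
involutive automorphism `σ` of `G` such that `H` lies between the group `G^σ` of fixed points of
`σ` and the identity component of `G^σ`. -/
structure IsSymmetricSpace {d : ℕ} (G : Type) [Group G] [TopologicalSpace G]
    [ChartedSpace (EuclideanSpace ℝ (Fin d)) G] (H : Subgroup G) (σ : G ≃* G) : Prop where
  lieGroup : LieGroup (𝓡 d) ∞ G
  connected : ConnectedSpace G
  isClosed : IsClosed (H : Set G)
  contMDiff : ContMDiff (𝓡 d) (𝓡 d) ∞ σ
  involutive : Function.Involutive σ
  le_fixed : (H : Set G) ⊆ {g | σ g = g}
  component_le : connectedComponentIn {g | σ g = g} 1 ⊆ (H : Set G)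

/-! ### Cotangent bundles -/

section Cotangent

variable {d : ℕ} (M : Type) [TopologicalSpace M] [ChartedSpace (EuclideanSpace ℝ (Fin d)) M]

/-- The (real) cotangent space of a manifold at a point. -/
abbrev CotangentSpace (x : M) : Type := TangentSpace (𝓡 d) x →L[ℝ] Bundle.Trivial M ℝ x

/-- The cotangent bundle `T^*M`, with the topology and the smooth structure that Mathlib puts on
the bundle of continuous linear maps from the tangent bundle to the trivial line bundle. -/
abbrev CotangentBundle : Type :=
  Bundle.TotalSpace (EuclideanSpace ℝ (Fin d) →L[ℝ] ℝ) (CotangentSpace (d := d) M)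

variable {M}

/-- The lift to `T^*M` of a diffeomorphism `f` of `M`, namely `(x, α) ↦ (f x, α ∘ (df_x)⁻¹)`. -/
def cotangentLift (f : M → M) (ξ : CotangentBundle (d := d) M) : CotangentBundle (d := d) M :=
  ⟨f ξ.proj, ContinuousLinearMap.comp ξ.2 (mfderiv (𝓡 d) (𝓡 d) f ξ.proj).inverse⟩

end Cotangent

/-! ### Parabolic subgroups -/

section Parabolic

variable {ι : Type} [Fintype ι] [DecidableEq ι]

/-- `𝔭_Θ`: the sum of the eigenspaces in `𝔤` of `ad (-i H)` for the eigenvalues `c ≥ 0`. Here `H` is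
`i` times an element with real eigenvalues. -/
def parabolicSubalgebra (𝔤 : LieSubalgebra ℂ (Matrix ι ι ℂ)) (H : Matrix ι ι ℂ) :
    Submodule ℂ (Matrix ι ι ℂ) :=
  Submodule.span ℂ {X | X ∈ 𝔤 ∧ ∃ c : ℝ, 0 ≤ c ∧ ⁅H, X⁆ = (Complex.I * c) • X}

/-- `𝔫_Θ⁺`: the sum of the eigenspaces in `𝔤` of `ad (-i H)` for the eigenvalues `c > 0`. -/
def nilradical (𝔤 : LieSubalgebra ℂ (Matrix ι ι ℂ)) (H : Matrix ι ι ℂ) :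
    Submodule ℂ (Matrix ι ι ℂ) :=
  Submodule.span ℂ {X | X ∈ 𝔤 ∧ ∃ c : ℝ, 0 < c ∧ ⁅H, X⁆ = (Complex.I * c) • X}

/-- The normalizer `{g | Ad(g) 𝔭 = 𝔭}` of a subspace of matrices. -/
def adNormalizer (𝔭 : Submodule ℂ (Matrix ι ι ℂ)) : Subgroup (GL ι ℂ) where
  carrier := {g | ∀ X : Matrix ι ι ℂ,
    (g : Matrix ι ι ℂ) * X * ((g⁻¹ : GL ι ℂ) : Matrix ι ι ℂ) ∈ 𝔭 ↔ X ∈ 𝔭}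
  one_mem' := fun X => by simp
  mul_mem' := fun {a b} ha hb X => by
    rw [← hb X, ← ha ((b : Matrix ι ι ℂ) * X * ((b⁻¹ : GL ι ℂ) : Matrix ι ι ℂ))]
    simp only [mul_inv_rev, Units.val_mul, mul_assoc]
  inv_mem' := fun {a} ha X => by
    rw [← ha]
    simp only [inv_inv, mul_assoc, Units.mul_inv_cancel_left, Units.mul_inv, mul_one]

/-- The parabolic subgroup `P_Θ` of `G`: the normalizer of `𝔭_Θ` in `G`. -/
def parabolicSubgroup (G : Subgroup (GL ι ℂ)) (𝔤 : LieSubalgebra ℂ (Matrix ι ι ℂ))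
    (H : Matrix ι ι ℂ) : Subgroup G :=
  (adNormalizer (parabolicSubalgebra 𝔤 H)).subgroupOf G

end Parabolic

/-! ### Symmetric flag manifolds with symmetric cotangent bundle -/

section Realization

variable {ι : Type} [Fintype ι] [DecidableEq ι]

/-- `F = U ⧸ K` is the flag manifold `G ⧸ P_Θ` of `G`: the inclusion `U ≤ G` induces a
diffeomorphism `φ : U ⧸ K → G ⧸ P_Θ`. -/
def IsFlagIdentification {G U : Subgroup (GL ι ℂ)} (hU : U ≤ G) {K : Subgroup U} {P : Subgroup G}
    {f : ℕ} [ChartedSpace (EuclideanSpace ℝ (Fin f)) (U ⧸ K)]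
    [ChartedSpace (EuclideanSpace ℝ (Fin f)) (G ⧸ P)]
    (φ : (U ⧸ K) ≃ₘ⟮𝓡 f, 𝓡 f⟯ (G ⧸ P)) : Prop :=
  ∀ u : U, φ (QuotientGroup.mk u) = QuotientGroup.mk (Subgroup.inclusion hU u)

/-- The diffeomorphism `j : G ⧸ Z → T^*F`, `F = U ⧸ K ≅ G ⧸ P_Θ`, realizes the cotangent bundle of
the flag manifold as `G ⧸ Z`. Identify `g Z` with the point `Ad(g) H` of the adjoint orbit of `H`.
* `proj`: `j` covers the canonical projection `G ⧸ Z → G ⧸ P_Θ`.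
* `equivariant`: `j` intertwines the action of `u ∈ U` on `G ⧸ Z` with the lift to `T^*F` of its
  action on `F`.
* `fiber`: on the fiber `H + 𝔫_Θ⁺` over the base point, `j` is a linear isomorphism onto the
  cotangent space. By equivariance `j` is then linear on every fiber `Ad(u)(H + 𝔫_Θ⁺)`, i.e. it is
  an isomorphism of vector bundles. -/
structure IsCotangentRealization {G U : Subgroup (GL ι ℂ)} (hU : U ≤ G) {K : Subgroup U}
    {Z P : Subgroup G} (H : Matrix ι ι ℂ) (𝔫 : Submodule ℂ (Matrix ι ι ℂ)) {f z : ℕ}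
    [ChartedSpace (EuclideanSpace ℝ (Fin f)) (U ⧸ K)] [IsManifold (𝓡 f) ∞ (U ⧸ K)]
    [ChartedSpace (EuclideanSpace ℝ (Fin f)) (G ⧸ P)]
    [ChartedSpace (EuclideanSpace ℝ (Fin z)) (G ⧸ Z)]
    (φ : (U ⧸ K) ≃ₘ⟮𝓡 f, 𝓡 f⟯ (G ⧸ P))
    (j : (G ⧸ Z) ≃ₘ⟮𝓡 z, (𝓡 f).prod 𝓘(ℝ, EuclideanSpace ℝ (Fin f) →L[ℝ] ℝ)⟯
      CotangentBundle (d := f) (U ⧸ K)) : Prop where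
  proj : ∀ g : G, φ (j (QuotientGroup.mk g)).proj = QuotientGroup.mk g
  equivariant : ∀ (u : U) (x : G ⧸ Z),
    j (Subgroup.inclusion hU u • x) = cotangentLift (fun y : U ⧸ K => u • y) (j x)
  fiber : ∃ L : 𝔫 ≃ₗ[ℝ] CotangentSpace (d := f) (U ⧸ K) (QuotientGroup.mk 1), ∀ X : 𝔫, ∃ g : G,
    ((g : GL ι ℂ) : Matrix ι ι ℂ) * H * (((g : GL ι ℂ)⁻¹ : GL ι ℂ) : Matrix ι ι ℂ) = H + X ∧
      j (QuotientGroup.mk g) = ⟨QuotientGroup.mk 1, L X⟩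

/-- Let `G` be a complex matrix group with Lie algebra `𝔤`, let `U ≤ G`, `K ≤ U`, `Z ≤ G`, and let
`H` be a matrix. The statement: `Z` is the centralizer of `H` in `G`; for their standard smooth
structures, `U ⧸ K` is the flag manifold `G ⧸ P_Θ` determined by `H`; `(U, K, σ)` and `(G, Z, σ)`
are symmetric spaces with the same `σ`, the conjugation by `exp H`; and the cotangent bundle of
`U ⧸ K` is realized as `G ⧸ Z`. -/
def IsSymmetricFlagWithSymmetricCotangent (G U K Z : Subgroup (GL ι ℂ))
    (𝔤 : LieSubalgebra ℂ (Matrix ι ι ℂ)) (H : Matrix ι ι ℂ) : Prop :=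
  ∃ hU : U ≤ G, K ≤ U ∧ Z ≤ G ∧
  (∀ g ∈ G, g ∈ Z ↔ (g : Matrix ι ι ℂ) * H = H * (g : Matrix ι ι ℂ)) ∧
  ∃ (dG dU f z : ℕ)
    (_ : ChartedSpace (EuclideanSpace ℝ (Fin dG)) G)
    (_ : ChartedSpace (EuclideanSpace ℝ (Fin dU)) U)
    (_ : ChartedSpace (EuclideanSpace ℝ (Fin f)) (U ⧸ K.subgroupOf U))
    (_ : ChartedSpace (EuclideanSpace ℝ (Fin f)) (G ⧸ parabolicSubgroup G 𝔤 H))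
    (_ : ChartedSpace (EuclideanSpace ℝ (Fin z)) (G ⧸ Z.subgroupOf G))
    (_ : IsManifold (𝓡 f) ∞ (U ⧸ K.subgroupOf U)),
    IsLinearLieGroup (d := dG) G ∧ IsLinearLieGroup (d := dU) U ∧
    IsHomogeneousManifold (d := dU) (e := f) U (K.subgroupOf U) ∧
    IsHomogeneousManifold (d := dG) (e := f) G (parabolicSubgroup G 𝔤 H) ∧
    IsHomogeneousManifold (d := dG) (e := z) G (Z.subgroupOf G) ∧
    (∃ s : U, ((s : GL ι ℂ) : Matrix ι ι ℂ) = NormedSpace.exp H ∧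
      IsSymmetricSpace (d := dU) U (K.subgroupOf U) (MulAut.conj s) ∧
      IsSymmetricSpace (d := dG) G (Z.subgroupOf G) (MulAut.conj (Subgroup.inclusion hU s))) ∧
    ∃ φ : (U ⧸ K.subgroupOf U) ≃ₘ⟮𝓡 f, 𝓡 f⟯ (G ⧸ parabolicSubgroup G 𝔤 H),
      IsFlagIdentification hU φ ∧
      ∃ j : (G ⧸ Z.subgroupOf G) ≃ₘ⟮𝓡 z, (𝓡 f).prod 𝓘(ℝ, EuclideanSpace ℝ (Fin f) →L[ℝ] ℝ)⟯
          CotangentBundle (d := f) (U ⧸ K.subgroupOf U),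
        IsCotangentRealization hU H (nilradical 𝔤 H) φ j

end Realization

/-! ### The classical groups -/

section Groups

/-- `SL(n, ℂ)`. -/
def SL (ι : Type) [Fintype ι] [DecidableEq ι] : Subgroup (GL ι ℂ) :=
  (Matrix.GeneralLinearGroup.det : GL ι ℂ →* ℂˣ).ker

/-- `U(n)`. -/
def U (ι : Type) [Fintype ι] [DecidableEq ι] : Subgroup (GL ι ℂ) :=
  (Matrix.unitaryGroup ι ℂ).units

/-- `SU(n)`. -/
def SU (ι : Type) [Fintype ι] [DecidableEq ι] : Subgroup (GL ι ℂ) :=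
  (Matrix.specialUnitaryGroup ι ℂ).units

/-- `Sp(l, ℂ)`. -/
def SpC (l : ℕ) : Subgroup (GL (Fin l ⊕ Fin l) ℂ) :=
  (Matrix.symplecticGroup (Fin l) ℂ).units

/-- The compact group `Sp(l) = Sp(l, ℂ) ∩ SU(2l)`. -/
def SpCompact (l : ℕ) : Subgroup (GL (Fin l ⊕ Fin l) ℂ) :=
  SpC l ⊓ SU (Fin l ⊕ Fin l)

/-- The complex special orthogonal group `SO(2l, ℂ)`: `A Aᵀ = 1` and `det A = 1`. -/
def SOC (l : ℕ) : Subgroup (GL (Fin l ⊕ Fin l) ℂ) :=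
  (Matrix.specialOrthogonalGroup (Fin l ⊕ Fin l) ℂ).units

/-- The compact group `SO(2l)` of real special orthogonal matrices, seen as complex matrices. -/
def SOR (l : ℕ) : Subgroup (GL (Fin l ⊕ Fin l) ℂ) :=
  ((Matrix.specialOrthogonalGroup (Fin l ⊕ Fin l) ℝ).map Complex.ofRealHom.mapMatrix).units

/-- `(a, d) ↦ diag(a, d)`, from `GL(m, ℂ) × GL(n, ℂ)` to `GL(m + n, ℂ)`. -/
def blockDiag (m n : Type) [Fintype m] [DecidableEq m] [Fintype n] [DecidableEq n] :
    GL m ℂ × GL n ℂ →* GL (m ⊕ n) ℂ where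
  toFun x :=
    { val := Matrix.fromBlocks x.1 0 0 x.2
      inv := Matrix.fromBlocks (x.1⁻¹ : GL m ℂ) 0 0 (x.2⁻¹ : GL n ℂ)
      val_inv := by
        simp only [Matrix.fromBlocks_multiply, Units.mul_inv, Matrix.mul_zero, Matrix.zero_mul,
          add_zero, zero_add, Matrix.fromBlocks_one]
      inv_val := by
        simp only [Matrix.fromBlocks_multiply, Units.inv_mul, Matrix.mul_zero, Matrix.zero_mul,
          add_zero, zero_add, Matrix.fromBlocks_one] }
  map_one' := by ext1; simp
  map_mul' x y := by ext1; simp [Matrix.fromBlocks_multiply]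

/-- `S(GL(p, ℂ) × GL(q, ℂ))`: block diagonal matrices of determinant one. -/
def SGLGL (p q : ℕ) : Subgroup (GL (Fin p ⊕ Fin q) ℂ) :=
  (blockDiag (Fin p) (Fin q)).range ⊓ SL (Fin p ⊕ Fin q)

/-- `S(U(p) × U(q))`: block diagonal matrices with unitary blocks and determinant one. -/
def SUU (p q : ℕ) : Subgroup (GL (Fin p ⊕ Fin q) ℂ) :=
  ((U (Fin p)).prod (U (Fin q))).map (blockDiag (Fin p) (Fin q)) ⊓ SL (Fin p ⊕ Fin q)

/-- The contragredient automorphism `a ↦ (aᵀ)⁻¹` of `GL(n, ℂ)`. -/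
def contragredient (n : Type) [Fintype n] [DecidableEq n] : GL n ℂ →* GL n ℂ where
  toFun a :=
    { val := Matrix.transpose (a⁻¹ : GL n ℂ)
      inv := Matrix.transpose a
      val_inv := by rw [← Matrix.transpose_mul, Units.mul_inv, Matrix.transpose_one]
      inv_val := by rw [← Matrix.transpose_mul, Units.inv_mul, Matrix.transpose_one] }
  map_one' := by ext1; simp
  map_mul' x y := by
    ext1
    simp only [mul_inv_rev, Units.val_mul, Matrix.transpose_mul]

/-- The standard embedding `a ↦ diag(a, (aᵀ)⁻¹)` of `GL(l, ℂ)` into `Sp(l, ℂ)`. -/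
def glToSp (l : ℕ) : GL (Fin l) ℂ →* GL (Fin l ⊕ Fin l) ℂ :=
  (blockDiag (Fin l) (Fin l)).comp
    ((MonoidHom.id (GL (Fin l) ℂ)).prod (contragredient (Fin l)))

/-- The change of basis `(i, 1; 1, i)`: up to a scalar, it turns the standard quadratic form on
`ℂ^(2l)` into the split one. -/
def cayley (l : ℕ) : GL (Fin l ⊕ Fin l) ℂ where
  val := Matrix.fromBlocks (Complex.I • 1) 1 1 (Complex.I • 1)
  inv := (1 / 2 : ℂ) • Matrix.fromBlocks (-Complex.I • 1) 1 1 (-Complex.I • 1)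
  val_inv := by
    rw [Matrix.mul_smul, Matrix.fromBlocks_multiply, ← Matrix.fromBlocks_one,
      Matrix.fromBlocks_smul]
    congr 1 <;> simp [← two_smul ℂ, smul_smul]
  inv_val := by
    rw [Matrix.smul_mul, Matrix.fromBlocks_multiply, ← Matrix.fromBlocks_one,
      Matrix.fromBlocks_smul]
    congr 1 <;> simp [← two_smul ℂ, smul_smul]

/-- The standard embedding of `GL(l, ℂ)` into `SO(2l, ℂ)`,
`A ↦ f⁻¹ diag(A, (Aᵀ)⁻¹) f` with `f = cayley l`. It sends a unitary matrix `a + i b` (`a`, `b` real)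
to the real matrix `(a, b; -b, a)`. -/
def glToSO (l : ℕ) : GL (Fin l) ℂ →* GL (Fin l ⊕ Fin l) ℂ :=
  (MulAut.conj (cayley l)⁻¹).toMonoidHom.comp (glToSp l)

/-- The element `(i π / (p + q)) diag(q I_p, -p I_q)` of `su(p + q)`. -/
def HA (p q : ℕ) : Matrix (Fin p ⊕ Fin q) (Fin p ⊕ Fin q) ℂ :=
  (Complex.I * Real.pi / (p + q)) • Matrix.fromBlocks ((q : ℂ) • 1) 0 0 (-(p : ℂ) • 1)

/-- The element `(i π / 2) diag(I_l, -I_l)` of `sp(l)`. -/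
def HC (l : ℕ) : Matrix (Fin l ⊕ Fin l) (Fin l ⊕ Fin l) ℂ :=
  (Complex.I * Real.pi / 2) • Matrix.fromBlocks 1 0 0 (-1)

/-- The element `(π / 2) (0, I_l; -I_l, 0)` of `so(2l)`. -/
def HD (l : ℕ) : Matrix (Fin l ⊕ Fin l) (Fin l ⊕ Fin l) ℂ :=
  (Real.pi / 2 : ℂ) • Matrix.fromBlocks 0 1 (-1) 0

end Groups

end FlagCotangent

end

/-!
In each of the three cases `H = iπE + c` for a Hermitian idempotent `E` and a scalar `c`. Hence
`ad (-iH)` has the eigenvalues `0` and `±π`, with `𝔫⁺ = E 𝔤 (1 - E)`, and `𝔭` consists of the elements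
of `𝔤` which preserve the range of `E`. The groups `Z` and `K` are the centralizers of `E` in `G` and
`U`, and `P` is the stabilizer of the range of `E` (`IsSymmetricDatum.mem_parabolicSubgroup`), so that
`G ⧸ P` is the orbit of the range of `E`, and `G ⧸ Z` the orbit of `E`.

*Smooth structures.* A group whose Lie algebra is described by the exponential near `0` has
logarithmic charts (`HasExpLieAlgebra`). On the big cell, where `E g E` is invertible on the range
of `E`, one has `g = (1 + Y) (1 + X) z` with `Y ∈ (1 - E) 𝔤 E`, `X ∈ E 𝔤 (1 - E)` and `z` commuting
with `E`. Then `Y` is a coordinate on `G ⧸ P`, and `(X, Y)` is one on `G ⧸ Z` (`FlagDatum.flagCoord`,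
`FlagDatum.orbitCosetCoord`); a coordinate near the base point with a global section gives the
structure of a homogeneous manifold (`CosetCoord.isHomogeneousManifold`). The map `U ⧸ K → G ⧸ P` is
injective because a unitary matrix preserving the range of `E` commutes with `E`. Its image is closed
since `U` is compact, and open since `𝔤 = 𝔲 + 𝔭`, so that it is onto the connected space `G ⧸ P`
(`FlagDatum.exists_flagHomeo`); `U ⧸ K` gets the transported charts.

*The cotangent bundle.* For `g ∈ G` let `u ∈ U` represent the point `g P` of the flag manifold. Then
`u⁻¹ g` preserves the range of `E`, and `(u⁻¹ g) E (u⁻¹ g)⁻¹ = E + N` with `N ∈ E 𝔤 (1 - E)`. The real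
trace form pairs this block with the tangent space `(1 - E) 𝔤 E`, perfectly because the two blocks
are exchanged by the adjoint, and `j (g Z)` is the functional given by `N` at `u K`. The coordinate
changes and the action of `U` are compatible with this because the transpose of the differential of a
left translation is a conjugation (`FlagDatum.hasFDerivAt_translate`). In the charts `j` is
`(X, Y) ↦ (Y, -X - (1 + Y* Y)⁻¹ Y*)`, up to the pairing: the second term is the upper block of the
Hermitian idempotent onto the graph of `Y`. So `j` is a diffeomorphism
(`FlagDatum.exists_cotangentRealization`).

*Symmetric spaces.* `exp H` is a multiple of the reflection `1 - 2E`, so conjugation by it is an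
involution whose fixed points are the elements commuting with `E`
(`IsSymmetricDatum.isSymmetricSpace`).

*The classical groups.* `SL` and the isometry groups of a bilinear form given by a real orthogonal
matrix are stable under the adjoint. The polar decomposition shows that such a group is connected if
and only if its unitary part is (`IsSelfAdjointGroup.isConnected_unitary`,
`IsSelfAdjointGroup.isConnected_of_unitary`). `SL` is a retract of `GL`, and any two points of `GL` lie
on a complex line which meets the singular matrices in finitely many points. A symplectic matrix is
moved into the big cell by a unipotent one (`exists_isSymm_isUnit_add_mul`). The real special
orthogonal group is generated by products of two reflections. In the symplectic and orthogonal cases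
the adjoint of `E` with respect to the form is `1 - E`, that is, the range and the kernel of `E` are
isotropic (`flagDatum_specialIsometryGroup`).
-/

set_option linter.unusedSectionVars false

noncomputable section

namespace FlagCotangent

open Set Topology Filter

/-! ### Coordinates on coset spaces -/

section CosetCoord

/-- A coordinate system on an open neighbourhood of the base point of `Γ ⧸ H` in the form of a
right `H`-invariant smooth map `coord` on an open subset `dom` of the Lie group `Γ`, together with a
smooth section `sec` which is defined on the whole model space. -/
structure CosetCoord {d : ℕ} (e : ℕ) (Γ : Type) [Group Γ] [TopologicalSpace Γ]
    [ChartedSpace (EuclideanSpace ℝ (Fin d)) Γ] (H : Subgroup Γ) where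
  dom : Set Γ
  coord : Γ → EuclideanSpace ℝ (Fin e)
  sec : EuclideanSpace ℝ (Fin e) → Γ
  isOpen_dom : IsOpen dom
  one_mem : 1 ∈ dom
  mul_mem : ∀ g ∈ dom, ∀ h ∈ H, g * h ∈ dom
  coord_mul : ∀ g ∈ dom, ∀ h ∈ H, coord (g * h) = coord g
  contMDiffOn_coord : ContMDiffOn (𝓡 d) (𝓡 e) ∞ coord dom
  contMDiff_sec : ContMDiff (𝓡 e) (𝓡 d) ∞ sec
  sec_mem : ∀ y, sec y ∈ dom
  coord_sec : ∀ y, coord (sec y) = y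
  mk_sec_coord : ∀ g ∈ dom, (sec (coord g) : Γ ⧸ H) = g

namespace CosetCoord

variable {d e : ℕ} {Γ : Type} [Group Γ] [TopologicalSpace Γ]
  [ChartedSpace (EuclideanSpace ℝ (Fin d)) Γ] {H : Subgroup Γ}
  (C : CosetCoord (d := d) e Γ H)

lemma mul_mem_iff {g h : Γ} (hh : h ∈ H) : g * h ∈ C.dom ↔ g ∈ C.dom :=
  ⟨fun hg => by simpa using C.mul_mem _ hg _ (H.inv_mem hh), fun hg => C.mul_mem _ hg _ hh⟩

lemma mul_out_mem_iff (g₀ g : Γ) :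
    g₀⁻¹ * (g : Γ ⧸ H).out ∈ C.dom ↔ g₀⁻¹ * g ∈ C.dom := by
  obtain ⟨h, hh⟩ := QuotientGroup.mk_out_eq_mul H g
  rw [hh, ← mul_assoc, C.mul_mem_iff h.2]

lemma coord_mul_out (g₀ g : Γ) (hg : g₀⁻¹ * g ∈ C.dom) :
    C.coord (g₀⁻¹ * (g : Γ ⧸ H).out) = C.coord (g₀⁻¹ * g) := by
  obtain ⟨h, hh⟩ := QuotientGroup.mk_out_eq_mul H g
  rw [hh, ← mul_assoc, C.coord_mul _ hg _ h.2]

variable [LieGroup (𝓡 d) ∞ Γ]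

/-- The chart of `Γ ⧸ H` around `g₀ H` obtained by left translation by `g₀`. -/
def chart (g₀ : Γ) : OpenPartialHomeomorph (Γ ⧸ H) (EuclideanSpace ℝ (Fin e)) where
  toFun x := C.coord (g₀⁻¹ * x.out)
  invFun y := ((g₀ * C.sec y : Γ) : Γ ⧸ H)
  source := {x | g₀⁻¹ * x.out ∈ C.dom}
  target := univ
  map_source' _ _ := mem_univ _
  map_target' y _ := by
    simp only [mem_ofPred_eq, mul_out_mem_iff, inv_mul_cancel_left]
    exact C.sec_mem y
  left_inv' x hx := by
    induction x using QuotientGroup.induction_on with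
    | H g =>
      rw [mem_ofPred_eq, mul_out_mem_iff] at hx
      rw [coord_mul_out _ _ _ hx]
      have := C.mk_sec_coord _ hx
      rw [QuotientGroup.eq] at this ⊢
      simpa [mul_assoc] using this
  right_inv' y _ := by
    rw [coord_mul_out] <;> rw [inv_mul_cancel_left]
    · exact C.coord_sec y
    · exact C.sec_mem y
  open_source := by
    have := topologicalGroup_of_lieGroup (G := Γ) (𝓡 d) ∞
    rw [← QuotientGroup.isOpenQuotientMap_mk.isQuotientMap.isOpen_preimage]
    have : (QuotientGroup.mk ⁻¹' {x : Γ ⧸ H | g₀⁻¹ * x.out ∈ C.dom}) =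
        (fun g => g₀⁻¹ * g) ⁻¹' C.dom := by
      ext g; simp only [mem_preimage, mem_ofPred_eq, mul_out_mem_iff]
    rw [this]
    exact C.isOpen_dom.preimage (continuous_const_mul _)
  open_target := isOpen_univ
  continuousOn_toFun := by
    have := topologicalGroup_of_lieGroup (G := Γ) (𝓡 d) ∞
    intro x hx
    induction x using QuotientGroup.induction_on with
    | H g =>
    have hx' := hx
    rw [mem_ofPred_eq, mul_out_mem_iff] at hx'
    apply ContinuousAt.continuousWithinAt
    rw [ContinuousAt, QuotientGroup.nhds_eq, Filter.tendsto_map'_iff]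
    have h1 : ContinuousAt (fun v => C.coord (g₀⁻¹ * v)) g :=
      ContinuousAt.comp' (C.contMDiffOn_coord.continuousOn.continuousAt
        (C.isOpen_dom.mem_nhds hx')) (continuous_const_mul _).continuousAt
    rw [coord_mul_out _ _ _ hx']
    refine h1.tendsto.congr' ?_
    filter_upwards [(continuous_const_mul g₀⁻¹).continuousAt.preimage_mem_nhds
      (C.isOpen_dom.mem_nhds hx')] with v hv
    exact (coord_mul_out _ _ _ hv).symm
  continuousOn_invFun := by
    have := topologicalGroup_of_lieGroup (G := Γ) (𝓡 d) ∞
    exact (QuotientGroup.continuous_mk.comp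
      (continuous_const.mul C.contMDiff_sec.continuous)).continuousOn

lemma mk_mem_chart_source {g₀ g : Γ} :
    (g : Γ ⧸ H) ∈ (C.chart g₀).source ↔ g₀⁻¹ * g ∈ C.dom := C.mul_out_mem_iff g₀ g

lemma chart_mk {g₀ g : Γ} (hg : g₀⁻¹ * g ∈ C.dom) :
    C.chart g₀ (g : Γ ⧸ H) = C.coord (g₀⁻¹ * g) := C.coord_mul_out g₀ g hg

lemma chart_symm_apply (g₀ : Γ) (y) : (C.chart g₀).symm y = ((g₀ * C.sec y : Γ) : Γ ⧸ H) := rfl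

/-- The charts on `Γ ⧸ H` given by a coset coordinate system; `rep` selects the translation used
for the preferred chart at a point. -/
@[reducible]
def chartedSpace (rep : Γ ⧸ H → Γ) (hrep : ∀ x, (rep x : Γ ⧸ H) = x) :
    ChartedSpace (EuclideanSpace ℝ (Fin e)) (Γ ⧸ H) where
  atlas := range C.chart
  chartAt x := C.chart (rep x)
  mem_chart_source x := by
    have h : (rep x : Γ ⧸ H) ∈ (C.chart (rep x)).source := by
      rw [mk_mem_chart_source, inv_mul_cancel]
      exact C.one_mem
    rwa [hrep] at h
  chart_mem_atlas x := mem_range_self _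

section Manifold

variable (rep : Γ ⧸ H → Γ) (hrep : ∀ x, (rep x : Γ ⧸ H) = x)

lemma contMDiffOn_translate (g₀ : Γ) :
    ContMDiffOn (𝓡 d) (𝓡 e) ∞ (fun g => C.coord (g₀⁻¹ * g)) ((fun g => g₀⁻¹ * g) ⁻¹' C.dom) :=
  C.contMDiffOn_coord.comp (contMDiff_mul_left.contMDiffOn) (fun _ h => h)

lemma isManifold : letI := C.chartedSpace rep hrep; IsManifold (𝓡 e) ∞ (Γ ⧸ H) := by
  let := C.chartedSpace rep hrep
  refine isManifold_of_contDiffOn _ _ _ ?_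
  rintro _ _ ⟨g₀, rfl⟩ ⟨g₁, rfl⟩
  simp only [modelWithCornersSelf_coe, Function.id_comp, modelWithCornersSelf_coe_symm,
    Function.comp_id, preimage_id_eq, id_eq, range_id, inter_univ]
  rw [← contMDiffOn_iff_contDiffOn]
  have h : ContMDiffOn (𝓡 e) (𝓡 e) ∞ (fun y => C.coord (g₁⁻¹ * (g₀ * C.sec y)))
      ((fun y => g₀ * C.sec y) ⁻¹' ((fun g => g₁⁻¹ * g) ⁻¹' C.dom)) :=
    (C.contMDiffOn_translate g₁).comp (contMDiff_mul_left.comp C.contMDiff_sec).contMDiffOn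
      (fun _ h => h)
  refine (h.mono ?_).congr ?_
  · rintro y ⟨-, hy⟩
    exact C.mk_mem_chart_source.1 hy
  · rintro y ⟨-, hy⟩
    exact C.chart_mk (C.mk_mem_chart_source.1 hy)

lemma chart_mem_maximalAtlas (g₀ : Γ) :
    letI := C.chartedSpace rep hrep
    C.chart g₀ ∈ IsManifold.maximalAtlas (𝓡 e) ∞ (Γ ⧸ H) := by
  let := C.chartedSpace rep hrep
  have := C.isManifold rep hrep
  exact IsManifold.subset_maximalAtlas (mem_range_self g₀)

lemma contMDiffOn_chart (g₀ : Γ) :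
    letI := C.chartedSpace rep hrep
    ContMDiffOn (𝓡 e) (𝓡 e) ∞ (C.chart g₀) (C.chart g₀).source := by
  let := C.chartedSpace rep hrep
  have := C.isManifold rep hrep
  exact contMDiffOn_of_mem_maximalAtlas (C.chart_mem_maximalAtlas rep hrep g₀)

lemma contMDiff_chart_symm (g₀ : Γ) :
    letI := C.chartedSpace rep hrep
    ContMDiff (𝓡 e) (𝓡 e) ∞ (C.chart g₀).symm := by
  let := C.chartedSpace rep hrep
  have := C.isManifold rep hrep
  exact contMDiffOn_univ.1
    (contMDiffOn_symm_of_mem_maximalAtlas (C.chart_mem_maximalAtlas rep hrep g₀))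

lemma contMDiff_mk :
    letI := C.chartedSpace rep hrep
    ContMDiff (𝓡 d) (𝓡 e) ∞ (QuotientGroup.mk : Γ → Γ ⧸ H) := by
  let := C.chartedSpace rep hrep
  have := C.isManifold rep hrep
  have := topologicalGroup_of_lieGroup (G := Γ) (𝓡 d) ∞
  intro g
  have hmem : (fun v => g⁻¹ * v) ⁻¹' C.dom ∈ 𝓝 g := by
    refine (continuous_const_mul g⁻¹).continuousAt.preimage_mem_nhds (C.isOpen_dom.mem_nhds ?_)
    rw [inv_mul_cancel]
    exact C.one_mem
  have h1 := (C.contMDiff_chart_symm rep hrep g).contMDiffAt.comp g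
    ((C.contMDiffOn_translate g).contMDiffAt hmem)
  refine h1.congr_of_eventuallyEq ?_
  filter_upwards [hmem] with v hv
  rw [Function.comp_apply, ← C.chart_mk hv, OpenPartialHomeomorph.left_inv]
  exact C.mk_mem_chart_source.2 hv

/-- A map out of `Γ ⧸ H` is smooth when its composition with the projection is. -/
lemma contMDiff_of_comp_mk {EN HN N : Type*} [NormedAddCommGroup EN] [NormedSpace ℝ EN]
    [TopologicalSpace HN] {J : ModelWithCorners ℝ EN HN} [TopologicalSpace N] [ChartedSpace HN N]
    {f : Γ ⧸ H → N} (hf : ContMDiff (𝓡 d) J ∞ (fun g : Γ => f g)) :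
    letI := C.chartedSpace rep hrep
    ContMDiff (𝓡 e) J ∞ f := by
  let := C.chartedSpace rep hrep
  have := C.isManifold rep hrep
  intro x
  induction x using QuotientGroup.induction_on with
  | H g =>
  have hx : (g : Γ ⧸ H) ∈ (C.chart g).source := by
    rw [C.mk_mem_chart_source, inv_mul_cancel]
    exact C.one_mem
  have hn := (C.chart g).open_source.mem_nhds hx
  have h1 : ContMDiffAt (𝓡 e) (𝓡 d) ∞ (fun x => g * C.sec (C.chart g x)) (g : Γ ⧸ H) :=
    (contMDiff_mul_left.comp C.contMDiff_sec).contMDiffAt.comp _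
      ((C.contMDiffOn_chart rep hrep g).contMDiffAt hn)
  refine (hf.contMDiffAt.comp _ h1).congr_of_eventuallyEq ?_
  filter_upwards [hn] with v hv
  rw [Function.comp_apply, ← C.chart_symm_apply, OpenPartialHomeomorph.left_inv _ hv]

lemma isHomogeneousManifold :
    letI := C.chartedSpace rep hrep
    IsHomogeneousManifold (d := d) (e := e) Γ H := by
  let := C.chartedSpace rep hrep
  have := C.isManifold rep hrep
  refine ⟨this, C.contMDiff_mk rep hrep, fun g => ?_⟩
  -- `v ↦ g * s(v) * s(c(1))⁻¹` is a smooth section through `g`, since `s(c(1)) ∈ H`.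
  set y₀ := C.coord 1
  have hy₀ : C.sec y₀ ∈ H := by
    have := C.mk_sec_coord 1 C.one_mem
    rwa [QuotientGroup.eq, mul_one, H.inv_mem_iff] at this
  set S : EuclideanSpace ℝ (Fin e) → Γ := fun y => g * C.sec y * (C.sec y₀)⁻¹
  have hS : ContMDiff (𝓡 e) (𝓡 d) ∞ S :=
    (contMDiff_mul_left.comp C.contMDiff_sec).mul contMDiff_const
  have hS₀ : S y₀ = g := by simp [S]
  have hmk : (QuotientGroup.mk ∘ S : _ → Γ ⧸ H) = (C.chart g).symm := by
    ext1 y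
    rw [C.chart_symm_apply, Function.comp_apply, QuotientGroup.eq]
    simpa [S, mul_assoc] using hy₀
  have hsurj : Function.Surjective (mfderiv (𝓡 e) (𝓡 e) (C.chart g).symm y₀) :=
    (((mdifferentiable_of_mem_atlas (mem_range_self g))).symm).mfderiv_surjective (mem_univ _)
  rw [← hmk, mfderiv_comp_of_eq (x := y₀) (y := g)
    ((C.contMDiff_mk rep hrep).mdifferentiableAt (by simp))
    (hS.mdifferentiableAt (by simp)) hS₀] at hsurj
  rw [← hS₀]
  exact Function.Surjective.of_comp hsurj

end Manifold

end CosetCoord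

end CosetCoord

/-! ### Transport of smooth structures along homeomorphisms -/

section Transport

variable {f : ℕ} {M N : Type} [TopologicalSpace M] [TopologicalSpace N]
  [ChartedSpace (EuclideanSpace ℝ (Fin f)) N] (φ : M ≃ₜ N)

/-- The charts on `M` obtained from charts on `N` by composition with a homeomorphism. -/
@[reducible]
def transportChartedSpace : ChartedSpace (EuclideanSpace ℝ (Fin f)) M where
  atlas := (fun c => φ.toOpenPartialHomeomorph ≫ₕ c) '' atlas (EuclideanSpace ℝ (Fin f)) N
  chartAt x := φ.toOpenPartialHomeomorph ≫ₕ chartAt (EuclideanSpace ℝ (Fin f)) (φ x)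
  mem_chart_source x := by simp
  chart_mem_atlas x := mem_image_of_mem _ (chart_mem_atlas _ _)

variable [IsManifold (𝓡 f) ∞ N]

lemma isManifold_transport : letI := transportChartedSpace (f := f) φ; IsManifold (𝓡 f) ∞ M := by
  let := transportChartedSpace (f := f) φ
  refine isManifold_of_contDiffOn _ _ _ ?_
  rintro _ _ ⟨c, hc, rfl⟩ ⟨c', hc', rfl⟩
  have h := (contDiffGroupoid ∞ (𝓡 f)).compatible hc hc'
  rw [contDiffGroupoid, mem_groupoid_of_pregroupoid] at h
  refine (h.1.mono ?_).congr ?_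
  · intro y hy
    simpa using hy
  · intro y hy
    simp

/-- A homeomorphism is a diffeomorphism for the transported structure. -/
def transportDiffeomorph : letI := transportChartedSpace (f := f) φ; M ≃ₘ⟮𝓡 f, 𝓡 f⟯ N :=
  letI := transportChartedSpace (f := f) φ
  haveI := isManifold_transport (f := f) φ
  { toEquiv := φ.toEquiv
    contMDiff_toFun := by
      intro x
      have hx : φ x ∈ (chartAt (EuclideanSpace ℝ (Fin f)) (φ x)).source := mem_chart_source _ _
      have h1 : ContMDiffAt (𝓡 f) (𝓡 f) ∞ (chartAt (EuclideanSpace ℝ (Fin f)) x) x :=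
        contMDiffOn_chart.contMDiffAt (chart_source_mem_nhds _ x)
      have h2 : ContMDiffAt (𝓡 f) (𝓡 f) ∞ (chartAt (EuclideanSpace ℝ (Fin f)) (φ x)).symm
          (chartAt (EuclideanSpace ℝ (Fin f)) x x) :=
        contMDiffOn_chart_symm.contMDiffAt (chart_target_mem_nhds _ (φ x))
      refine (h2.comp x h1).congr_of_eventuallyEq ?_
      filter_upwards [φ.continuous.continuousAt.preimage_mem_nhds
        (chart_source_mem_nhds (EuclideanSpace ℝ (Fin f)) (φ x))] with v hv
      exact ((chartAt (EuclideanSpace ℝ (Fin f)) (φ x)).left_inv hv).symm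
    contMDiff_invFun := by
      intro x
      have hc : chartAt (EuclideanSpace ℝ (Fin f)) (φ.symm x) =
          φ.toOpenPartialHomeomorph ≫ₕ chartAt (EuclideanSpace ℝ (Fin f)) x := by
        change _ ≫ₕ chartAt _ (φ (φ.symm x)) = _
        rw [φ.apply_symm_apply]
      have h1 : ContMDiffAt (𝓡 f) (𝓡 f) ∞ (chartAt (EuclideanSpace ℝ (Fin f)) x) x :=
        contMDiffOn_chart.contMDiffAt (chart_source_mem_nhds _ x)
      have h2 : ContMDiffAt (𝓡 f) (𝓡 f) ∞ (chartAt (EuclideanSpace ℝ (Fin f)) (φ.symm x)).symm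
          (chartAt (EuclideanSpace ℝ (Fin f)) x x) := by
        refine contMDiffOn_chart_symm.contMDiffAt
          ((OpenPartialHomeomorph.open_target _).mem_nhds ?_)
        rw [hc]
        simp
      refine (h2.comp x h1).congr_of_eventuallyEq ?_
      filter_upwards [chart_source_mem_nhds (EuclideanSpace ℝ (Fin f)) x] with v hv
      rw [hc]
      simp [hv] }

end Transport

/-! ### Linear Lie groups through the exponential map -/

section Exponential

variable {A : Type} [NormedRing A] [NormedAlgebra ℝ A] [CompleteSpace A]

lemma exp_mul_exp_neg (X : A) : NormedSpace.exp X * NormedSpace.exp (-X) = 1 := by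
  let := NormedAlgebra.restrictScalars ℚ ℝ A
  rw [← NormedSpace.exp_add_of_commute (Commute.refl X).neg_right, add_neg_cancel,
    NormedSpace.exp_zero]

/-- The exponential as a unit. -/
def expUnit (X : A) : Aˣ where
  val := NormedSpace.exp X
  inv := NormedSpace.exp (-X)
  val_inv := exp_mul_exp_neg X
  inv_val := by simpa using exp_mul_exp_neg (-X)

@[simp] lemma val_expUnit (X : A) : (expUnit X : A) = NormedSpace.exp X := rfl

lemma contDiff_exp : ContDiff ℝ ω (NormedSpace.exp : A → A) :=
  contDiff_iff_contDiffAt.2 fun x => (NormedSpace.exp_analytic (𝕂 := ℝ) x).contDiffAt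

/-- The exponential is a diffeomorphism from arbitrarily small neighbourhoods of `0`. -/
lemma exists_local_log {s : Set A} (hs : s ∈ 𝓝 (0 : A)) :
    ∃ ℓ : OpenPartialHomeomorph A A, (∀ X, ℓ X = NormedSpace.exp X) ∧ 0 ∈ ℓ.source ∧
      ℓ.source ⊆ s ∧ ContDiffOn ℝ ∞ ℓ.symm ℓ.target := by
  have h0 : HasFDerivAt (NormedSpace.exp : A → A)
      ((ContinuousLinearEquiv.refl ℝ A : A ≃L[ℝ] A) : A →L[ℝ] A) 0 :=
    hasFDerivAt_exp_zero (𝕂 := ℝ)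
  have hc : ContDiffAt ℝ ω (NormedSpace.exp : A → A) 0 := contDiff_exp.contDiffAt
  set L := hc.toOpenPartialHomeomorph (NormedSpace.exp : A → A) h0 (by simp)
  have h0L : (0 : A) ∈ L.source := hc.mem_toOpenPartialHomeomorph_source h0 (by simp)
  have h1L : NormedSpace.exp (0 : A) ∈ L.target :=
    hc.image_mem_toOpenPartialHomeomorph_target h0 (by simp)
  have hsm : ContDiffAt ℝ ω L.symm (NormedSpace.exp (0 : A)) := hc.to_localInverse h0 (by simp)
  have hev := hsm.eventually (by simp)
  have h2 : ∀ᶠ X in 𝓝 (0 : A), ContDiffAt ℝ ω L.symm (NormedSpace.exp X) :=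
    contDiff_exp.continuous.continuousAt.eventually hev
  obtain ⟨t, hts, hto, h0t⟩ := mem_nhds_iff.1 (inter_mem hs h2)
  refine ⟨L.restrOpen t hto, fun X => rfl, ⟨h0L, h0t⟩, fun X hX => (hts hX.2).1, ?_⟩
  intro y hy
  have hy1 : y ∈ L.target := hy.1
  have hy2 : L.symm y ∈ t := hy.2
  have h3 := (hts hy2).2
  have : NormedSpace.exp (L.symm y) = y := L.right_inv hy1
  rw [mem_ofPred_eq, this] at h3
  exact (h3.of_le (by simp)).contDiffWithinAt

/-- The real subspace `𝔥` is the Lie algebra of the matrix group `Γ` in the strong sense that, near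
`0`, the exponential maps exactly `𝔥` into `Γ`. -/
structure HasExpLieAlgebra (Γ : Subgroup Aˣ) (𝔥 : Submodule ℝ A) : Prop where
  exp_mem : ∀ X ∈ 𝔥, expUnit X ∈ Γ
  mem_of_exp : ∀ᶠ X in 𝓝 (0 : A), expUnit X ∈ Γ → X ∈ 𝔥

lemma HasExpLieAlgebra.inf {Γ Γ' : Subgroup Aˣ} {𝔥 𝔥' : Submodule ℝ A}
    (h : HasExpLieAlgebra Γ 𝔥) (h' : HasExpLieAlgebra Γ' 𝔥') :
    HasExpLieAlgebra (Γ ⊓ Γ') (𝔥 ⊓ 𝔥') where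
  exp_mem X hX := ⟨h.exp_mem X hX.1, h'.exp_mem X hX.2⟩
  mem_of_exp := by
    filter_upwards [h.mem_of_exp, h'.mem_of_exp] with X h1 h2 h3
    exact ⟨h1 h3.1, h2 h3.2⟩

lemma exp_eventually_inj {σ τ : A → A} (hσ : ContinuousAt σ 0) (hτ : ContinuousAt τ 0)
    (hσ0 : σ 0 = 0) (hτ0 : τ 0 = 0) :
    ∀ᶠ X in 𝓝 (0 : A), NormedSpace.exp (σ X) = NormedSpace.exp (τ X) → σ X = τ X := by
  obtain ⟨ℓ, hℓ, h0, -, -⟩ := exists_local_log (A := A) univ_mem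
  have hn := ℓ.open_source.mem_nhds h0
  filter_upwards [hσ (by rwa [hσ0]), hτ (by rwa [hτ0])] with X h1 h2 h3
  rw [← hℓ, ← hℓ] at h3
  exact ℓ.injOn h1 h2 h3

end Exponential

namespace HasExpLieAlgebra

variable {A : Type} [NormedRing A] [NormedAlgebra ℝ A] [CompleteSpace A]
  [FiniteDimensional ℝ A] {Γ : Subgroup Aˣ} {𝔥 : Submodule ℝ A} (h : HasExpLieAlgebra Γ 𝔥)

/-- A local diffeomorphism given by the exponential, on a neighbourhood of `0` in which
only the elements of `𝔥` are mapped into `Γ`. -/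
def log (h : HasExpLieAlgebra Γ 𝔥) : OpenPartialHomeomorph A A :=
  (exists_local_log h.mem_of_exp).choose

lemma log_apply (X : A) : h.log X = NormedSpace.exp X :=
  (exists_local_log h.mem_of_exp).choose_spec.1 X

lemma zero_mem : (0 : A) ∈ h.log.source := (exists_local_log h.mem_of_exp).choose_spec.2.1

lemma mem_of_source {X : A} (hX : X ∈ h.log.source) (hm : expUnit X ∈ Γ) : X ∈ 𝔥 :=
  (exists_local_log h.mem_of_exp).choose_spec.2.2.1 hX hm

lemma contDiffOn_log : ContDiffOn ℝ ∞ h.log.symm h.log.target :=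
  (exists_local_log h.mem_of_exp).choose_spec.2.2.2

variable (𝔥) in
/-- Linear coordinates on `𝔥`. -/
def toEucl : 𝔥 ≃L[ℝ] EuclideanSpace ℝ (Fin (Module.finrank ℝ 𝔥)) :=
  ContinuousLinearEquiv.ofFinrankEq (by simp)

variable (𝔥) in
/-- The inclusion of `𝔥`, in linear coordinates. -/
def incl : EuclideanSpace ℝ (Fin (Module.finrank ℝ 𝔥)) →L[ℝ] A :=
  𝔥.subtypeL ∘L ((toEucl 𝔥).symm : _ →L[ℝ] 𝔥)

variable (𝔥) in
lemma exists_proj : ∃ p : A →ₗ[ℝ] EuclideanSpace ℝ (Fin (Module.finrank ℝ 𝔥)),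
    p ∘ₗ 𝔥.subtype = (toEucl 𝔥).toLinearEquiv.toLinearMap := LinearMap.exists_extend _

variable (𝔥) in
/-- A left inverse of the inclusion of `𝔥`. -/
def proj : A →L[ℝ] EuclideanSpace ℝ (Fin (Module.finrank ℝ 𝔥)) :=
  LinearMap.toContinuousLinearMap (exists_proj 𝔥).choose

variable (𝔥) in
lemma proj_coe (X : 𝔥) : proj 𝔥 (X : A) = toEucl 𝔥 X :=
  LinearMap.congr_fun (exists_proj 𝔥).choose_spec X

variable (𝔥) in
lemma incl_mem (w) : incl 𝔥 w ∈ 𝔥 := ((toEucl 𝔥).symm w).2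

variable (𝔥) in
lemma proj_incl (w) : proj 𝔥 (incl 𝔥 w) = w := by
  change proj 𝔥 (((toEucl 𝔥).symm w : 𝔥) : A) = w
  rw [proj_coe, ContinuousLinearEquiv.apply_symm_apply]

lemma incl_proj {X : A} (hX : X ∈ 𝔥) : incl 𝔥 (proj 𝔥 X) = X := by
  have := proj_coe 𝔥 ⟨X, hX⟩
  rw [Subtype.coe_mk] at this
  simp [incl, this]

variable (Γ) in
omit [NormedAlgebra ℝ A] [FiniteDimensional ℝ A] in
lemma isEmbedding_val : IsEmbedding (fun g : Γ => ((g : Aˣ) : A)) :=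
  Units.isOpenEmbedding_val.isEmbedding.comp IsEmbedding.subtypeVal

variable (Γ) in
omit [NormedAlgebra ℝ A] [CompleteSpace A] [FiniteDimensional ℝ A] in
@[fun_prop]
lemma continuous_val : Continuous (fun g : Γ => ((g : Aˣ) : A)) :=
  Units.continuous_val.comp continuous_subtype_val

/-- The exponential of an element of `𝔥` given by its coordinates, as an element of `Γ`. -/
def exp (w : EuclideanSpace ℝ (Fin (Module.finrank ℝ 𝔥))) : Γ :=
  ⟨expUnit (incl 𝔥 w), h.exp_mem _ (incl_mem 𝔥 w)⟩

lemma val_exp (w) : ((h.exp w : Aˣ) : A) = NormedSpace.exp (incl 𝔥 w) := rfl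

lemma incl_proj_log {g : Γ} (hg : ((g : Aˣ) : A) ∈ h.log.target) :
    incl 𝔥 (proj 𝔥 (h.log.symm ((g : Aˣ) : A))) = h.log.symm ((g : Aˣ) : A) := by
  apply incl_proj
  apply h.mem_of_source (h.log.map_target hg)
  have : expUnit (h.log.symm ((g : Aˣ) : A)) = (g : Aˣ) := by
    ext1
    rw [val_expUnit, ← h.log_apply, h.log.right_inv hg]
  rw [this]
  exact g.2

/-- Logarithmic coordinates around `g₀`. -/
def chart (g₀ : Γ) :
    OpenPartialHomeomorph Γ (EuclideanSpace ℝ (Fin (Module.finrank ℝ 𝔥))) where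
  toFun g := proj 𝔥 (h.log.symm ((g₀⁻¹ * g : Γ) : Aˣ))
  invFun w := g₀ * h.exp w
  source := {g | (((g₀⁻¹ * g : Γ) : Aˣ) : A) ∈ h.log.target}
  target := {w | incl 𝔥 w ∈ h.log.source}
  map_source' g hg := by
    rw [mem_ofPred_eq, h.incl_proj_log hg]
    exact h.log.map_target hg
  map_target' w hw := by
    rw [mem_ofPred_eq, inv_mul_cancel_left, val_exp, ← h.log_apply]
    exact h.log.map_source hw
  left_inv' g hg := by
    have : h.exp (proj 𝔥 (h.log.symm ((g₀⁻¹ * g : Γ) : Aˣ))) = g₀⁻¹ * g := by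
      ext1; ext1
      rw [val_exp, h.incl_proj_log hg, ← h.log_apply, h.log.right_inv hg]
    rw [this, mul_inv_cancel_left]
  right_inv' w hw := by
    rw [inv_mul_cancel_left, val_exp, ← h.log_apply, h.log.left_inv hw, proj_incl]
  open_source := h.log.open_target.preimage
    ((continuous_val Γ).comp (continuous_const_mul g₀⁻¹))
  open_target := h.log.open_source.preimage (incl 𝔥).continuous
  continuousOn_toFun := (proj 𝔥).continuous.comp_continuousOn
    (h.log.continuousOn_symm.comp ((continuous_val Γ).comp
      (continuous_const_mul g₀⁻¹)).continuousOn (fun _ hg => hg))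
  continuousOn_invFun := by
    refine (continuous_const.mul ?_).continuousOn
    rw [(isEmbedding_val Γ).continuous_iff]
    exact contDiff_exp.continuous.comp (incl 𝔥).continuous

lemma mem_chart_source_self (g : Γ) : g ∈ (h.chart g).source := by
  change (((g⁻¹ * g : Γ) : Aˣ) : A) ∈ h.log.target
  have := h.log.map_source h.zero_mem
  rw [h.log_apply, NormedSpace.exp_zero] at this
  simpa using this

/-- The charts given by logarithmic coordinates. -/
@[reducible]
def chartedSpace : ChartedSpace (EuclideanSpace ℝ (Fin (Module.finrank ℝ 𝔥))) Γ where
  atlas := range h.chart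
  chartAt g := h.chart g
  mem_chart_source g := h.mem_chart_source_self g
  chart_mem_atlas _ := mem_range_self _

lemma contDiffOn_chart_aux (g₀ : Γ) :
    ContDiffOn ℝ ∞ (fun a : A => proj 𝔥 (h.log.symm (((g₀⁻¹ : Γ) : Aˣ) * a)))
      ((fun a : A => (((g₀⁻¹ : Γ) : Aˣ) : A) * a) ⁻¹' h.log.target) :=
  (proj 𝔥).contDiff.comp_contDiffOn
    (h.contDiffOn_log.comp (contDiff_const.mul contDiff_id).contDiffOn fun _ ha => ha)

lemma isManifold : letI := h.chartedSpace; IsManifold (𝓡 (Module.finrank ℝ 𝔥)) ∞ Γ := by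
  let := h.chartedSpace
  refine isManifold_of_contDiffOn _ _ _ ?_
  rintro _ _ ⟨g₀, rfl⟩ ⟨g₁, rfl⟩
  simp only [modelWithCornersSelf_coe, Function.id_comp, modelWithCornersSelf_coe_symm,
    Function.comp_id, preimage_id_eq, id_eq, range_id, inter_univ]
  have h1 : ContDiff ℝ ∞ (fun w => ((g₀ : Aˣ) : A) * NormedSpace.exp (incl 𝔥 w)) :=
    contDiff_const.mul ((contDiff_exp.of_le (by simp)).comp (incl 𝔥).contDiff)
  refine ((h.contDiffOn_chart_aux g₁).comp h1.contDiffOn ?_)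
  rintro w ⟨-, hw⟩
  exact hw

lemma contMDiff_val :
    letI := h.chartedSpace
    ContMDiff (𝓡 (Module.finrank ℝ 𝔥)) 𝓘(ℝ, A) ∞ (fun g : Γ => ((g : Aˣ) : A)) := by
  let := h.chartedSpace
  have := h.isManifold
  intro g₀
  have h1 : ContDiff ℝ ∞ (fun w => ((g₀ : Aˣ) : A) * NormedSpace.exp (incl 𝔥 w)) :=
    contDiff_const.mul ((contDiff_exp.of_le (by simp)).comp (incl 𝔥).contDiff)
  refine (h1.contMDiff.contMDiffAt.comp g₀ (contMDiffOn_chart.contMDiffAt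
    (chart_source_mem_nhds _ g₀))).congr_of_eventuallyEq ?_
  filter_upwards [(h.chart g₀).open_source.mem_nhds (h.mem_chart_source_self g₀)] with g hg
  exact congrArg (fun g : Γ => ((g : Aˣ) : A)) ((h.chart g₀).left_inv hg).symm

section Universal

variable {E' H' M : Type*} [NormedAddCommGroup E'] [NormedSpace ℝ E'] [TopologicalSpace H']
  {J : ModelWithCorners ℝ E' H'} [TopologicalSpace M] [ChartedSpace H' M]

/-- Smoothness of maps into `Γ` can be checked in the ambient algebra. -/
lemma contMDiff_of_val {f : M → Γ}
    (hf : ContMDiff J 𝓘(ℝ, A) ∞ (fun x => ((f x : Aˣ) : A))) :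
    letI := h.chartedSpace
    ContMDiff J (𝓡 (Module.finrank ℝ 𝔥)) ∞ f := by
  let := h.chartedSpace
  intro x
  rw [contMDiffAt_iff_target]
  refine ⟨((isEmbedding_val Γ).continuous_iff.2 hf.continuous).continuousAt, ?_⟩
  have h1 := (h.contDiffOn_chart_aux (f x)).contMDiffOn.contMDiffAt
    (x := ((f x : Aˣ) : A)) ((h.log.open_target.preimage (continuous_const_mul _)).mem_nhds
      (h.mem_chart_source_self (f x)))
  exact ContMDiffAt.comp x (f := fun x => ((f x : Aˣ) : A)) h1 hf.contMDiffAt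

end Universal

lemma lieGroup : letI := h.chartedSpace; LieGroup (𝓡 (Module.finrank ℝ 𝔥)) ∞ Γ := by
  let := h.chartedSpace
  have := h.isManifold
  refine { contMDiff_mul := ?_, contMDiff_inv := ?_ }
  · refine h.contMDiff_of_val ?_
    exact (contDiff_mul (𝕜 := ℝ) (𝔸 := A)).contMDiff.comp
      ((h.contMDiff_val.comp contMDiff_fst).prodMk_space (h.contMDiff_val.comp contMDiff_snd))
  · refine h.contMDiff_of_val fun g => ?_
    have h1 : ContMDiffAt 𝓘(ℝ, A) 𝓘(ℝ, A) ∞ Ring.inverse ((g : Aˣ) : A) :=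
      (contDiffAt_ringInverse ℝ _).contMDiffAt
    refine (h1.comp g h.contMDiff_val.contMDiffAt).congr_of_eventuallyEq ?_
    exact Eventually.of_forall fun v => by simp

lemma injective_mfderiv_val (g : Γ) :
    letI := h.chartedSpace
    Function.Injective (mfderiv (𝓡 (Module.finrank ℝ 𝔥)) 𝓘(ℝ, A)
      (fun g : Γ => ((g : Aˣ) : A)) g) := by
  let := h.chartedSpace
  have := h.isManifold
  have h1 := (h.contDiffOn_chart_aux g).contMDiffOn.contMDiffAt
    (x := ((g : Aˣ) : A)) ((h.log.open_target.preimage (continuous_const_mul _)).mem_nhds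
      (h.mem_chart_source_self g))
  have h2 := mfderiv_comp g (h1.mdifferentiableAt (by simp))
    (h.contMDiff_val.mdifferentiableAt (x := g) (by simp))
  have h3 : Function.Injective (mfderiv (𝓡 (Module.finrank ℝ 𝔥)) (𝓡 (Module.finrank ℝ 𝔥))
      (h.chart g) g) :=
    (mdifferentiable_of_mem_atlas (mem_range_self g)).mfderiv_injective (h.mem_chart_source_self g)
  have h4 : (h.chart g : Γ → _) = (fun a : A => proj 𝔥 (h.log.symm (((g⁻¹ : Γ) : Aˣ) * a))) ∘
    (fun g : Γ => ((g : Aˣ) : A)) := rfl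
  rw [h4, h2] at h3
  exact Function.Injective.of_comp h3

end HasExpLieAlgebra

namespace HasExpLieAlgebra

variable {A : Type} [NormedRing A] [NormedAlgebra ℝ A] [CompleteSpace A]
  [FiniteDimensional ℝ A] {Γ : Subgroup Aˣ} {𝔥 : Submodule ℝ A} (h : HasExpLieAlgebra Γ 𝔥)
  {F : Type*} [NormedAddCommGroup F] [NormedSpace ℝ F]

/-- The restriction to `Γ` of a smooth map on the ambient algebra is smooth. -/
lemma contMDiffAt_comp_val {f : A → F} {g : Γ} (hf : ContDiffAt ℝ ∞ f ((g : Aˣ) : A)) :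
    letI := h.chartedSpace
    ContMDiffAt (𝓡 (Module.finrank ℝ 𝔥)) 𝓘(ℝ, F) ∞ (fun g : Γ => f ((g : Aˣ) : A)) g := by
  let := h.chartedSpace
  exact ContMDiffAt.comp (g := f) g hf.contMDiffAt h.contMDiff_val.contMDiffAt

lemma contMDiff_val_inv :
    letI := h.chartedSpace
    ContMDiff (𝓡 (Module.finrank ℝ 𝔥)) 𝓘(ℝ, A) ∞ (fun g : Γ => (((g : Aˣ)⁻¹ : Aˣ) : A)) := by
  let := h.chartedSpace
  have := h.lieGroup
  exact h.contMDiff_val.comp (contMDiff_inv (𝓡 (Module.finrank ℝ 𝔥)) ∞)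

end HasExpLieAlgebra

/-! ### The big cell of an idempotent -/

section BigCell

section Ring

variable {A : Type} [Ring A] {E : A}

/-- `Y` lies in the block `(1 - E) A E`. -/
structure IsLower (E Y : A) : Prop where
  left : E * Y = 0
  right : Y * E = Y

/-- `X` lies in the block `E A (1 - E)`. -/
structure IsUpper (E X : A) : Prop where
  left : E * X = X
  right : X * E = 0

namespace IsLower

variable {Y Y' : A}

lemma right_assoc (h : IsLower E Y) (x : A) : Y * (E * x) = Y * x := by
  rw [← mul_assoc, h.right]

lemma mul_eq_zero (h : IsLower E Y) (h' : IsLower E Y') : Y * Y' = 0 := by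
  rw [← h.right, mul_assoc, h'.left, mul_zero]

lemma mul_assoc_eq_zero (h : IsLower E Y) (h' : IsLower E Y') (x : A) : Y * (Y' * x) = 0 := by
  rw [← mul_assoc, h.mul_eq_zero h', zero_mul]

end IsLower

namespace IsUpper

variable {X X' : A}

lemma mul_eq_zero (h : IsUpper E X) (h' : IsUpper E X') : X * X' = 0 := by
  rw [← h'.left, ← mul_assoc, h.right, zero_mul]

end IsUpper

lemma idem_assoc (hE : E * E = E) (x : A) : E * (E * x) = E * x := by rw [← mul_assoc, hE]

/-- The part of `g` whose invertibility defines the big cell. -/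
def pivot (E g : A) : A := E * g * E + (1 - E)

/-- The coordinate of `g` on the big cell: the range of `g E` is the graph of this map. -/
def cellCoord (E g : A) : A := (1 - E) * g * E * Ring.inverse (pivot E g)

lemma pivot_mul_idem (hE : E * E = E) (g : A) : pivot E g * E = E * g * E := by
  simp [pivot, add_mul, sub_mul, mul_assoc, hE]

lemma idem_mul_pivot (hE : E * E = E) (g : A) : E * pivot E g = E * g * E := by
  simp [pivot, mul_add, mul_sub, mul_assoc, hE, idem_assoc hE]

lemma inverse_pivot_comm (hE : E * E = E) {g : A} (hg : IsUnit (pivot E g)) :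
    Ring.inverse (pivot E g) * E = E * Ring.inverse (pivot E g) := by
  have h : Commute (pivot E g) E := by
    rw [Commute, SemiconjBy, pivot_mul_idem hE, idem_mul_pivot hE]
  obtain ⟨u, hu⟩ := hg
  rw [← hu] at h ⊢
  rw [Ring.inverse_unit]
  exact h.units_inv_left

lemma isLower_cellCoord (hE : E * E = E) {g : A} (hg : IsUnit (pivot E g)) :
    IsLower E (cellCoord E g) where
  left := by
    simp only [cellCoord, ← mul_assoc, mul_sub, mul_one, hE, sub_self, zero_mul]
  right := by
    rw [cellCoord, mul_assoc _ _ E, inverse_pivot_comm hE hg]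
    simp only [mul_assoc, idem_assoc hE]

lemma mul_idem_eq (hE : E * E = E) {g : A} (hg : IsUnit (pivot E g)) :
    g * E = (E + cellCoord E g) * g * E := by
  have h1 : cellCoord E g * (g * E) = (1 - E) * g * E := by
    rw [← (isLower_cellCoord hE hg).right_assoc, ← mul_assoc E, ← pivot_mul_idem hE, cellCoord,
      mul_assoc _ _ (_ * E), ← mul_assoc _ (pivot E g) E, Ring.inverse_mul_cancel _ hg, one_mul,
      mul_assoc _ E E, hE]
  rw [add_mul, add_mul, mul_assoc (cellCoord E g), h1]
  noncomm_ring

lemma cellCoord_eq (hE : E * E = E) {g Y : A} (hg : IsUnit (pivot E g)) (hY : IsLower E Y)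
    (h : g * E = (E + Y) * g * E) : cellCoord E g = Y := by
  have h1 : (1 - E) * g * E = Y * (pivot E g * E) := by
    rw [pivot_mul_idem hE, mul_assoc E, hY.right_assoc, sub_mul, sub_mul, one_mul]
    conv_lhs => enter [1]; rw [h]
    noncomm_ring
  rw [cellCoord, h1, mul_assoc, mul_assoc, ← inverse_pivot_comm hE hg, ← mul_assoc (pivot E g),
    Ring.mul_inverse_cancel _ hg, one_mul, hY.right]

/-- The units which preserve the range of `E`. -/
def stabRange (E g : A) : Prop := E * g * E = g * E

lemma pivot_mul (hE : E * E = E) {g p : A} (hp : stabRange E p) :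
    pivot E (g * p) = pivot E g * pivot E p := by
  have h1 : E * (g * (p * E)) = E * (g * (E * (p * E))) := by
    rw [← mul_assoc E p E, hp]
  simp [pivot, mul_add, mul_sub, add_mul, sub_mul, mul_assoc, hE, idem_assoc hE, h1]

lemma stabRange.mul {g p : A} (hg : stabRange E g) (hp : stabRange E p) :
    stabRange E (g * p) := by
  unfold stabRange at *
  calc E * (g * p) * E = E * g * (p * E) := by noncomm_ring
    _ = (E * g * E) * (p * E) := by
        conv_lhs => rw [← hp]
        simp only [mul_assoc]
    _ = g * p * E := by rw [hg, mul_assoc, ← mul_assoc E, hp, mul_assoc]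

lemma isUnit_pivot_of_stab (hE : E * E = E) (p : Aˣ) (hp : stabRange E (p : A))
    (hp' : stabRange E ((p⁻¹ : Aˣ) : A)) : IsUnit (pivot E (p : A)) := by
  refine ⟨⟨_, pivot E ((p⁻¹ : Aˣ) : A), ?_, ?_⟩, rfl⟩
  · change pivot E (p : A) * pivot E ((p⁻¹ : Aˣ) : A) = 1
    rw [← pivot_mul hE hp']; simp [pivot, hE]
  · change pivot E ((p⁻¹ : Aˣ) : A) * pivot E (p : A) = 1
    rw [← pivot_mul hE hp]; simp [pivot, hE]

lemma cellCoord_mul (hE : E * E = E) {g : A} (p : Aˣ) (hg : IsUnit (pivot E g))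
    (hp : stabRange E (p : A)) (hp' : stabRange E ((p⁻¹ : Aˣ) : A)) :
    cellCoord E (g * p) = cellCoord E g := by
  refine cellCoord_eq hE ?_ (isLower_cellCoord hE hg) ?_
  · rw [pivot_mul hE hp]
    exact hg.mul (isUnit_pivot_of_stab hE p hp hp')
  · have h1 : g * p * E = g * E * p * E := by
      rw [mul_assoc g, ← hp]; noncomm_ring
    rw [h1]
    conv_lhs => rw [mul_idem_eq hE hg]
    rw [mul_assoc _ (g * p) E, h1]
    noncomm_ring

lemma pivot_one_add (hE : E * E = E) {Y : A} (hY : IsLower E Y) : pivot E (1 + Y) = 1 := by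
  simp [pivot, mul_add, hE, hY.left]

lemma cellCoord_one_add (hE : E * E = E) {Y : A} (hY : IsLower E Y) :
    cellCoord E (1 + Y) = Y := by
  refine cellCoord_eq hE (by rw [pivot_one_add hE hY]; exact isUnit_one) hY ?_
  simp [mul_add, add_mul, hE, hY.left, hY.right, hY.mul_eq_zero hY]

/-- If `p` preserves the range of `E`, the idempotent `p E p⁻¹` differs from `E` by an element of
the upper block. -/
lemma conj_eq_of_stab (p : Aˣ) (hp : stabRange E (p : A))
    (hp' : stabRange E ((p⁻¹ : Aˣ) : A)) :
    (p : A) * E * ((p⁻¹ : Aˣ) : A) =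
      E + E * p * E * ((p⁻¹ : Aˣ) : A) * (1 - E) := by
  have h1 : (p : A) * E * ((p⁻¹ : Aˣ) : A) * E = E := by
    rw [mul_assoc, mul_assoc, ← mul_assoc E, hp', ← mul_assoc, p.mul_inv, one_mul]
  rw [hp, mul_sub, mul_one, h1]
  abel

lemma isUpper_mul (hE : E * E = E) (x : A) : IsUpper E (E * x * (1 - E)) where
  left := by simp only [← mul_assoc, hE]
  right := by rw [mul_assoc, sub_mul, one_mul, hE, sub_self, mul_zero]

lemma isLower_mul (hE : E * E = E) (x : A) : IsLower E ((1 - E) * x * E) where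
  left := by simp only [← mul_assoc, mul_sub, mul_one, hE, sub_self, zero_mul]
  right := by rw [mul_assoc, hE]

lemma IsUpper.eq {X : A} (h : IsUpper E X) : E * X * (1 - E) = X := by
  rw [h.left, mul_sub, mul_one, h.right, sub_zero]

lemma IsLower.eq {X : A} (h : IsLower E X) : (1 - E) * X * E = X := by
  rw [sub_mul, h.left, one_mul, sub_zero, h.right]

end Ring

variable {A : Type} [NormedRing A] [NormedAlgebra ℝ A] [CompleteSpace A]
  [FiniteDimensional ℝ A] {E : A}

/-- In finite dimension the inverse of an element preserving the range of `E` preserves it as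
well. -/
lemma stabRange.inv {p : Aˣ} (hp : stabRange E (p : A)) (hE : E * E = E) :
    stabRange E ((p⁻¹ : Aˣ) : A) := by
  -- `V = E A` is a finite dimensional space which `p` maps injectively into itself, so `E = p x`
  -- with `x ∈ V`.
  let V : Submodule ℝ A := LinearMap.ker (LinearMap.mulLeft ℝ (1 - E))
  have hV : ∀ x, x ∈ V ↔ E * x = x := fun x => by
    simp only [V, LinearMap.mem_ker, LinearMap.mulLeft_apply, sub_mul, one_mul, sub_eq_zero]
    exact eq_comm
  have hmap : ∀ x ∈ V, LinearMap.mulLeft ℝ (p : A) x ∈ V := fun x hx => by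
    rw [hV] at hx ⊢
    rw [LinearMap.mulLeft_apply, ← hx, ← mul_assoc, ← mul_assoc, hp]
    simp [mul_assoc]
  let f : V →ₗ[ℝ] V := (LinearMap.mulLeft ℝ (p : A)).restrict hmap
  have hinj : Function.Injective f := fun x y hxy => by
    have := congrArg Subtype.val hxy
    exact Subtype.ext (p.isUnit.mul_left_cancel this)
  obtain ⟨x, hx⟩ := LinearMap.injective_iff_surjective.1 hinj ⟨E, (hV E).2 hE⟩
  have hx' : (p : A) * x = E := congrArg Subtype.val hx
  have h2 : ((p⁻¹ : Aˣ) : A) * E = x := by rw [← hx', Units.inv_mul_cancel_left]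
  rw [stabRange, mul_assoc, h2]
  exact (hV x).1 x.2

lemma contDiffAt_cellCoord {g : A} (hg : IsUnit (pivot E g)) :
    ContDiffAt ℝ ∞ (cellCoord E) g := by
  have h1 : ContDiffAt ℝ ∞ (pivot E) g := by unfold pivot; fun_prop
  have h2 : ContDiffAt ℝ ∞ Ring.inverse (pivot E g) := by
    obtain ⟨u, hu⟩ := hg
    rw [← hu]
    exact contDiffAt_ringInverse ℝ u
  have h3 : ContDiffAt ℝ ∞ (fun g => (1 - E) * g * E) g := by fun_prop
  exact h3.mul (h2.comp g h1)

end BigCell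

/-! ### Coordinates on the flag manifold and on the adjoint orbit -/

section FlagDatum

variable {A : Type} [NormedRing A] [NormedAlgebra ℝ A] [CompleteSpace A]
  [FiniteDimensional ℝ A] [StarRing A]

/-- A matrix group `G` with a subgroup `U` of unitary elements, and a Hermitian idempotent `E` such
that the big cell of `G` with respect to `E` is described by the blocks `(1 - E) 𝔤 E` and
`E 𝔤 (1 - E)` of a space `𝔤` of matrices. -/
structure FlagDatum (G U : Subgroup Aˣ) (𝔤 : Submodule ℝ A) (E : A) : Prop where
  idem : E * E = E
  star_idem : star E = E
  le : U ≤ G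
  unitary : ∀ u ∈ U, star (u : A) = ((u⁻¹ : Aˣ) : A)
  star_mem : ∀ X ∈ 𝔤, star X ∈ 𝔤
  one_add_lower : ∀ Y ∈ 𝔤, IsLower E Y → ∃ g ∈ G, (g : A) = 1 + Y
  one_add_upper : ∀ X ∈ 𝔤, IsUpper E X → ∃ g ∈ G, (g : A) = 1 + X
  coord_mem : ∀ g ∈ G, ∀ Y, IsLower E Y → (g : A) * E = (E + Y) * g * E → Y ∈ 𝔤
  upper_mem : ∀ g ∈ G, E * (g : A) * E * ((g⁻¹ : Aˣ) : A) * (1 - E) ∈ 𝔤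

variable (𝔤 : Submodule ℝ A) (E : A)

/-- The block `(1 - E) 𝔤 E`. -/
def lowerBlock : Submodule ℝ A where
  carrier := {Y | Y ∈ 𝔤 ∧ IsLower E Y}
  add_mem' := fun {a b} ha hb => ⟨add_mem ha.1 hb.1,
    by rw [mul_add, ha.2.left, hb.2.left, add_zero],
    by rw [add_mul, ha.2.right, hb.2.right]⟩
  zero_mem' := ⟨zero_mem _, mul_zero _, zero_mul _⟩
  smul_mem' := fun c a ha => ⟨𝔤.smul_mem c ha.1, by rw [mul_smul_comm, ha.2.left, smul_zero],
    by rw [smul_mul_assoc, ha.2.right]⟩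

/-- The block `E 𝔤 (1 - E)`. -/
def upperBlock : Submodule ℝ A where
  carrier := {X | X ∈ 𝔤 ∧ IsUpper E X}
  add_mem' := fun {a b} ha hb => ⟨add_mem ha.1 hb.1, by rw [mul_add, ha.2.left, hb.2.left],
    by rw [add_mul, ha.2.right, hb.2.right, add_zero]⟩
  zero_mem' := ⟨zero_mem _, mul_zero _, zero_mul _⟩
  smul_mem' := fun c a ha => ⟨𝔤.smul_mem c ha.1, by rw [mul_smul_comm, ha.2.left],
    by rw [smul_mul_assoc, ha.2.right, smul_zero]⟩

/-- The sum of the two off-diagonal blocks of `𝔤`. -/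
def offDiagonal : Submodule ℝ A := upperBlock 𝔤 E ⊔ lowerBlock 𝔤 E

variable {𝔤 E}

lemma offDiagonal_upper {v : A} (hv : v ∈ offDiagonal 𝔤 E) :
    E * v * (1 - E) ∈ 𝔤 ∧ (1 - E) * v * E ∈ 𝔤 ∧ E * v * (1 - E) + (1 - E) * v * E = v := by
  obtain ⟨X, hX, Y, hY, rfl⟩ := Submodule.mem_sup.1 hv
  have h1 : E * (X + Y) * (1 - E) = X := by
    rw [mul_add, hX.2.left, hY.2.left, add_zero, mul_sub, mul_one, hX.2.right, sub_zero]
  have h2 : (1 - E) * (X + Y) * E = Y := by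
    rw [mul_assoc, add_mul, hX.2.right, hY.2.right, zero_add, sub_mul, hY.2.left, one_mul, sub_zero]
  rw [h1, h2]
  exact ⟨hX.1, hY.1, rfl⟩

namespace FlagDatum

variable {G U : Subgroup Aˣ} (D : FlagDatum G U 𝔤 E)

/-- The unipotent element `1 + Y`. -/
def lower (w : EuclideanSpace ℝ (Fin (Module.finrank ℝ (lowerBlock 𝔤 E)))) : G :=
  ⟨(D.one_add_lower _ (HasExpLieAlgebra.incl_mem _ w).1 (HasExpLieAlgebra.incl_mem _ w).2).choose,
  (D.one_add_lower _ (HasExpLieAlgebra.incl_mem _ w).1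
    (HasExpLieAlgebra.incl_mem _ w).2).choose_spec.1⟩

lemma val_lower (w) : ((D.lower w : Aˣ) : A) = 1 + HasExpLieAlgebra.incl (lowerBlock 𝔤 E) w :=
  (D.one_add_lower _ (HasExpLieAlgebra.incl_mem _ w).1
    (HasExpLieAlgebra.incl_mem _ w).2).choose_spec.2

include D in
lemma cellCoord_mem {g : G} (hg : IsUnit (pivot E ((g : Aˣ) : A))) :
    cellCoord E ((g : Aˣ) : A) ∈ lowerBlock 𝔤 E :=
  ⟨D.coord_mem _ g.2 _ (isLower_cellCoord D.idem hg) (mul_idem_eq D.idem hg),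
    isLower_cellCoord D.idem hg⟩

/-- An element whose value is `1 + Y` with `Y` lower has `1 - Y` as its inverse. -/
lemma _root_.FlagCotangent.inv_one_add {R : Type*} [Ring R] (g : Rˣ) {Y : R}
    (hg : (g : R) = 1 + Y) (hY : Y * Y = 0) : ((g⁻¹ : Rˣ) : R) = 1 - Y := by
  have h : (g : R) * (1 - Y) = 1 := by
    rw [hg, mul_sub, add_mul, add_mul, hY]; noncomm_ring
  calc ((g⁻¹ : Rˣ) : R) = ((g⁻¹ : Rˣ) : R) * (g * (1 - Y)) := by rw [h, mul_one]
    _ = 1 - Y := g.inv_mul_cancel_left _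

lemma stabRange_lower_inv_mul {g g' : Aˣ} {Y : A} (hE : E * E = E) (hY : IsLower E Y)
    (hg' : (g' : A) = 1 + Y) (hg : (g : A) * E = (E + Y) * g * E) :
    stabRange E ((g'⁻¹ * g : Aˣ) : A) := by
  have h2 : ((g'⁻¹ * g : Aˣ) : A) * E = E * g * E := by
    rw [Units.val_mul, inv_one_add g' hg' (hY.mul_eq_zero hY), mul_assoc, hg]
    simp [add_mul, sub_mul, mul_add, mul_assoc, hY.right_assoc, hY.mul_assoc_eq_zero hY]
  rw [stabRange, mul_assoc, h2, mul_assoc, idem_assoc hE]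

section Lie

variable {𝔩 : Submodule ℝ A} (hG : HasExpLieAlgebra G 𝔩)

lemma isOpen_cell (G : Subgroup Aˣ) : IsOpen {g : G | IsUnit (pivot E ((g : Aˣ) : A))} := by
  refine Units.isOpen.preimage (f := fun g : G => pivot E ((g : Aˣ) : A)) ?_
  unfold pivot
  fun_prop

/-- Coordinates on `G ⧸ P` given by the big cell. -/
def flagCoord {P : Subgroup G} (hP : ∀ g : G, g ∈ P ↔ stabRange E ((g : Aˣ) : A)) :
    letI := hG.chartedSpace
    CosetCoord (d := Module.finrank ℝ 𝔩) (Module.finrank ℝ (lowerBlock 𝔤 E)) G P :=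
  letI := hG.chartedSpace
  { dom := {g | IsUnit (pivot E ((g : Aˣ) : A))}
    coord := fun g => HasExpLieAlgebra.proj _ (cellCoord E ((g : Aˣ) : A))
    sec := D.lower
    isOpen_dom := isOpen_cell G
    one_mem := by simp [pivot, D.idem]
    mul_mem := fun g hg p hp => by
      have := (hP p).1 hp
      simp only [mem_ofPred_eq, Subgroup.coe_mul, Units.val_mul] at hg ⊢
      rw [pivot_mul D.idem this]
      exact hg.mul (isUnit_pivot_of_stab D.idem _ this (this.inv D.idem))
    coord_mul := fun g hg p hp => by
      have := (hP p).1 hp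
      rw [Subgroup.coe_mul, Units.val_mul, cellCoord_mul D.idem _ hg this (this.inv D.idem)]
    contMDiffOn_coord := fun g hg => by
      refine ContMDiffAt.contMDiffWithinAt ?_
      exact hG.contMDiffAt_comp_val
        ((HasExpLieAlgebra.proj (lowerBlock 𝔤 E)).contDiff.contDiffAt.comp _
          (contDiffAt_cellCoord hg))
    contMDiff_sec := by
      refine hG.contMDiff_of_val ?_
      simp only [val_lower]
      exact (contDiff_const.add (HasExpLieAlgebra.incl (lowerBlock 𝔤 E)).contDiff).contMDiff
    sec_mem := fun w => by
      rw [mem_ofPred_eq, val_lower, pivot_one_add D.idem (HasExpLieAlgebra.incl_mem _ w).2]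
      exact isUnit_one
    coord_sec := fun w => by
      rw [val_lower, cellCoord_one_add D.idem (HasExpLieAlgebra.incl_mem _ w).2,
        HasExpLieAlgebra.proj_incl]
    mk_sec_coord := fun g hg => by
      rw [QuotientGroup.eq, hP]
      have hm := D.cellCoord_mem hg
      refine stabRange_lower_inv_mul (Y := cellCoord E ((g : Aˣ) : A)) D.idem hm.2 ?_
        (mul_idem_eq D.idem hg)
      rw [val_lower, HasExpLieAlgebra.incl_proj hm] }

/-- The element `1 + X` with `X = E v (1 - E)`. -/
def upper (w : EuclideanSpace ℝ (Fin (Module.finrank ℝ (offDiagonal 𝔤 E)))) : G :=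
  ⟨(D.one_add_upper _ (offDiagonal_upper (HasExpLieAlgebra.incl_mem _ w)).1
    (isUpper_mul D.idem _)).choose,
  (D.one_add_upper _ (offDiagonal_upper (HasExpLieAlgebra.incl_mem _ w)).1
    (isUpper_mul D.idem _)).choose_spec.1⟩

lemma val_upper (w) : ((D.upper w : Aˣ) : A) =
    1 + E * HasExpLieAlgebra.incl (offDiagonal 𝔤 E) w * (1 - E) :=
  (D.one_add_upper _ (offDiagonal_upper (HasExpLieAlgebra.incl_mem _ w)).1
    (isUpper_mul D.idem _)).choose_spec.2

/-- The element `1 + Y` with `Y = (1 - E) v E`. -/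
def lower' (w : EuclideanSpace ℝ (Fin (Module.finrank ℝ (offDiagonal 𝔤 E)))) : G :=
  ⟨(D.one_add_lower _ (offDiagonal_upper (HasExpLieAlgebra.incl_mem _ w)).2.1
    (isLower_mul D.idem _)).choose,
  (D.one_add_lower _ (offDiagonal_upper (HasExpLieAlgebra.incl_mem _ w)).2.1
    (isLower_mul D.idem _)).choose_spec.1⟩

lemma val_lower' (w) : ((D.lower' w : Aˣ) : A) =
    1 + (1 - E) * HasExpLieAlgebra.incl (offDiagonal 𝔤 E) w * E :=
  (D.one_add_lower _ (offDiagonal_upper (HasExpLieAlgebra.incl_mem _ w)).2.1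
    (isLower_mul D.idem _)).choose_spec.2

/-- The upper block of minus the idempotent `g E g⁻¹`. -/
def orbitCoord (E : A) (g : Aˣ) : A := -(E * (g : A) * E * ((g⁻¹ : Aˣ) : A) * (1 - E))

include D in
lemma orbitCoord_mem {g : G} : orbitCoord E (g : Aˣ) ∈ upperBlock 𝔤 E := by
  refine neg_mem ⟨D.upper_mem _ g.2, ?_⟩
  have := isUpper_mul D.idem ((g : Aˣ) * E * (((g : Aˣ)⁻¹ : Aˣ) : A))
  simpa only [mul_assoc] using this

/-- Left multiplication by `1 + Y` does not change the upper block of the idempotent. -/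
lemma orbitCoord_lower_mul {g g' : Aˣ} {Y : A} (hY : IsLower E Y)
    (hg' : (g' : A) = 1 + Y) : orbitCoord E (g' * g) = orbitCoord E g := by
  have h1 : ((g' * g)⁻¹ : Aˣ) = g⁻¹ * g'⁻¹ := mul_inv_rev _ _
  have h2 : (1 - Y) * (1 - E) = 1 - E := by
    rw [sub_mul, mul_sub Y, hY.right]; noncomm_ring
  have h3 : E * (1 + Y) = E := by rw [mul_add, hY.left, mul_one, add_zero]
  rw [orbitCoord, h1, Units.val_mul, Units.val_mul, hg', inv_one_add g' hg' (hY.mul_eq_zero hY),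
    ← mul_assoc E, h3, mul_assoc _ (_ * (1 - Y)), mul_assoc _ (1 - Y), h2]
  simp only [orbitCoord, mul_assoc]

lemma orbitCoord_upper {g : Aˣ} {X : A} (hE : E * E = E) (hX : IsUpper E X)
    (hg : (g : A) = 1 + X) : orbitCoord E g = X := by
  rw [orbitCoord, inv_one_add g hg (hX.mul_eq_zero hX), hg]
  have h1 : E * (1 + X) * E = E := by
    simp [mul_add, add_mul, hE, hX.left, hX.right]
  rw [h1, mul_assoc]
  simp [mul_sub, sub_mul, hE, hX.left, hX.right]

/-- An element preserving the range of `E` is determined modulo the centralizer of `E` by its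
upper coordinate. -/
lemma conj_eq_of_stab' {p : Aˣ} (hp : stabRange E (p : A))
    (hp' : stabRange E ((p⁻¹ : Aˣ) : A)) :
    (p : A) * E * ((p⁻¹ : Aˣ) : A) = E - orbitCoord E p := by
  rw [conj_eq_of_stab p hp hp', orbitCoord, sub_neg_eq_add]

lemma comm_of_conj_eq {g h : Aˣ}
    (hgh : (g : A) * E * ((g⁻¹ : Aˣ) : A) = (h : A) * E * ((h⁻¹ : Aˣ) : A)) :
    ((g⁻¹ * h : Aˣ) : A) * E = E * ((g⁻¹ * h : Aˣ) : A) := by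
  have h1 : (h : A) * E = (g : A) * E * ((g⁻¹ : Aˣ) : A) * h := by
    rw [hgh, mul_assoc, Units.inv_mul, mul_one]
  rw [Units.val_mul, mul_assoc, h1]
  simp only [mul_assoc, Units.inv_mul_cancel_left]

lemma orbitCoord_mul_comm {g h : Aˣ} (hh : (h : A) * E = E * (h : A)) :
    orbitCoord E (g * h) = orbitCoord E g := by
  have h1 : ((g * h : Aˣ) : A) * E * (((g * h)⁻¹ : Aˣ) : A) = g * E * ((g⁻¹ : Aˣ) : A) := by
    rw [mul_inv_rev, Units.val_mul, Units.val_mul, mul_assoc (g : A), hh]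
    simp only [mul_assoc, Units.mul_inv_cancel_left]
  unfold orbitCoord
  have h2 : ∀ k : Aˣ, E * (k : A) * E * ((k⁻¹ : Aˣ) : A) * (1 - E) =
      E * ((k : A) * E * ((k⁻¹ : Aˣ) : A)) * (1 - E) := fun k => by simp only [mul_assoc]
  rw [h2, h2, h1]

lemma stabRange_of_comm {h : A} (hE : E * E = E) (hh : h * E = E * h) : stabRange E h := by
  rw [stabRange, mul_assoc, hh, idem_assoc hE]

/-- In the big cell `g = (1 + Y) (1 + X) z` with `Y` and `X` the coordinates of `g`, and `z`
commuting with `E`. -/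
lemma inv_mul_comm_of_isUnit_pivot (hE : E * E = E) {g l r : Aˣ} (hg : IsUnit (pivot E (g : A)))
    (hl : (l : A) = 1 + cellCoord E (g : A)) (hr : (r : A) = 1 + orbitCoord E g) :
    (((l * r)⁻¹ * g : Aˣ) : A) * E = E * (((l * r)⁻¹ * g : Aˣ) : A) := by
  have hY := isLower_cellCoord hE hg
  have hX : IsUpper E (orbitCoord E g) := by
    have := isUpper_mul hE (-((g : A) * E * ((g⁻¹ : Aˣ) : A)))
    simpa only [orbitCoord, mul_assoc, mul_neg, neg_mul] using this
  refine comm_of_conj_eq ?_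
  have hp := stabRange_lower_inv_mul hE hY hl (mul_idem_eq hE hg)
  have h5 := conj_eq_of_stab' hp (hp.inv hE)
  have h6 : orbitCoord E (l⁻¹ * g) = orbitCoord E g := by
    rw [← orbitCoord_lower_mul hY hl, mul_inv_cancel_left]
  have h7 : (r : A) * E * ((r⁻¹ : Aˣ) : A) = E - orbitCoord E g := by
    rw [inv_one_add _ hr (hX.mul_eq_zero hX), hr]
    simp [mul_sub, add_mul, hX.left, hX.right]
  rw [h6, ← h7, mul_inv_rev, inv_inv, Units.val_mul, Units.val_mul] at h5
  rw [mul_inv_rev, Units.val_mul, Units.val_mul]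
  calc _ = (l : A) * ((r : A) * E * ((r⁻¹ : Aˣ) : A)) * ((l⁻¹ : Aˣ) : A) := by
        simp only [mul_assoc]
    _ = _ := by rw [← h5]; simp [mul_assoc]

lemma incl_offDiagonal {X Y : A} (hX : X ∈ upperBlock 𝔤 E) (hY : Y ∈ lowerBlock 𝔤 E) :
    E * HasExpLieAlgebra.incl (offDiagonal 𝔤 E) (HasExpLieAlgebra.proj _ (X + Y)) * (1 - E) = X ∧
    (1 - E) * HasExpLieAlgebra.incl (offDiagonal 𝔤 E) (HasExpLieAlgebra.proj _ (X + Y)) * E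
      = Y := by
  have hXY : X + Y ∈ offDiagonal 𝔤 E := Submodule.add_mem_sup hX hY
  rw [HasExpLieAlgebra.incl_proj hXY]
  constructor
  · rw [mul_add, hX.2.left, hY.2.left, add_zero, mul_sub, mul_one, hX.2.right, sub_zero]
  · rw [mul_assoc, add_mul, hX.2.right, hY.2.right, zero_add, sub_mul, hY.2.left, one_mul,
      sub_zero]

/-- Coordinates on `G ⧸ Z`, the orbit of `E`. -/
def orbitCosetCoord {Z : Subgroup G}
    (hZ : ∀ g : G, g ∈ Z ↔ ((g : Aˣ) : A) * E = E * ((g : Aˣ) : A)) :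
    letI := hG.chartedSpace
    CosetCoord (d := Module.finrank ℝ 𝔩) (Module.finrank ℝ (offDiagonal 𝔤 E)) G Z :=
  letI := hG.chartedSpace
  { dom := {g | IsUnit (pivot E ((g : Aˣ) : A))}
    coord := fun g => HasExpLieAlgebra.proj _
      (orbitCoord E (g : Aˣ) + cellCoord E ((g : Aˣ) : A))
    sec := fun w => D.lower' w * D.upper w
    isOpen_dom := isOpen_cell G
    one_mem := by simp [pivot, D.idem]
    mul_mem := fun g hg p hp => by
      have := stabRange_of_comm D.idem ((hZ p).1 hp)
      simp only [mem_ofPred_eq, Subgroup.coe_mul, Units.val_mul] at hg ⊢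
      rw [pivot_mul D.idem this]
      exact hg.mul (isUnit_pivot_of_stab D.idem _ this (this.inv D.idem))
    coord_mul := fun g hg p hp => by
      have := stabRange_of_comm D.idem ((hZ p).1 hp)
      rw [Subgroup.coe_mul, orbitCoord_mul_comm ((hZ p).1 hp), Units.val_mul,
        cellCoord_mul D.idem _ hg this (this.inv D.idem)]
    contMDiffOn_coord := fun g hg => by
      have := hG.lieGroup
      refine ContMDiffAt.contMDiffWithinAt ?_
      refine ContMDiffAt.comp (g := HasExpLieAlgebra.proj (offDiagonal 𝔤 E)) g
        (HasExpLieAlgebra.proj (offDiagonal 𝔤 E)).contDiff.contMDiff.contMDiffAt ?_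
      refine ContMDiffAt.add ?_ (hG.contMDiffAt_comp_val (contDiffAt_cellCoord hg))
      have h1 : ContDiff ℝ ∞ (fun p : A × A => -(E * p.1 * E * p.2 * (1 - E))) := by fun_prop
      exact (h1.contMDiff.comp (hG.contMDiff_val.prodMk_space hG.contMDiff_val_inv)).contMDiffAt
    contMDiff_sec := by
      refine hG.contMDiff_of_val ?_
      simp only [Subgroup.coe_mul, Units.val_mul, val_lower', val_upper]
      refine ContDiff.contMDiff ?_
      fun_prop
    sec_mem := fun w => by
      have hX := isUpper_mul D.idem (HasExpLieAlgebra.incl (offDiagonal 𝔤 E) w)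
      have hs : stabRange E ((D.upper w : Aˣ) : A) := by
        rw [stabRange, val_upper, mul_assoc, add_mul, hX.right, one_mul, add_zero, D.idem]
      rw [mem_ofPred_eq, Subgroup.coe_mul, Units.val_mul, pivot_mul D.idem hs, val_lower',
        pivot_one_add D.idem (isLower_mul D.idem _), one_mul]
      exact isUnit_pivot_of_stab D.idem _ hs (hs.inv D.idem)
    coord_sec := fun w => by
      have hX := isUpper_mul D.idem (HasExpLieAlgebra.incl (offDiagonal 𝔤 E) w)
      have hY := isLower_mul D.idem (HasExpLieAlgebra.incl (offDiagonal 𝔤 E) w)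
      have hs : stabRange E ((D.upper w : Aˣ) : A) := by
        rw [stabRange, val_upper, mul_assoc, add_mul, hX.right, one_mul, add_zero, D.idem]
      rw [Subgroup.coe_mul, orbitCoord_lower_mul hY (D.val_lower' w),
        orbitCoord_upper D.idem hX (D.val_upper w), Units.val_mul,
        cellCoord_mul D.idem _ _ hs (hs.inv D.idem), val_lower', cellCoord_one_add D.idem hY,
        (offDiagonal_upper (HasExpLieAlgebra.incl_mem _ w)).2.2,
        HasExpLieAlgebra.proj_incl]
      rw [val_lower', pivot_one_add D.idem hY]
      exact isUnit_one
    mk_sec_coord := fun g hg => by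
      rw [QuotientGroup.eq, hZ]
      have hXm := D.orbitCoord_mem (g := g)
      have hYm := D.cellCoord_mem hg
      obtain ⟨h1, h2⟩ := incl_offDiagonal hXm hYm
      have h3 := D.val_lower' (HasExpLieAlgebra.proj (offDiagonal 𝔤 E)
        (orbitCoord E (g : Aˣ) + cellCoord E ((g : Aˣ) : A)))
      have h4 := D.val_upper (HasExpLieAlgebra.proj (offDiagonal 𝔤 E)
        (orbitCoord E (g : Aˣ) + cellCoord E ((g : Aˣ) : A)))
      rw [h2] at h3
      rw [h1] at h4
      exact inv_mul_comm_of_isUnit_pivot D.idem hg h3 h4 }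

end Lie

end FlagDatum

end FlagDatum

/-! ### The compact model of the flag manifold -/

section Derivative

variable {A : Type} [NormedRing A] [NormedAlgebra ℝ A] [CompleteSpace A] {E : A}

lemma hasFDerivAt_cellCoord (hE : E * E = E) {g : A} (hg : IsUnit (pivot E g)) :
    ∃ L : A →L[ℝ] A, HasFDerivAt (cellCoord E) L g ∧
      ∀ X, L X = (1 - E - cellCoord E g) * X * E * Ring.inverse (pivot E g) := by
  have h1 : HasFDerivAt (pivot E) (ContinuousLinearMap.mulLeftRight ℝ A E E) g := by
    have h := (ContinuousLinearMap.mulLeftRight ℝ A E E).hasFDerivAt (x := g)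
    exact h.add_const (1 - E)
  obtain ⟨u, hu⟩ := id hg
  have h2 : HasFDerivAt Ring.inverse
      (-ContinuousLinearMap.mulLeftRight ℝ A (Ring.inverse (pivot E g))
        (Ring.inverse (pivot E g))) (pivot E g) := by
    rw [← hu, Ring.inverse_unit]
    exact hasFDerivAt_ringInverse u
  have h3 : HasFDerivAt (fun g => (1 - E) * g * E)
      (ContinuousLinearMap.mulLeftRight ℝ A (1 - E) E) g :=
    (ContinuousLinearMap.mulLeftRight ℝ A (1 - E) E).hasFDerivAt
  refine ⟨_, h3.mul' (h2.comp g h1), fun X => ?_⟩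
  -- The derivative of the inverse contributes `-c X E a⁻¹`, where `c` is the coordinate and `a` the
  -- pivot, since `c = (1 - E) g E a⁻¹`.
  have h4 : cellCoord E g * E = cellCoord E g := (isLower_cellCoord hE hg).right
  have h5 : cellCoord E g * X * E * Ring.inverse (pivot E g) = (1 - E) * g * E *
      (Ring.inverse (pivot E g) * (E * X * E) * Ring.inverse (pivot E g)) := by
    conv_lhs => rw [← h4]
    simp only [cellCoord, mul_assoc]
  simp only [add_apply, smul_apply, ContinuousLinearMap.comp_apply, neg_apply,
    ContinuousLinearMap.mulLeftRight_apply, smul_eq_mul, MulOpposite.smul_eq_mul_unop,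
    MulOpposite.unop_op]
  rw [mul_neg, ← h5]
  noncomm_ring

end Derivative

namespace FlagDatum

variable {A : Type} [NormedRing A] [NormedAlgebra ℝ A] [CompleteSpace A]
  [FiniteDimensional ℝ A] [StarRing A] {𝔤 : Submodule ℝ A} {E : A}
  {G U : Subgroup Aˣ} (D : FlagDatum G U 𝔤 E)

include D in
/-- A unitary element preserving the range of `E` commutes with `E`. -/
lemma comm_of_stabRange {u : Aˣ} (hu : u ∈ U) (h : stabRange E (u : A)) :
    (u : A) * E = E * (u : A) := by
  have h1 := h.inv D.idem
  have h2 := congrArg star h1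
  rw [← D.unitary u hu] at h2
  simp only [star_mul, star_star, D.star_idem] at h2
  rw [← h2, ← mul_assoc]
  exact h.symm

section Homeo

variable {P : Subgroup G} (hP : ∀ g : G, g ∈ P ↔ stabRange E ((g : Aˣ) : A))
  {K : Subgroup U} (hK : ∀ u : U, u ∈ K ↔ ((u : Aˣ) : A) * E = E * ((u : Aˣ) : A))

include hP hK in
lemma mem_iff_inclusion (u : U) : Subgroup.inclusion D.le u ∈ P ↔ u ∈ K := by
  rw [hP, hK]
  exact ⟨D.comm_of_stabRange u.2, stabRange_of_comm D.idem⟩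

/-- The map `U ⧸ K → G ⧸ P` induced by the inclusion of `U` in `G`. -/
def flagMap : U ⧸ K → G ⧸ P :=
  Quotient.lift (fun u : U => (QuotientGroup.mk (Subgroup.inclusion D.le u) : G ⧸ P))
    (fun a b hab => by
      have h := QuotientGroup.leftRel_apply.1 hab
      rw [QuotientGroup.eq, ← map_inv, ← map_mul]
      exact (D.mem_iff_inclusion hP hK _).2 h)

@[simp] lemma flagMap_mk (u : U) :
    D.flagMap hP hK (u : U ⧸ K) = (QuotientGroup.mk (Subgroup.inclusion D.le u) : G ⧸ P) := rfl

lemma injective_flagMap : Function.Injective (D.flagMap hP hK) := by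
  intro x y hxy
  induction x using QuotientGroup.induction_on
  induction y using QuotientGroup.induction_on
  rw [flagMap_mk, flagMap_mk, QuotientGroup.eq, ← map_inv, ← map_mul,
    D.mem_iff_inclusion hP hK] at hxy
  exact QuotientGroup.eq.2 hxy

lemma continuous_flagMap : Continuous (D.flagMap hP hK) := by
  refine Continuous.quotient_lift ?_ _
  exact QuotientGroup.continuous_mk.comp (continuous_inclusion D.le)

include hP in
lemma isClosed_stabilizer : IsClosed (P : Set G) := by
  have : (P : Set G) = {g : G | E * ((g : Aˣ) : A) * E = ((g : Aˣ) : A) * E} :=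
    Set.ext fun g => hP g
  rw [this]
  exact isClosed_eq (by fun_prop) (by fun_prop)

section Transitive

variable {𝔩 𝔲 : Submodule ℝ A} (hG : HasExpLieAlgebra G 𝔩) (hU : HasExpLieAlgebra U 𝔲)
  (hsub : ∀ Y ∈ lowerBlock 𝔤 E, Y - star Y ∈ 𝔲)

include D hsub in
/-- The derivative of the big cell coordinate of `exp X`, for `X ∈ 𝔲`, is onto because
`𝔤 = 𝔲 + 𝔭`. -/
lemma exists_strictFDerivAt_exp :
    ∃ L : EuclideanSpace ℝ (Fin (Module.finrank ℝ 𝔲)) →L[ℝ]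
        EuclideanSpace ℝ (Fin (Module.finrank ℝ (lowerBlock 𝔤 E))),
      HasStrictFDerivAt (fun w => HasExpLieAlgebra.proj (lowerBlock 𝔤 E)
        (cellCoord E (NormedSpace.exp (HasExpLieAlgebra.incl 𝔲 w)))) L 0 ∧
      Function.Surjective L := by
  have hu1 : IsUnit (pivot E (1 : A)) := by simp [pivot, D.idem]
  obtain ⟨L, hL, hLX⟩ := hasFDerivAt_cellCoord D.idem hu1
  have hc1 : cellCoord E (1 : A) = 0 := by simp [cellCoord, sub_mul, D.idem]
  have hp1 : Ring.inverse (pivot E (1 : A)) = 1 := by simp [pivot, D.idem]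
  rw [hc1, hp1] at hLX
  have hs : HasStrictFDerivAt (cellCoord E) L 1 :=
    (contDiffAt_cellCoord hu1).hasStrictFDerivAt' hL (by simp)
  have he : HasStrictFDerivAt (NormedSpace.exp : A → A) (1 : A →L[ℝ] A) 0 :=
    hasStrictFDerivAt_exp_zero
  have h0 : HasExpLieAlgebra.incl 𝔲 0 = 0 := map_zero _
  refine ⟨HasExpLieAlgebra.proj (lowerBlock 𝔤 E) ∘L L ∘L 1 ∘L HasExpLieAlgebra.incl 𝔲, ?_, ?_⟩
  · have h1 := (HasExpLieAlgebra.incl 𝔲).hasStrictFDerivAt (x := 0)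
    rw [← h0] at he
    have h2 := he.comp 0 h1
    rw [← NormedSpace.exp_zero, ← h0] at hs
    have h3 := HasStrictFDerivAt.comp 0 hs h2
    exact (HasExpLieAlgebra.proj (lowerBlock 𝔤 E)).hasStrictFDerivAt.comp 0 h3
  · intro w
    have hY := HasExpLieAlgebra.incl_mem (lowerBlock 𝔤 E) w
    refine ⟨HasExpLieAlgebra.proj 𝔲 (HasExpLieAlgebra.incl (lowerBlock 𝔤 E) w -
      star (HasExpLieAlgebra.incl (lowerBlock 𝔤 E) w)), ?_⟩
    simp only [ContinuousLinearMap.comp_apply, one_apply_eq_self]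
    rw [HasExpLieAlgebra.incl_proj (hsub _ hY), hLX]
    set Y := HasExpLieAlgebra.incl (lowerBlock 𝔤 E) w with hYdef
    have h4 : E * star Y = star Y := by
      have := congrArg star hY.2.right
      rwa [star_mul, D.star_idem] at this
    have h5 : (1 - E - 0) * (Y - star Y) * E * 1 = Y := by
      rw [mul_one, sub_zero, mul_sub, sub_mul (1 : A) E (star Y), h4, one_mul, sub_self, sub_zero,
        hY.2.eq]
    rw [h5, hYdef, HasExpLieAlgebra.proj_incl]

include hG hU hsub in
/-- The image of `U` in `G ⧸ P` is a neighbourhood of the base point. -/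
lemma range_flagMap_mem_nhds_one :
    range (D.flagMap hP hK) ∈ 𝓝 (QuotientGroup.mk (1 : G) : G ⧸ P) := by
  let := hG.chartedSpace
  have := hG.lieGroup
  have hTG := topologicalGroup_of_lieGroup (G := G) (𝓡 (Module.finrank ℝ 𝔩)) ∞
  let C := D.flagCoord hG hP
  obtain ⟨L, hL, hLs⟩ := D.exists_strictFDerivAt_exp hsub
  have h1 := hL.map_nhds_eq_of_surj (LinearMap.range_eq_top.2 hLs)
  have hmem : (QuotientGroup.mk (1 : G) : G ⧸ P) ∈ (C.chart 1).source := by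
    rw [C.mk_mem_chart_source, inv_one, one_mul]; exact C.one_mem
  have h2 : C.chart 1 (QuotientGroup.mk (1 : G)) = HasExpLieAlgebra.proj (lowerBlock 𝔤 E)
        (cellCoord E (NormedSpace.exp (HasExpLieAlgebra.incl 𝔲 0))) := by
    rw [C.chart_mk (by rw [inv_one, one_mul]; exact C.one_mem), map_zero, NormedSpace.exp_zero,
      inv_one, one_mul]
    rfl
  -- In the chart, the map `w ↦ exp w` has a surjective derivative at `0`, so its image is a
  -- neighbourhood.
  have h3 : C.chart 1 '' ((C.chart 1).source ∩ range (D.flagMap hP hK)) ∈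
      𝓝 (C.chart 1 (QuotientGroup.mk (1 : G))) := by
    rw [h2, ← h1, mem_map]
    have hc : Continuous (fun w => Subgroup.inclusion D.le (hU.exp w)) := by
      refine (continuous_inclusion D.le).comp ?_
      rw [(HasExpLieAlgebra.isEmbedding_val U).continuous_iff]
      exact contDiff_exp.continuous.comp (HasExpLieAlgebra.incl 𝔲).continuous
    have ho : {w | Subgroup.inclusion D.le (hU.exp w) ∈ C.dom} ∈
        𝓝 (0 : EuclideanSpace ℝ (Fin (Module.finrank ℝ 𝔲))) := by
      refine (C.isOpen_dom.preimage hc).mem_nhds ?_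
      have : Subgroup.inclusion D.le (hU.exp 0) = 1 := by
        ext1; ext1
        change NormedSpace.exp (HasExpLieAlgebra.incl 𝔲 0) = 1
        rw [map_zero, NormedSpace.exp_zero]
      rw [mem_preimage, this]
      exact C.one_mem
    filter_upwards [ho] with w hw
    have hw' : (1 : G)⁻¹ * Subgroup.inclusion D.le (hU.exp w) ∈ C.dom := by
      rwa [inv_one, one_mul]
    refine ⟨QuotientGroup.mk (Subgroup.inclusion D.le (hU.exp w)),
      ⟨C.mk_mem_chart_source.2 hw', (hU.exp w : U ⧸ K), rfl⟩, ?_⟩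
    rw [C.chart_mk hw', inv_one, one_mul]
    rfl
  have h4 := (C.chart 1).symm.image_mem_nhds (x := C.chart 1 (QuotientGroup.mk (1 : G)))
    ((C.chart 1).map_source hmem) h3
  rw [(C.chart 1).left_inv hmem] at h4
  refine mem_of_superset h4 ?_
  rintro _ ⟨_, ⟨x, hx, rfl⟩, rfl⟩
  rw [(C.chart 1).left_inv hx.1]
  exact hx.2

include hG hU hsub in
lemma surjective_flagMap [CompactSpace U] [ConnectedSpace G] :
    Function.Surjective (D.flagMap hP hK) := by
  let := hG.chartedSpace
  have := hG.lieGroup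
  have hTG := topologicalGroup_of_lieGroup (G := G) (𝓡 (Module.finrank ℝ 𝔩)) ∞
  have := isClosed_stabilizer hP
  -- The image is compact, and open by homogeneity; `G ⧸ P` is connected.
  have hclosed : IsClosed (range (D.flagMap hP hK)) :=
    (isCompact_range (D.continuous_flagMap hP hK)).isClosed
  have hopen : IsOpen (range (D.flagMap hP hK)) := by
    rw [isOpen_iff_mem_nhds]
    rintro _ ⟨x, rfl⟩
    induction x using QuotientGroup.induction_on with
    | H u =>
    have hc : Continuous (fun y : G ⧸ P => (Subgroup.inclusion D.le u)⁻¹ • y) :=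
      continuous_const_smul _
    have h1 := hc.continuousAt.preimage_mem_nhds
      (x := (QuotientGroup.mk (Subgroup.inclusion D.le u) : G ⧸ P))
      (t := range (D.flagMap hP hK)) (by
        have := D.range_flagMap_mem_nhds_one hP hK hG hU hsub
        convert this using 2
        rw [MulAction.Quotient.smul_mk, smul_eq_mul, inv_mul_cancel])
    rw [flagMap_mk]
    refine mem_of_superset h1 ?_
    rintro y ⟨z, hz⟩
    induction z using QuotientGroup.induction_on with
    | H v =>
    refine ⟨QuotientGroup.mk (u * v), ?_⟩
    rw [flagMap_mk] at hz ⊢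
    rw [map_mul, ← smul_eq_mul, ← MulAction.Quotient.smul_mk, hz, smul_inv_smul]
  have hconn : ConnectedSpace (G ⧸ P) :=
    QuotientGroup.mk_surjective.connectedSpace QuotientGroup.continuous_mk
  exact range_eq_univ.1 (IsClopen.eq_univ ⟨hclosed, hopen⟩ ⟨_, ⟨QuotientGroup.mk 1, rfl⟩⟩)

include hG hU hsub hP hK in
/-- The compact model and the complex model of the flag manifold are homeomorphic. -/
lemma exists_flagHomeo [CompactSpace U] [ConnectedSpace G] :
    ∃ φ : (U ⧸ K) ≃ₜ (G ⧸ P), ∀ u : U, φ u = QuotientGroup.mk (Subgroup.inclusion D.le u) := by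
  let := hG.chartedSpace
  have := hG.lieGroup
  have hTG := topologicalGroup_of_lieGroup (G := G) (𝓡 (Module.finrank ℝ 𝔩)) ∞
  have := isClosed_stabilizer hP
  let e := Equiv.ofBijective _ ⟨D.injective_flagMap hP hK,
    D.surjective_flagMap hP hK hG hU hsub⟩
  exact ⟨Continuous.homeoOfEquivCompactToT2 (f := e) (D.continuous_flagMap hP hK), fun u => rfl⟩

end Transitive

end Homeo

end FlagDatum

/-! ### The trace pairing of the two off-diagonal blocks -/

section TracePairing

/-- The upper block of the idempotent `g E g⁻¹`. -/
def upperPart {A : Type} [Ring A] (E : A) (g : Aˣ) : A :=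
  E * (g : A) * E * ((g⁻¹ : Aˣ) : A) * (1 - E)

section Ring

variable {A : Type} [Ring A] {E : A}

lemma upperPart_eq_conj (g : Aˣ) :
    upperPart E g = E * ((g : A) * E * ((g⁻¹ : Aˣ) : A)) * (1 - E) := by
  simp only [upperPart, mul_assoc]

lemma isUpper_upperPart (hE : E * E = E) (g : Aˣ) : IsUpper E (upperPart E g) := by
  rw [upperPart_eq_conj]; exact isUpper_mul hE _

/-- Conjugation by an element commuting with `E` commutes with taking the upper block. -/
lemma upperPart_comm_mul {h : Aˣ} (hh : (h : A) * E = E * (h : A)) (g : Aˣ) :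
    upperPart E (h * g) = (h : A) * upperPart E g * ((h⁻¹ : Aˣ) : A) := by
  have h1 : Commute ((h⁻¹ : Aˣ) : A) E := (show Commute (h : A) E from hh).units_inv_left
  have h2 : Commute ((h⁻¹ : Aˣ) : A) (1 - E) := (Commute.one_right _).sub_right h1
  rw [upperPart, mul_inv_rev, Units.val_mul, Units.val_mul, ← mul_assoc E, ← hh]
  calc _ = (h : A) * (E * g * E * ((g⁻¹ : Aˣ) : A)) * (((h⁻¹ : Aˣ) : A) * (1 - E)) := by
        simp only [mul_assoc]
    _ = _ := by rw [h2.eq]; simp only [upperPart, mul_assoc]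

variable [Algebra ℝ A]

/-- The trace form of the differential of the big cell coordinate at `g`, tested against a
nilpotent element which vanishes on the range of `g E` and takes its values there. -/
lemma trace_mul_deriv_cellCoord {tr : A →ₗ[ℝ] ℝ} (htr : ∀ a b, tr (a * b) = tr (b * a))
    (hE : E * E = E) {g : Aˣ} (hg : IsUnit (pivot E (g : A))) {N : A}
    (h1 : N * g * E = 0) (h2 : (g : A) * E * ((g⁻¹ : Aˣ) : A) * N = N) (X : A) :
    tr (N * ((1 - E - cellCoord E (g : A)) * X * E * Ring.inverse (pivot E (g : A)))) =
      tr (N * X * ((g⁻¹ : Aˣ) : A)) := by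
  set c := cellCoord E (g : A)
  set r := Ring.inverse (pivot E (g : A)) with hr
  have hc : IsLower E c := isLower_cellCoord hE hg
  have hrE : r * E = E * r := inverse_pivot_comm hE hg
  have h3 : (E + c) * E = E + c := by rw [add_mul, hE, hc.right]
  have h4 : (g : A) * E * r = E + c := by
    calc (g : A) * E * r = (E + c) * (E * g * E) * r := by
          conv_lhs => rw [mul_idem_eq hE hg]
          rw [← mul_assoc, ← mul_assoc, h3]
      _ = (E + c) * E := by
          rw [← pivot_mul_idem hE, mul_assoc, mul_assoc (pivot E (g : A)), ← hrE,
            ← mul_assoc (pivot E (g : A)), Ring.mul_inverse_cancel _ hg, one_mul]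
      _ = E + c := h3
  have h5 : N * (1 - E - c) = N := by
    have : N * (E + c) = 0 := by
      rw [← h4, ← mul_assoc, ← mul_assoc, h1, zero_mul]
    rw [sub_sub, mul_sub, this, mul_one, sub_zero]
  have h6 : E * r * N = ((g⁻¹ : Aˣ) : A) * N := by
    have h7 : E * r * (g : A) * E = E := by
      calc E * r * (g : A) * E = r * (E * g * E) := by rw [← hrE]; simp only [mul_assoc]
        _ = E := by
          rw [← pivot_mul_idem hE, ← mul_assoc, Ring.inverse_mul_cancel _ hg, one_mul]
    have h8 : E * (((g⁻¹ : Aˣ) : A) * N) = ((g⁻¹ : Aˣ) : A) * N := by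
      conv_rhs => rw [← h2]
      simp only [mul_assoc, Units.inv_mul_cancel_left]
    calc E * r * N = E * r * ((g : A) * E * ((g⁻¹ : Aˣ) : A) * N) := by rw [h2]
      _ = E * r * g * E * (((g⁻¹ : Aˣ) : A) * N) := by simp only [mul_assoc]
      _ = _ := by rw [h7, h8]
  calc _ = tr (N * (1 - E - c) * X * (E * r)) := by simp only [mul_assoc]
    _ = tr (E * r * N * X) := by rw [h5, htr]; simp only [mul_assoc]
    _ = _ := by rw [h6, mul_assoc, htr]

end Ring

section Unitary

variable {A : Type} [Ring A] [StarRing A] {E : A}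

/-- The upper block of the Hermitian idempotent onto the graph of `Y`. -/
def graphPart (Y : A) : A := Ring.inverse (1 + star Y * Y) * star Y

/-- For a unitary `v` in the big cell, `v E v⁻¹` is the Hermitian idempotent onto the graph of the
coordinate of `v`. -/
lemma upperPart_unitary (hE : E * E = E) (hs : star E = E) {v : Aˣ}
    (hv : star (v : A) = ((v⁻¹ : Aˣ) : A)) (hp : IsUnit (pivot E (v : A))) :
    IsUnit (1 + star (cellCoord E (v : A)) * cellCoord E (v : A)) ∧
      upperPart E v = graphPart (cellCoord E (v : A)) := by
  set Y := cellCoord E (v : A)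
  have hY : IsLower E Y := isLower_cellCoord hE hp
  have hY1 : star Y * E = 0 := by
    have := congrArg star hY.left
    rwa [star_mul, hs, star_zero] at this
  have hY2 : E * star Y = star Y := by
    have := congrArg star hY.right
    rwa [star_mul, hs] at this
  have h1 : (v : A) * E = (1 + Y) * (E * v * E) := by
    conv_lhs => rw [mul_idem_eq hE hp]
    have : E + Y = (1 + Y) * E := by rw [add_mul, hY.right, one_mul]
    rw [this]; simp only [mul_assoc]
  have h2 : E * ((v⁻¹ : Aˣ) : A) = E * star (v : A) * E * (1 + star Y) := by
    have := congrArg star h1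
    simp only [star_mul, hs, star_add, star_one] at this
    rw [← hv]
    exact this.trans (by simp only [mul_assoc])
  have h3 : star (pivot E (v : A)) = E * star (v : A) * E + (1 - E) := by
    simp only [pivot, star_add, star_sub, star_mul, hs, star_one, mul_assoc]
  -- `v E = (1 + Y) E v E` with `v` unitary gives `a* (1 + Y* Y) a = 1` for the pivot `a`.
  have h4 : star (pivot E (v : A)) * (1 + star Y * Y) * pivot E (v : A) = 1 := by
    have h5 : E * star (v : A) * E * (1 + star Y) * ((1 + Y) * (E * v * E)) = E := by
      rw [← h2, ← h1]
      calc _ = E * (((v⁻¹ : Aˣ) : A) * v) * E := by simp only [mul_assoc]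
        _ = E := by rw [Units.inv_mul, mul_one, hE]
    rw [h3, pivot]
    have h6 : (1 - E) * (1 + star Y * Y) = 1 - E := by
      have : (1 - E) * star Y = 0 := by rw [sub_mul, hY2, one_mul, sub_self]
      rw [mul_add, ← mul_assoc, this, zero_mul, add_zero, mul_one]
    have h7 : (1 + star Y * Y) * (1 - E) = 1 - E := by
      have : Y * (1 - E) = 0 := by rw [mul_sub, hY.right, mul_one, sub_self]
      rw [add_mul, mul_assoc, this, mul_zero, add_zero, one_mul]
    have h8 : E * (1 + star Y) * ((1 + Y) * E) = E * (1 + star Y * Y) * E := by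
      have : E * Y * E = 0 := by rw [hY.left, zero_mul]
      have h' : E * star Y * E = 0 := by rw [mul_assoc, hY1, mul_zero]
      have h9 : E * (1 + star Y) * ((1 + Y) * E) =
        E * (1 + star Y * Y) * E + E * Y * E + E * star Y * E := by noncomm_ring
      rw [h9, this, h', add_zero, add_zero]
    have h10 : E * (1 - E) = 0 := by rw [mul_sub, hE, mul_one, sub_self]
    have h11 : (1 - E) * E = 0 := by rw [sub_mul, hE, one_mul, sub_self]
    have h12 : (1 - E) * (1 - E) = 1 - E := by rw [mul_sub, h11, mul_one, sub_zero]
    calc _ = E * star (v : A) * E * (1 + star Y * Y) * (E * v * E) +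
          E * star (v : A) * E * ((1 + star Y * Y) * (1 - E)) +
          ((1 - E) * (1 + star Y * Y)) * (E * v * E) +
          ((1 - E) * (1 + star Y * Y)) * (1 - E) := by noncomm_ring
      _ = E * star (v : A) * (E * (1 + star Y * Y) * E) * v * E +
          E * star (v : A) * (E * (1 - E)) + ((1 - E) * E) * v * E + (1 - E) * (1 - E) := by
          rw [h7, h6]; simp only [mul_assoc]
      _ = E * star (v : A) * E * (1 + star Y) * ((1 + Y) * (E * v * E)) + (1 - E) := by
          rw [← h8, h10, h11, h12]; simp only [mul_assoc, mul_zero, zero_mul, add_zero]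
      _ = 1 := by rw [h5]; abel
  have hps : IsUnit (star (pivot E (v : A))) := hp.star
  have h5 : (1 + star Y * Y) * (pivot E (v : A) * star (pivot E (v : A))) = 1 := by
    refine hps.mul_left_cancel ?_
    rw [← mul_assoc, ← mul_assoc, h4, one_mul, mul_one]
  have h6 : (pivot E (v : A) * star (pivot E (v : A))) * (1 + star Y * Y) = 1 := by
    refine hp.mul_right_cancel ?_
    rw [mul_assoc, mul_assoc, ← mul_assoc (star _), h4, one_mul, mul_one]
  have hu : IsUnit (1 + star Y * Y) := ⟨⟨_, _, h5, h6⟩, rfl⟩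
  refine ⟨hu, ?_⟩
  have h7 : Ring.inverse (1 + star Y * Y) = pivot E (v : A) * star (pivot E (v : A)) := by
    have := Ring.inverse_unit (⟨_, _, h5, h6⟩ : Aˣ)
    exact this
  have h8 : (E * star (v : A) * E + (1 - E)) * star Y = E * star (v : A) * star Y := by
    rw [add_mul, mul_assoc _ E, hY2, sub_mul, hY2, one_mul, sub_self, add_zero]
  have h9 : E * (1 + star Y) * (1 - E) = star Y := by
    rw [mul_add, hY2, mul_one, add_mul, mul_sub, hE, mul_one, sub_self, zero_add, mul_sub, hY1,
      mul_one, sub_zero]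
  rw [graphPart, h7, h3, mul_assoc, h8, upperPart, mul_assoc _ E, h2, pivot]
  calc _ = E * v * E * star (v : A) * (E * (1 + star Y) * (1 - E)) := by
        rw [show E * (v : A) * (E * star (v : A) * E * (1 + star Y)) * (1 - E) =
          E * v * E * star (v : A) * (E * (1 + star Y) * (1 - E)) by simp only [mul_assoc]]
    _ = _ := by
        rw [h9, add_mul, sub_mul, ← mul_assoc (E), ← mul_assoc E, hE, one_mul, sub_self, add_zero]
        simp only [mul_assoc, idem_assoc hE]

end Unitary

section Smooth

variable {A : Type} [NormedRing A] [NormedAlgebra ℝ A] [CompleteSpace A]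
  [FiniteDimensional ℝ A] [StarRing A] [StarModule ℝ A]

variable (A) in
/-- The involution as a real linear map. -/
def realStar : A →ₗ[ℝ] A where
  toFun := star
  map_add' := star_add
  map_smul' c a := by simp [star_smul]

lemma contDiffAt_graphPart {Y : A} (hY : IsUnit (1 + star Y * Y)) :
    ContDiffAt ℝ ∞ (graphPart : A → A) Y := by
  have h1 : ContDiff ℝ ∞ (star : A → A) :=
    (LinearMap.toContinuousLinearMap (realStar A)).contDiff
  obtain ⟨u, hu⟩ := hY
  have h2 : ContDiffAt ℝ ∞ Ring.inverse (1 + star Y * Y) := by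
    rw [← hu]; exact contDiffAt_ringInverse ℝ u
  have h3 : ContDiffAt ℝ ∞ (fun Y : A => 1 + star Y * Y) Y :=
    (contDiff_const.add (h1.mul contDiff_id)).contDiffAt
  exact (h2.comp Y h3).mul h1.contDiffAt

end Smooth

end TracePairing

/-! ### Cotangent vectors of the flag manifold as nilpotent matrices -/

section Pairing

variable {A : Type} [NormedRing A] [NormedAlgebra ℝ A] [CompleteSpace A]
  [FiniteDimensional ℝ A] [StarRing A] [StarModule ℝ A] (𝔤 : Submodule ℝ A) (E : A)

/-- A real trace form which is definite with respect to the involution. -/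
structure IsTraceForm (tr : A →ₗ[ℝ] ℝ) : Prop where
  comm : ∀ a b, tr (a * b) = tr (b * a)
  definite : ∀ a, tr (a * star a) = 0 → a = 0

/-- The functional `Y ↦ tr (M Y)` on the lower block, in coordinates. -/
def pairing (tr : A →ₗ[ℝ] ℝ) :
    A →ₗ[ℝ] (EuclideanSpace ℝ (Fin (Module.finrank ℝ (lowerBlock 𝔤 E))) →L[ℝ] ℝ) where
  toFun M := (LinearMap.toContinuousLinearMap (tr ∘ₗ LinearMap.mulLeft ℝ M)).comp
    (HasExpLieAlgebra.incl (lowerBlock 𝔤 E))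
  map_add' a b := by ext η; simp [add_mul]
  map_smul' c a := by ext η; simp

variable {𝔤 E} {tr : A →ₗ[ℝ] ℝ}

lemma pairing_apply (M : A) (η) :
    pairing 𝔤 E tr M η = tr (M * HasExpLieAlgebra.incl (lowerBlock 𝔤 E) η) := rfl

/-- The pairing only sees the upper block. -/
lemma pairing_eq_upper (htr : IsTraceForm tr) (M : A) :
    pairing 𝔤 E tr M = pairing 𝔤 E tr (E * M * (1 - E)) := by
  ext η
  have h := HasExpLieAlgebra.incl_mem (lowerBlock 𝔤 E) η
  have h1 : (1 - E) * HasExpLieAlgebra.incl (lowerBlock 𝔤 E) η =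
      HasExpLieAlgebra.incl (lowerBlock 𝔤 E) η := by
    rw [sub_mul, h.2.left, one_mul, sub_zero]
  rw [pairing_apply, pairing_apply, mul_assoc (E * M), h1, mul_assoc E, htr.comm E, mul_assoc,
    h.2.right]

lemma pairing_congr (htr : IsTraceForm tr) {M M' : A}
    (h : E * M * (1 - E) = E * M' * (1 - E)) : pairing 𝔤 E tr M = pairing 𝔤 E tr M' := by
  rw [pairing_eq_upper htr, h, ← pairing_eq_upper htr]

namespace FlagDatum

variable {G U : Subgroup Aˣ} (D : FlagDatum G U 𝔤 E)

include D in
lemma star_mem_lower {X : A} (h : X ∈ upperBlock 𝔤 E) : star X ∈ lowerBlock 𝔤 E := by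
  refine ⟨D.star_mem _ h.1, ?_, ?_⟩
  · have := congrArg star h.2.right
    rwa [star_mul, D.star_idem, star_zero] at this
  · have := congrArg star h.2.left
    rwa [star_mul, D.star_idem] at this

include D in
lemma star_mem_upper {Y : A} (h : Y ∈ lowerBlock 𝔤 E) : star Y ∈ upperBlock 𝔤 E := by
  refine ⟨D.star_mem _ h.1, ?_, ?_⟩
  · have := congrArg star h.2.right
    rwa [star_mul, D.star_idem] at this
  · have := congrArg star h.2.left
    rwa [star_mul, D.star_idem, star_zero] at this

/-- The involution exchanges the two blocks. -/
def upperEquivLower : upperBlock 𝔤 E ≃ₗ[ℝ] lowerBlock 𝔤 E where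
  toFun X := ⟨star X.1, D.star_mem_lower X.2⟩
  invFun Y := ⟨star Y.1, D.star_mem_upper Y.2⟩
  left_inv X := Subtype.ext (star_star _)
  right_inv Y := Subtype.ext (star_star _)
  map_add' a b := Subtype.ext (star_add _ _)
  map_smul' c a := Subtype.ext (by simp [star_smul])

include D in
lemma finrank_upperBlock : Module.finrank ℝ (upperBlock 𝔤 E) =
    Module.finrank ℝ (EuclideanSpace ℝ (Fin (Module.finrank ℝ (lowerBlock 𝔤 E))) →L[ℝ] ℝ) := by
  rw [D.upperEquivLower.finrank_eq, ← (LinearMap.toContinuousLinearMap (𝕜 := ℝ)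
    (E := EuclideanSpace ℝ (Fin (Module.finrank ℝ (lowerBlock 𝔤 E)))) (F' := ℝ)).finrank_eq]
  refine Eq.symm ((Subspace.dual_finrank_eq (K := ℝ)
    (V := EuclideanSpace ℝ (Fin (Module.finrank ℝ (lowerBlock 𝔤 E))))).trans ?_)
  exact finrank_euclideanSpace_fin

include D in
lemma eq_zero_of_pairing (htr : IsTraceForm tr) {X : A} (hX : X ∈ upperBlock 𝔤 E)
    (h : pairing 𝔤 E tr X = 0) : X = 0 := by
  refine htr.definite X ?_
  have := DFunLike.congr_fun h (HasExpLieAlgebra.proj _ (star X))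
  rwa [pairing_apply, HasExpLieAlgebra.incl_proj (D.star_mem_lower hX)] at this

/-- The trace form identifies the upper block with the dual of the lower block. -/
def pairingEquiv (htr : IsTraceForm tr) : upperBlock 𝔤 E ≃ₗ[ℝ]
    (EuclideanSpace ℝ (Fin (Module.finrank ℝ (lowerBlock 𝔤 E))) →L[ℝ] ℝ) :=
  LinearMap.linearEquivOfInjective ((pairing 𝔤 E tr).comp (upperBlock 𝔤 E).subtype)
    ((injective_iff_map_eq_zero _).2 fun X h => Subtype.ext (D.eq_zero_of_pairing htr X.2 h))
    D.finrank_upperBlock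

/-- The upper nilpotent matrix that represents a functional on the lower block. -/
def dualVector (htr : IsTraceForm tr) :
    (EuclideanSpace ℝ (Fin (Module.finrank ℝ (lowerBlock 𝔤 E))) →L[ℝ] ℝ) →L[ℝ] A :=
  LinearMap.toContinuousLinearMap
    ((upperBlock 𝔤 E).subtype.comp (D.pairingEquiv htr).symm.toLinearMap)

lemma dualVector_mem (htr : IsTraceForm tr) (α) : D.dualVector htr α ∈ upperBlock 𝔤 E :=
  ((D.pairingEquiv htr).symm α).2

lemma pairing_dualVector (htr : IsTraceForm tr) (α) :
    pairing 𝔤 E tr (D.dualVector htr α) = α := (D.pairingEquiv htr).apply_symm_apply α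

lemma dualVector_pairing (htr : IsTraceForm tr) {X : A} (hX : X ∈ upperBlock 𝔤 E) :
    D.dualVector htr (pairing 𝔤 E tr X) = X :=
  congrArg Subtype.val ((D.pairingEquiv htr).symm_apply_apply ⟨X, hX⟩)

include D in
lemma upperPart_mem {g : Aˣ} (hg : g ∈ G) : upperPart E g ∈ upperBlock 𝔤 E :=
  ⟨D.upper_mem _ hg, isUpper_upperPart D.idem _⟩

/-- The element `1 - X` of `G`, for `X` in the upper block. -/
def unipotent {X : A} (hX : X ∈ upperBlock 𝔤 E) : G :=
  ⟨(D.one_add_upper _ (neg_mem hX).1 (neg_mem hX).2).choose,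
    (D.one_add_upper _ (neg_mem hX).1 (neg_mem hX).2).choose_spec.1⟩

lemma val_unipotent {X : A} (hX : X ∈ upperBlock 𝔤 E) :
    ((D.unipotent hX : Aˣ) : A) = 1 - X :=
  ((D.one_add_upper _ (neg_mem hX).1 (neg_mem hX).2).choose_spec.2).trans (sub_eq_add_neg _ _).symm

lemma val_inv_unipotent {X : A} (hX : X ∈ upperBlock 𝔤 E) :
    (((D.unipotent hX : Aˣ)⁻¹ : Aˣ) : A) = 1 + X := by
  have := inv_one_add (D.unipotent hX : Aˣ) (Y := -X)
    ((D.val_unipotent hX).trans (sub_eq_add_neg _ _))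
    (by rw [neg_mul_neg, hX.2.mul_eq_zero hX.2])
  rw [this, sub_neg_eq_add]

lemma conj_unipotent {X : A} (hX : X ∈ upperBlock 𝔤 E) :
    ((D.unipotent hX : Aˣ) : A) * E * (((D.unipotent hX : Aˣ)⁻¹ : Aˣ) : A) = E + X := by
  rw [val_unipotent, val_inv_unipotent, sub_mul, hX.2.right, one_mul, sub_zero, mul_add, mul_one,
    hX.2.left]

lemma upperPart_unipotent {X : A} (hX : X ∈ upperBlock 𝔤 E) :
    upperPart E (D.unipotent hX : Aˣ) = X := by
  rw [upperPart_eq_conj, D.conj_unipotent hX, mul_add, D.idem, hX.2.left, add_mul, mul_sub, D.idem,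
    mul_one, sub_self, zero_add, mul_sub, hX.2.right, mul_one, sub_zero]

lemma stabRange_unipotent {X : A} (hX : X ∈ upperBlock 𝔤 E) :
    stabRange E ((D.unipotent hX : Aˣ) : A) := by
  rw [stabRange, val_unipotent, mul_assoc, sub_mul, hX.2.right, one_mul, sub_zero, D.idem]

include D in
/-- If `p` preserves the range of `E` then `p E p⁻¹` is `E` plus its upper block; so `p` is
unipotent modulo the centralizer of `E`. -/
lemma conj_of_stabRange {p : Aˣ} (hp : stabRange E (p : A)) :
    (p : A) * E * ((p⁻¹ : Aˣ) : A) = E + upperPart E p :=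
  conj_eq_of_stab p hp (hp.inv D.idem)

/-- Left translations by `G` in the big cell coordinates: their differential, transposed with
respect to the trace form, is conjugation. -/
lemma hasFDerivAt_translate (htr : IsTraceForm tr) (b : G) (y₀)
    (hb : stabRange E ((b * D.lower y₀ : Aˣ) : A)) :
    ∃ T : EuclideanSpace ℝ (Fin (Module.finrank ℝ (lowerBlock 𝔤 E))) →L[ℝ]
        EuclideanSpace ℝ (Fin (Module.finrank ℝ (lowerBlock 𝔤 E))),
      HasFDerivAt (fun y => HasExpLieAlgebra.proj (lowerBlock 𝔤 E) (cellCoord E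
        (((b : Aˣ) : A) * (1 + HasExpLieAlgebra.incl (lowerBlock 𝔤 E) y)))) T y₀ ∧
      ∀ N, IsUpper E N → (pairing 𝔤 E tr N).comp T =
        pairing 𝔤 E tr ((((b : Aˣ)⁻¹ : Aˣ) : A) * N * ((b : Aˣ) : A)) := by
  set I := HasExpLieAlgebra.incl (lowerBlock 𝔤 E)
  have hval : ((b * D.lower y₀ : Aˣ) : A) = ((b : Aˣ) : A) * (1 + I y₀) := by
    rw [Units.val_mul, val_lower]
  have hinv := hb.inv D.idem
  have hp : IsUnit (pivot E ((b * D.lower y₀ : Aˣ) : A)) := isUnit_pivot_of_stab D.idem _ hb hinv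
  obtain ⟨L, hL, hLX⟩ := hasFDerivAt_cellCoord D.idem hp
  have h1 : HasFDerivAt (fun y => ((b : Aˣ) : A) * (1 + I y))
      ((ContinuousLinearMap.mul ℝ A ((b : Aˣ) : A)).comp I) y₀ := by
    exact (ContinuousLinearMap.mul ℝ A ((b : Aˣ) : A)).hasFDerivAt.comp y₀
      (I.hasFDerivAt.const_add 1)
  rw [hval] at hL
  have h2 := HasFDerivAt.comp (x := y₀) hL h1
  have h3 := (HasExpLieAlgebra.proj (lowerBlock 𝔤 E)).hasFDerivAt.comp y₀ h2
  refine ⟨_, h3, fun N hN => ?_⟩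
  have h4 := I.hasFDerivAt.comp y₀ h3
  -- Near `y₀` the coordinate of `b (1 + Y)` lies in the lower block, where `I ∘ proj` is the
  -- identity; so its derivative may be computed in the algebra.
  have h5 : (I ∘ (HasExpLieAlgebra.proj (lowerBlock 𝔤 E)) ∘
      (cellCoord E ∘ fun y => ((b : Aˣ) : A) * (1 + I y))) =ᶠ[𝓝 y₀]
      (cellCoord E ∘ fun y => ((b : Aˣ) : A) * (1 + I y)) := by
    have hc : Continuous (fun y => pivot E (((b : Aˣ) : A) * (1 + I y))) := by
      unfold pivot; fun_prop
    filter_upwards [(Units.isOpen.preimage hc).mem_nhds (by rw [mem_preimage, ← hval]; exact hp)]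
      with y hy
    have hy' : IsUnit (pivot E (((b * D.lower y : G) : Aˣ) : A)) := by
      rw [Subgroup.coe_mul, Units.val_mul, val_lower]; exact hy
    have := D.cellCoord_mem hy'
    rw [Subgroup.coe_mul, Units.val_mul, val_lower] at this
    exact HasExpLieAlgebra.incl_proj this
  have h6 := (h4.congr_of_eventuallyEq h5.symm).unique h2
  ext η
  have h7 := DFunLike.congr_fun h6 η
  simp only [ContinuousLinearMap.comp_apply] at h7
  simp only [ContinuousLinearMap.comp_apply]
  rw [pairing_apply, h7, hLX, pairing_apply, trace_mul_deriv_cellCoord htr.comm D.idem hp]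
  · have hη := HasExpLieAlgebra.incl_mem (lowerBlock 𝔤 E) η
    have hy := HasExpLieAlgebra.incl_mem (lowerBlock 𝔤 E) y₀
    rw [ContinuousLinearMap.mul_apply', mul_inv_rev, Units.val_mul,
      inv_one_add _ (D.val_lower y₀) (hy.2.mul_eq_zero hy.2)]
    have h8 : I η * (1 - I y₀) = I η := by
      rw [mul_sub, mul_one, hη.2.mul_eq_zero hy.2, sub_zero]
    calc _ = tr (N * ((b : Aˣ) : A) * (I η * (1 - I y₀)) * (((b : Aˣ)⁻¹ : Aˣ) : A)) := by
          simp only [mul_assoc]; rfl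
      _ = _ := by rw [h8, htr.comm]; simp only [mul_assoc]; rfl
  · rw [mul_assoc, ← hb, ← mul_assoc, ← mul_assoc, hN.right, zero_mul, zero_mul]
  · have h8 : (((b * D.lower y₀ : Aˣ)⁻¹ : Aˣ) : A) * N =
        E * ((((b * D.lower y₀ : Aˣ)⁻¹ : Aˣ) : A) * N) := by
      conv_lhs => rw [← hN.left, ← mul_assoc, ← hinv]
      rw [mul_assoc, hN.left, mul_assoc]
    rw [mul_assoc, mul_assoc, ← h8, Units.mul_inv_cancel_left]

end FlagDatum

end Pairing

/-! ### The cotangent bundle in the charts of the flag manifold -/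

namespace FlagDatum

variable {A : Type} [NormedRing A] [NormedAlgebra ℝ A] [CompleteSpace A]
  [FiniteDimensional ℝ A] [StarRing A] [StarModule ℝ A] {𝔤 : Submodule ℝ A} {E : A}
  {tr : A →ₗ[ℝ] ℝ} {G U : Subgroup Aˣ} (D : FlagDatum G U 𝔤 E) {K : Subgroup U}

/-- The chosen unitary representative of a point of `U ⧸ K`. -/
def rep (x : U ⧸ K) : Aˣ := ((x.out : U) : Aˣ)

lemma rep_mem (x : U ⧸ K) : rep x ∈ U := x.out.2

variable [ChartedSpace (EuclideanSpace ℝ (Fin (Module.finrank ℝ (lowerBlock 𝔤 E)))) (U ⧸ K)]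

variable (𝔤 E) in
/-- The charts of `U ⧸ K` are the big cell coordinates translated by the chosen representatives,
and `β` is the projection of `G` onto the flag manifold `U ⧸ K`. -/
structure IsFlagAtlas (β : G → U ⧸ K) : Prop where
  mem_source : ∀ (x : U ⧸ K) (u : U),
    (u : U ⧸ K) ∈ (chartAt (EuclideanSpace ℝ (Fin (Module.finrank ℝ (lowerBlock 𝔤 E)))) x).source ↔
      IsUnit (pivot E (((rep x)⁻¹ * (u : Aˣ) : Aˣ) : A))
  chart_apply : ∀ (x : U ⧸ K) (u : U), IsUnit (pivot E (((rep x)⁻¹ * (u : Aˣ) : Aˣ) : A)) →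
    chartAt (EuclideanSpace ℝ (Fin (Module.finrank ℝ (lowerBlock 𝔤 E)))) x (u : U ⧸ K) =
      HasExpLieAlgebra.proj _ (cellCoord E (((rep x)⁻¹ * (u : Aˣ) : Aˣ) : A))
  base_eq_iff : ∀ (g : G) (u : U), β g = u ↔ stabRange E (((u : Aˣ)⁻¹ * (g : Aˣ) : Aˣ) : A)
  mem_iff : ∀ u : U, u ∈ K ↔ ((u : Aˣ) : A) * E = E * ((u : Aˣ) : A)

variable {β : G → U ⧸ K} (B : IsFlagAtlas 𝔤 E β)

section Atlas

include B

lemma IsFlagAtlas.stabRange_rep (g : G) :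
    stabRange E (((rep (β g))⁻¹ * (g : Aˣ) : Aˣ) : A) :=
  (B.base_eq_iff g (β g).out).1 (QuotientGroup.out_eq' _).symm

include D in
lemma IsFlagAtlas.pivot_rep_iff (v : Aˣ) (g : G) :
    IsUnit (pivot E ((v * rep (β g) : Aˣ) : A)) ↔ IsUnit (pivot E ((v * (g : Aˣ) : Aˣ) : A)) := by
  have h := B.stabRange_rep g
  have hu := isUnit_pivot_of_stab D.idem _ h (h.inv D.idem)
  have h1 : v * (g : Aˣ) = (v * rep (β g)) * ((rep (β g))⁻¹ * (g : Aˣ)) := by group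
  rw [h1, Units.val_mul (v * rep (β g)), pivot_mul D.idem h, hu.mul_right_iff]

include D in
lemma IsFlagAtlas.cellCoord_rep (v : Aˣ) (g : G)
    (hv : IsUnit (pivot E ((v * rep (β g) : Aˣ) : A))) :
    cellCoord E ((v * (g : Aˣ) : Aˣ) : A) = cellCoord E ((v * rep (β g) : Aˣ) : A) := by
  have h := B.stabRange_rep g
  have h1 : v * (g : Aˣ) = (v * rep (β g)) * ((rep (β g))⁻¹ * (g : Aˣ)) := by group
  rw [h1, Units.val_mul (v * rep (β g)), cellCoord_mul D.idem _ hv h (h.inv D.idem)]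

include D in
lemma IsFlagAtlas.base_mem_source {x₀ : U ⧸ K} {g : G} :
    β g ∈ (chartAt (EuclideanSpace ℝ (Fin (Module.finrank ℝ (lowerBlock 𝔤 E)))) x₀).source ↔
      IsUnit (pivot E (((rep x₀)⁻¹ * (g : Aˣ) : Aˣ) : A)) := by
  rw [← B.pivot_rep_iff D, ← QuotientGroup.out_eq' (β g), B.mem_source, QuotientGroup.out_eq']
  rfl

include D in
lemma IsFlagAtlas.chart_base {x₀ : U ⧸ K} {g : G}
    (h : IsUnit (pivot E (((rep x₀)⁻¹ * (g : Aˣ) : Aˣ) : A))) :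
    chartAt (EuclideanSpace ℝ (Fin (Module.finrank ℝ (lowerBlock 𝔤 E)))) x₀ (β g) =
      HasExpLieAlgebra.proj _ (cellCoord E (((rep x₀)⁻¹ * (g : Aˣ) : Aˣ) : A)) := by
  have h' := (B.pivot_rep_iff D (rep x₀)⁻¹ g).2 h
  rw [B.cellCoord_rep D _ _ h', ← QuotientGroup.out_eq' (β g)]
  have h2 := B.chart_apply x₀ (β g).out h'
  rw [QuotientGroup.out_eq'] at h2 ⊢
  exact h2

lemma IsFlagAtlas.base_inclusion (u : U) : β (Subgroup.inclusion D.le u) = u := by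
  rw [B.base_eq_iff]
  simp [stabRange, D.idem]

/-- `U ⧸ K` has a chart inverse given by unipotent lower elements. -/
lemma IsFlagAtlas.chart_symm (x₀ : U ⧸ K) (y) :
    (chartAt (EuclideanSpace ℝ (Fin (Module.finrank ℝ (lowerBlock 𝔤 E)))) x₀).symm y =
      β (Subgroup.inclusion D.le x₀.out * D.lower y) := by
  have hy := HasExpLieAlgebra.incl_mem (lowerBlock 𝔤 E) y
  have h1 : (rep x₀)⁻¹ * ((Subgroup.inclusion D.le x₀.out * D.lower y : G) : Aˣ) =
      (D.lower y : Aˣ) := by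
    rw [Subgroup.coe_mul]; exact inv_mul_cancel_left _ _
  have hp : IsUnit (pivot E (((rep x₀)⁻¹ *
      ((Subgroup.inclusion D.le x₀.out * D.lower y : G) : Aˣ) : Aˣ) : A)) := by
    rw [h1, D.val_lower, pivot_one_add D.idem hy.2]; exact isUnit_one
  have h2 := B.chart_base D hp
  rw [h1, D.val_lower, cellCoord_one_add D.idem hy.2, HasExpLieAlgebra.proj_incl] at h2
  conv_lhs => rw [← h2]
  exact OpenPartialHomeomorph.left_inv _ ((B.base_mem_source D).2 hp)

/-- Left translation by `u ∈ U`, in the charts. -/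
lemma IsFlagAtlas.translate_chart (x x₀ : U ⧸ K) (u : U) (y)
    (h : IsUnit (pivot E ((((rep x)⁻¹ * (u : Aˣ) * rep x₀ : Aˣ) : A) *
      (1 + HasExpLieAlgebra.incl (lowerBlock 𝔤 E) y)))) :
    chartAt (EuclideanSpace ℝ (Fin (Module.finrank ℝ (lowerBlock 𝔤 E)))) x
      (β (Subgroup.inclusion D.le u * (Subgroup.inclusion D.le x₀.out * D.lower y))) =
      HasExpLieAlgebra.proj _ (cellCoord E ((((rep x)⁻¹ * (u : Aˣ) * rep x₀ : Aˣ) : A) *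
      (1 + HasExpLieAlgebra.incl (lowerBlock 𝔤 E) y))) := by
  have h1 : ((((rep x)⁻¹ * (u : Aˣ) * rep x₀ : Aˣ) : A) *
      (1 + HasExpLieAlgebra.incl (lowerBlock 𝔤 E) y)) = (((rep x)⁻¹ *
        ((Subgroup.inclusion D.le u * (Subgroup.inclusion D.le x₀.out * D.lower y) : G) : Aˣ) :
        Aˣ) : A) := by
    rw [← D.val_lower, ← Units.val_mul, mul_assoc, mul_assoc, Subgroup.coe_mul, Subgroup.coe_mul]
    rfl
  rw [h1] at h ⊢
  exact B.chart_base D h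

end Atlas

variable [IsManifold (𝓡 (Module.finrank ℝ (lowerBlock 𝔤 E))) ∞ (U ⧸ K)]

variable (𝔤 E tr) in
/-- The cotangent vector at `x` given by the trace pairing with `M`, in the chart around `x`. -/
def cotangentPoint (x : U ⧸ K) (M : A) :
    CotangentBundle (d := Module.finrank ℝ (lowerBlock 𝔤 E)) (U ⧸ K) :=
  ⟨x, pairing 𝔤 E tr M⟩

include D in
/-- The expression of a pairing in the trivialization of the cotangent bundle around `x₀`. -/
lemma IsFlagAtlas.inCoordinates_pairing (B : IsFlagAtlas 𝔤 E β) (htr : IsTraceForm tr)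
    (x₀ x : U ⧸ K)
    (hx : x ∈ (chartAt (EuclideanSpace ℝ (Fin (Module.finrank ℝ (lowerBlock 𝔤 E)))) x₀).source)
    {N : A} (hN : IsUpper E N) :
    ContinuousLinearMap.inCoordinates
      (EuclideanSpace ℝ (Fin (Module.finrank ℝ (lowerBlock 𝔤 E))))
      (TangentSpace (M := U ⧸ K) (𝓡 (Module.finrank ℝ (lowerBlock 𝔤 E)))) ℝ
      (Bundle.Trivial (U ⧸ K) ℝ) x₀ x x₀ x (cotangentPoint 𝔤 E tr x N).2 =
    pairing 𝔤 E tr ((((rep x₀)⁻¹ * rep x : Aˣ) : A) * N * (((rep x)⁻¹ * rep x₀ : Aˣ) : A)) := by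
  set b : G := (Subgroup.inclusion D.le x.out)⁻¹ * Subgroup.inclusion D.le x₀.out with hbdef
  have hb : (b : Aˣ) = (rep x)⁻¹ * rep x₀ := rfl
  have hbi : (b : Aˣ)⁻¹ = (rep x₀)⁻¹ * rep x := by rw [hb]; group
  set y₀ := chartAt (EuclideanSpace ℝ (Fin (Module.finrank ℝ (lowerBlock 𝔤 E)))) x₀ x
  have hsx : β (Subgroup.inclusion D.le x₀.out * D.lower y₀) = x := by
    rw [← B.chart_symm D, OpenPartialHomeomorph.left_inv _ hx]
  have hst : stabRange E ((b * D.lower y₀ : Aˣ) : A) := by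
    have := B.stabRange_rep (Subgroup.inclusion D.le x₀.out * D.lower y₀)
    rw [hsx] at this
    rw [hb, mul_assoc]
    exact this
  obtain ⟨T, hT, hTN⟩ := D.hasFDerivAt_translate htr b y₀ hst
  -- The change of trivialization of the tangent bundle is the derivative of the change of charts,
  -- which is left translation by `b` in the big cell coordinates.
  have hTc : (tangentBundleCore (𝓡 (Module.finrank ℝ (lowerBlock 𝔤 E))) (U ⧸ K)).coordChange
      (achart _ x₀) (achart _ x) x = T := by
    rw [tangentBundleCore_coordChange_achart]
    simp only [mfld_simps, fderivWithin_univ]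
    refine (hT.congr_of_eventuallyEq ?_).fderiv
    have hp : IsUnit (pivot E (((b : Aˣ) : A) *
        (1 + HasExpLieAlgebra.incl (lowerBlock 𝔤 E) y₀))) := by
      rw [← D.val_lower, ← Units.val_mul]
      exact isUnit_pivot_of_stab D.idem _ hst (hst.inv D.idem)
    have hc : Continuous (fun y => pivot E (((b : Aˣ) : A) *
        (1 + HasExpLieAlgebra.incl (lowerBlock 𝔤 E) y))) := by
      unfold pivot; fun_prop
    filter_upwards [(Units.isOpen.preimage hc).mem_nhds hp] with y hy
    have := B.translate_chart D x x₀ 1 y (by rw [Subgroup.coe_one, mul_one]; exact hy)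
    rw [Subgroup.coe_one, mul_one, map_one, one_mul] at this
    rw [Function.comp_apply, B.chart_symm D]
    exact this
  rw [← hbi, ← hb]
  refine Eq.trans ?_ (hTN N hN)
  rw [← hTc, ← TangentBundle.symmL_trivializationAt_eq_core hx]
  have ht := Bundle.Trivial.continuousLinearMapAt_trivialization ℝ (U ⧸ K) ℝ x
  change (Bundle.Trivialization.continuousLinearMapAt ℝ (Bundle.Trivial.trivialization (U ⧸ K) ℝ)
    x).comp _ = _
  rw [ht]
  rfl

end FlagDatum

/-! ### The cotangent vector of a group element -/

namespace FlagDatum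

variable {A : Type} [NormedRing A] [NormedAlgebra ℝ A] [CompleteSpace A]
  [FiniteDimensional ℝ A] [StarRing A] [StarModule ℝ A] {𝔤 : Submodule ℝ A} {E : A}
  {tr : A →ₗ[ℝ] ℝ} {G U : Subgroup Aˣ} (D : FlagDatum G U 𝔤 E) {K : Subgroup U}
  [ChartedSpace (EuclideanSpace ℝ (Fin (Module.finrank ℝ (lowerBlock 𝔤 E)))) (U ⧸ K)]
  {β : G → U ⧸ K}

section Base

variable (B : IsFlagAtlas 𝔤 E β)

include B

include D in
lemma IsFlagAtlas.base_mul_comm (g : G) {z : G} (hz : ((z : Aˣ) : A) * E = E * ((z : Aˣ) : A)) :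
    β (g * z) = β g := by
  rw [← QuotientGroup.out_eq' (β g)]
  rw [B.base_eq_iff, Subgroup.coe_mul, ← mul_assoc]
  have h := stabRange_of_comm D.idem hz
  exact (B.stabRange_rep g).mul h

lemma IsFlagAtlas.base_smul (u : U) (g : G) : β (Subgroup.inclusion D.le u * g) = u • β g := by
  have h : u • β g = ((u * (β g).out : U) : U ⧸ K) := by
    conv_lhs => rw [← QuotientGroup.out_eq' (β g)]
    rfl
  rw [h, B.base_eq_iff]
  have h2 : ((u * (β g).out : U) : Aˣ)⁻¹ * ((Subgroup.inclusion D.le u * g : G) : Aˣ) =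
      (rep (β g))⁻¹ * (g : Aˣ) := by
    rw [Subgroup.coe_mul, Subgroup.coe_mul, mul_inv_rev, mul_assoc]
    congr 1
    exact inv_mul_cancel_left _ _
  rw [h2]
  exact B.stabRange_rep g

include D in
/-- Representatives of the same point of the flag manifold give conjugate idempotents. -/
lemma IsFlagAtlas.rep_comm {x : U ⧸ K} {u : U} (h : (u : U ⧸ K) = x) :
    (((rep x)⁻¹ * (u : Aˣ) : Aˣ) : A) * E = E * (((rep x)⁻¹ * (u : Aˣ) : Aˣ) : A) := by
  refine (B.mem_iff (x.out⁻¹ * u)).1 ?_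
  rw [← QuotientGroup.eq, h]
  exact QuotientGroup.out_eq' _

end Base

variable [IsManifold (𝓡 (Module.finrank ℝ (lowerBlock 𝔤 E))) ∞ (U ⧸ K)]

variable (𝔤 E tr β) in
/-- The cotangent vector of the flag manifold attached to `g ∈ G`: it sits over the base point of
`g`, and is represented by the upper block of `g E g⁻¹`, moved to the origin. -/
def cotangentVector (g : G) : CotangentBundle (d := Module.finrank ℝ (lowerBlock 𝔤 E)) (U ⧸ K) :=
  cotangentPoint 𝔤 E tr (β g) (upperPart E ((rep (β g))⁻¹ * (g : Aˣ)))

lemma cotangentVector_of_base {g : G} {x : U ⧸ K} (h : β g = x) :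
    cotangentVector 𝔤 E tr β g = cotangentPoint 𝔤 E tr x (upperPart E ((rep x)⁻¹ * (g : Aˣ))) := by
  rw [cotangentVector, h]

variable (B : IsFlagAtlas 𝔤 E β) (htr : IsTraceForm tr)

lemma _root_.FlagCotangent.upperPart_mul_comm {g z : Aˣ} (hz : (z : A) * E = E * (z : A)) :
    upperPart E (g * z) = upperPart E g := by
  have := orbitCoord_mul_comm (g := g) hz
  exact neg_injective this

include D B in
lemma cotangentVector_mul (g : G) {z : G} (hz : ((z : Aˣ) : A) * E = E * ((z : Aˣ) : A)) :
    cotangentVector 𝔤 E tr β (g * z) = cotangentVector 𝔤 E tr β g := by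
  rw [cotangentVector_of_base (B.base_mul_comm D g hz), cotangentVector, Subgroup.coe_mul,
    ← mul_assoc, upperPart_mul_comm hz]

/-- The element of `G` which gives a prescribed cotangent vector. -/
def cotangentRep (ξ : CotangentBundle (d := Module.finrank ℝ (lowerBlock 𝔤 E)) (U ⧸ K)) : G :=
  Subgroup.inclusion D.le ξ.proj.out * D.unipotent (D.dualVector_mem htr ξ.2)

lemma rep_inv_mul_cotangentRep
    (ξ : CotangentBundle (d := Module.finrank ℝ (lowerBlock 𝔤 E)) (U ⧸ K)) :
    (rep ξ.proj)⁻¹ * (D.cotangentRep htr ξ : Aˣ) = (D.unipotent (D.dualVector_mem htr ξ.2) : Aˣ) :=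
  inv_mul_cancel_left _ _

include B in
lemma base_cotangentRep
    (ξ : CotangentBundle (d := Module.finrank ℝ (lowerBlock 𝔤 E)) (U ⧸ K)) :
    β (D.cotangentRep htr ξ) = ξ.proj := by
  have h : ξ.proj = (ξ.proj.out : U ⧸ K) := (QuotientGroup.out_eq' _).symm
  rw [h, B.base_eq_iff]
  have := D.rep_inv_mul_cotangentRep htr ξ
  rw [rep] at this
  rw [this]
  exact D.stabRange_unipotent _

include B in
lemma cotangentVector_cotangentRep
    (ξ : CotangentBundle (d := Module.finrank ℝ (lowerBlock 𝔤 E)) (U ⧸ K)) :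
    cotangentVector 𝔤 E tr β (D.cotangentRep htr ξ) = ξ := by
  rw [cotangentVector_of_base (D.base_cotangentRep B htr ξ), rep_inv_mul_cotangentRep,
    upperPart_unipotent, cotangentPoint]
  have := D.pairing_dualVector htr ξ.2
  exact congrArg (fun α => (⟨ξ.proj, α⟩ :
    CotangentBundle (d := Module.finrank ℝ (lowerBlock 𝔤 E)) (U ⧸ K))) this

include B in
/-- The element reconstructed from the cotangent vector of `g` agrees with `g` modulo the
centralizer of `E`. -/
lemma cotangentRep_cotangentVector (g : G) :
    (((D.cotangentRep htr (cotangentVector 𝔤 E tr β g) : Aˣ)⁻¹ * (g : Aˣ) : Aˣ) : A) * E =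
      E * (((D.cotangentRep htr (cotangentVector 𝔤 E tr β g) : Aˣ)⁻¹ * (g : Aˣ) : Aˣ) : A) := by
  set p := (rep (β g))⁻¹ * (g : Aˣ) with hp
  have hpG : p ∈ G := G.mul_mem (G.inv_mem (D.le (rep_mem _))) g.2
  have h1 := D.dualVector_pairing htr (D.upperPart_mem hpG)
  have h2 : (D.unipotent (D.dualVector_mem htr (cotangentVector 𝔤 E tr β g).2) : Aˣ)
      = (rep (β g))⁻¹ * (D.cotangentRep htr (cotangentVector 𝔤 E tr β g) : Aˣ) :=
    (D.rep_inv_mul_cotangentRep htr _).symm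
  have h3 := D.conj_unipotent (D.dualVector_mem htr (cotangentVector 𝔤 E tr β g).2)
  have h4 : D.dualVector htr (cotangentVector 𝔤 E tr β g).2 = upperPart E p := h1
  have h6 := h3.trans (congrArg (fun X => E + X) h4)
  rw [← D.conj_of_stabRange (B.stabRange_rep g), h2] at h6
  have h5 := comm_of_conj_eq h6
  rw [mul_inv_rev, inv_inv, mul_assoc, mul_inv_cancel_left] at h5
  exact h5

include D B htr in
/-- The local expression of a cotangent vector: moving it to another chart subtracts the upper
block of the Hermitian idempotent of the base point. -/
lemma pairing_conj_upperPart (v : Aˣ) (hv : v ∈ U) (g : G)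
    (hg : IsUnit (pivot E ((v * (g : Aˣ) : Aˣ) : A))) :
    pairing 𝔤 E tr (((v * rep (β g) : Aˣ) : A) * upperPart E ((rep (β g))⁻¹ * (g : Aˣ)) *
      (((rep (β g))⁻¹ * v⁻¹ : Aˣ) : A)) =
    pairing 𝔤 E tr (upperPart E (v * (g : Aˣ)) -
      graphPart (cellCoord E ((v * (g : Aˣ) : Aˣ) : A))) ∧
    graphPart (cellCoord E ((v * (g : Aˣ) : Aˣ) : A)) ∈ upperBlock 𝔤 E ∧
    IsUnit (1 + star (cellCoord E ((v * (g : Aˣ) : Aˣ) : A)) *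
      cellCoord E ((v * (g : Aˣ) : Aˣ) : A)) := by
  have hs : v * rep (β g) ∈ U := U.mul_mem hv (rep_mem _)
  have hg' := (B.pivot_rep_iff D v g).2 hg
  obtain ⟨h0, h1⟩ := upperPart_unitary D.idem D.star_idem (D.unitary _ hs) hg'
  rw [B.cellCoord_rep D v g hg', ← h1]
  refine ⟨?_, D.upperPart_mem (D.le hs), h0⟩
  have h2 := D.conj_of_stabRange (B.stabRange_rep g)
  have h3 : upperPart E ((rep (β g))⁻¹ * (g : Aˣ)) =
      (((rep (β g))⁻¹ * (g : Aˣ) : Aˣ) : A) * E *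
        ((((rep (β g))⁻¹ * (g : Aˣ))⁻¹ : Aˣ) : A) - E := by
    rw [h2]; abel
  have h4 : (((v * rep (β g) : Aˣ) : A) * upperPart E ((rep (β g))⁻¹ * (g : Aˣ)) *
      (((rep (β g))⁻¹ * v⁻¹ : Aˣ) : A)) =
      ((v * (g : Aˣ) : Aˣ) : A) * E * (((v * (g : Aˣ))⁻¹ : Aˣ) : A) -
      ((v * rep (β g) : Aˣ) : A) * E * (((v * rep (β g))⁻¹ : Aˣ) : A) := by
    rw [h3, mul_sub, sub_mul, ← mul_inv_rev]
    congr 1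
    have h5 : v * (g : Aˣ) = (v * rep (β g)) * ((rep (β g))⁻¹ * (g : Aˣ)) := by group
    rw [h5, mul_inv_rev (v * rep (β g)), Units.val_mul (v * rep (β g)), Units.val_mul _ (_)⁻¹]
    simp only [mul_assoc]
  refine pairing_congr htr ?_
  have h5 : ∀ a b : A, E * (a - b) * (1 - E) = E * a * (1 - E) - E * b * (1 - E) := fun a b => by
    noncomm_ring
  rw [h4, h5, h5, ← upperPart_eq_conj, ← upperPart_eq_conj,
    (isUpper_upperPart D.idem _).eq, (isUpper_upperPart D.idem _).eq]

include D B htr in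
lemma inCoordinates_cotangentVector (x₀ : U ⧸ K) (g : G)
    (hg : IsUnit (pivot E (((rep x₀)⁻¹ * (g : Aˣ) : Aˣ) : A))) :
    ContinuousLinearMap.inCoordinates
      (EuclideanSpace ℝ (Fin (Module.finrank ℝ (lowerBlock 𝔤 E))))
      (TangentSpace (M := U ⧸ K) (𝓡 (Module.finrank ℝ (lowerBlock 𝔤 E)))) ℝ
      (Bundle.Trivial (U ⧸ K) ℝ) x₀ (cotangentVector 𝔤 E tr β g).proj x₀
      (cotangentVector 𝔤 E tr β g).proj (cotangentVector 𝔤 E tr β g).2 =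
    pairing 𝔤 E tr (upperPart E ((rep x₀)⁻¹ * (g : Aˣ)) -
      graphPart (cellCoord E (((rep x₀)⁻¹ * (g : Aˣ) : Aˣ) : A))) := by
  have h1 := B.inCoordinates_pairing D htr x₀ (β g) ((B.base_mem_source D).2 hg)
    (isUpper_upperPart D.idem ((rep (β g))⁻¹ * (g : Aˣ)))
  have h2 := (D.pairing_conj_upperPart B htr (rep x₀)⁻¹ (U.inv_mem (rep_mem _)) g hg).1
  rw [inv_inv] at h2
  exact h1.trans h2

section Smooth

variable {𝔩 : Submodule ℝ A} (hG : HasExpLieAlgebra G 𝔩)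

include D B htr in
/-- The cotangent vector of `g` depends smoothly on `g`. -/
lemma contMDiff_cotangentVector
    (hβ : letI := hG.chartedSpace
      ContMDiff (𝓡 (Module.finrank ℝ 𝔩)) (𝓡 (Module.finrank ℝ (lowerBlock 𝔤 E))) ∞ β) :
    letI := hG.chartedSpace
    ContMDiff (𝓡 (Module.finrank ℝ 𝔩)) ((𝓡 (Module.finrank ℝ (lowerBlock 𝔤 E))).prod
      𝓘(ℝ, EuclideanSpace ℝ (Fin (Module.finrank ℝ (lowerBlock 𝔤 E))) →L[ℝ] ℝ)) ∞
      (cotangentVector 𝔤 E tr β) := by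
  let := hG.chartedSpace
  have := hG.lieGroup
  intro g₀
  rw [contMDiffAt_hom_bundle]
  refine ⟨hβ g₀, ?_⟩
  set x₀ := β g₀ with hx₀
  set v := (rep x₀)⁻¹ with hv
  have hvU : v ∈ U := U.inv_mem (rep_mem _)
  have hc : Continuous (fun g : G => pivot E ((v * (g : Aˣ) : Aˣ) : A)) := by
    unfold pivot; fun_prop
  -- Around `g₀` the cotangent vector has the smooth local expression
  -- `upperPart (v g) - graphPart (cellCoord (v g))`.
  have hg₀ : IsUnit (pivot E ((v * (g₀ : Aˣ) : Aˣ) : A)) := by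
    have h := B.stabRange_rep g₀
    exact isUnit_pivot_of_stab D.idem _ h (h.inv D.idem)
  have h1 : ContMDiffAt (𝓡 (Module.finrank ℝ 𝔩)) 𝓘(ℝ, A) ∞
      (fun g : G => upperPart E (v * (g : Aˣ)) -
        graphPart (cellCoord E ((v * (g : Aˣ) : Aˣ) : A))) g₀ := by
    refine ContMDiffAt.sub ?_ ?_
    · have h1 : ContDiff ℝ ∞ (fun p : A × A => E * ((v : A) * p.1) * E * (p.2 * ((v⁻¹ : Aˣ) : A)) *
          (1 - E)) := by fun_prop
      have h2 := (h1.contMDiff.comp (hG.contMDiff_val.prodMk_space hG.contMDiff_val_inv))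
      refine (h2.contMDiffAt (x := g₀)).congr_of_eventuallyEq (Eventually.of_forall fun g => ?_)
      simp only [upperPart, mul_inv_rev, Units.val_mul, Function.comp_apply]
    · have h3 := (D.pairing_conj_upperPart B htr v hvU g₀ hg₀).2.2
      rw [Units.val_mul] at h3 hg₀
      have h2 : ContDiffAt ℝ ∞ (fun a : A => graphPart (cellCoord E ((v : A) * a)))
          ((g₀ : Aˣ) : A) := by
        have h4 : ContDiffAt ℝ ∞ (fun a : A => (v : A) * a) ((g₀ : Aˣ) : A) := by fun_prop
        have h5 := ContDiffAt.comp ((g₀ : Aˣ) : A) (contDiffAt_cellCoord hg₀) h4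
        exact (show ContDiffAt ℝ ∞ graphPart ((cellCoord E ∘ fun a : A => (v : A) * a)
          ((g₀ : Aˣ) : A)) from contDiffAt_graphPart h3).comp _ h5
      refine (hG.contMDiffAt_comp_val h2).congr_of_eventuallyEq (Eventually.of_forall fun g => ?_)
      simp only [Units.val_mul]
  have h2 : ContDiff ℝ ∞ (pairing 𝔤 E tr) := (LinearMap.toContinuousLinearMap
    (pairing 𝔤 E tr)).contDiff
  refine (ContMDiffAt.comp g₀ h2.contMDiff.contMDiffAt h1).congr_of_eventuallyEq ?_
  filter_upwards [(Units.isOpen.preimage hc).mem_nhds hg₀] with g hg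
  exact D.inCoordinates_cotangentVector B htr x₀ g hg

variable {Z : Subgroup G} (hZ : ∀ g : G, g ∈ Z ↔ ((g : Aˣ) : A) * E = E * ((g : Aˣ) : A))

include B in
/-- The point of the orbit depends smoothly on the cotangent vector. -/
lemma contMDiff_mk_cotangentRep :
    letI := hG.chartedSpace
    letI := hG.lieGroup
    letI := (D.orbitCosetCoord hG hZ).chartedSpace Quotient.out QuotientGroup.out_eq'
    ContMDiff ((𝓡 (Module.finrank ℝ (lowerBlock 𝔤 E))).prod
      𝓘(ℝ, EuclideanSpace ℝ (Fin (Module.finrank ℝ (lowerBlock 𝔤 E))) →L[ℝ] ℝ))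
      (𝓡 (Module.finrank ℝ (offDiagonal 𝔤 E))) ∞
      (fun ξ : CotangentBundle (d := Module.finrank ℝ (lowerBlock 𝔤 E)) (U ⧸ K) =>
        (D.cotangentRep htr ξ : G ⧸ Z)) := by
  let := hG.chartedSpace
  have := hG.lieGroup
  let C := D.orbitCosetCoord hG hZ
  let := C.chartedSpace Quotient.out QuotientGroup.out_eq'
  intro ξ₀
  obtain ⟨h1, h2⟩ := (contMDiffAt_hom_bundle (IM := (𝓡 (Module.finrank ℝ (lowerBlock 𝔤 E))).prod
      𝓘(ℝ, EuclideanSpace ℝ (Fin (Module.finrank ℝ (lowerBlock 𝔤 E))) →L[ℝ] ℝ)) (n := ∞)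
      (fun ξ : CotangentBundle (d := Module.finrank ℝ (lowerBlock 𝔤 E)) (U ⧸ K) => ξ)
      (x₀ := ξ₀)).1 contMDiffAt_id
  set x₀ := ξ₀.proj with hx₀
  set I := HasExpLieAlgebra.incl (lowerBlock 𝔤 E)
  set a := fun ξ : CotangentBundle (d := Module.finrank ℝ (lowerBlock 𝔤 E)) (U ⧸ K) =>
    ContinuousLinearMap.inCoordinates
      (EuclideanSpace ℝ (Fin (Module.finrank ℝ (lowerBlock 𝔤 E))))
      (TangentSpace (M := U ⧸ K) (𝓡 (Module.finrank ℝ (lowerBlock 𝔤 E)))) ℝ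
      (Bundle.Trivial (U ⧸ K) ℝ) x₀ ξ.proj x₀ ξ.proj ξ.2 with ha
  set c := chartAt (EuclideanSpace ℝ (Fin (Module.finrank ℝ (lowerBlock 𝔤 E)))) x₀
  -- Inverse of the local expression: from the base point with coordinate `Y` and the functional `a`
  -- one recovers the orbit coordinates `Y` and `-(dualVector a + graphPart Y)`.
  have hkey : ∀ ξ : CotangentBundle (d := Module.finrank ℝ (lowerBlock 𝔤 E)) (U ⧸ K),
      ξ.proj ∈ c.source → IsUnit (1 + star (I (c ξ.proj)) * I (c ξ.proj)) ∧
      (D.cotangentRep htr ξ : G ⧸ Z) = (C.chart (Subgroup.inclusion D.le x₀.out)).symm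
        (HasExpLieAlgebra.proj (offDiagonal 𝔤 E)
          (-(D.dualVector htr (a ξ) + graphPart (I (c ξ.proj))) + I (c ξ.proj))) := by
    intro ξ hξ
    set g := D.cotangentRep htr ξ with hg
    have hb := D.base_cotangentRep B htr ξ
    have hp : IsUnit (pivot E (((rep x₀)⁻¹ * (g : Aˣ) : Aˣ) : A)) := by
      rw [← B.base_mem_source D, hb]; exact hξ
    have h3 := D.inCoordinates_cotangentVector B htr x₀ g hp
    obtain ⟨-, h4, h5⟩ := D.pairing_conj_upperPart B htr (rep x₀)⁻¹ (U.inv_mem (rep_mem _)) g hp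
    rw [D.cotangentVector_cotangentRep B htr ξ] at h3
    have h6 : (rep x₀)⁻¹ * (g : Aˣ) ∈ G := G.mul_mem (G.inv_mem (D.le (rep_mem _))) g.2
    have h7 : D.dualVector htr (a ξ) = upperPart E ((rep x₀)⁻¹ * (g : Aˣ)) -
        graphPart (cellCoord E (((rep x₀)⁻¹ * (g : Aˣ) : Aˣ) : A)) := by
      refine Eq.trans (congrArg (D.dualVector htr) h3) ?_
      exact D.dualVector_pairing htr (sub_mem (D.upperPart_mem h6) h4)
    have h8 : I (c ξ.proj) = cellCoord E (((rep x₀)⁻¹ * (g : Aˣ) : Aˣ) : A) := by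
      rw [← hb, B.chart_base D hp]
      exact HasExpLieAlgebra.incl_proj (D.cellCoord_mem (g := ⟨_, h6⟩) hp)
    rw [h8, h7, sub_add_cancel]
    refine ⟨h5, ?_⟩
    have hd : (Subgroup.inclusion D.le x₀.out)⁻¹ * g ∈ C.dom := hp
    have h9 := C.chart_mk hd
    rw [← (C.chart (Subgroup.inclusion D.le x₀.out)).left_inv (C.mk_mem_chart_source.2 hd), h9]
    rfl
  have hn : ∀ᶠ ξ : CotangentBundle (d := Module.finrank ℝ (lowerBlock 𝔤 E)) (U ⧸ K) in 𝓝 ξ₀,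
      ξ.proj ∈ c.source :=
    h1.continuousAt.preimage_mem_nhds (c.open_source.mem_nhds (mem_chart_source _ x₀))
  have h3 : ContMDiffAt ((𝓡 (Module.finrank ℝ (lowerBlock 𝔤 E))).prod
      𝓘(ℝ, EuclideanSpace ℝ (Fin (Module.finrank ℝ (lowerBlock 𝔤 E))) →L[ℝ] ℝ)) 𝓘(ℝ, A) ∞
      (fun ξ : CotangentBundle (d := Module.finrank ℝ (lowerBlock 𝔤 E)) (U ⧸ K) =>
        I (c ξ.proj)) ξ₀ := by
    have h4 : ContMDiffAt (𝓡 (Module.finrank ℝ (lowerBlock 𝔤 E)))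
      (𝓡 (Module.finrank ℝ (lowerBlock 𝔤 E))) ∞ c ξ₀.proj :=
      contMDiffOn_chart.contMDiffAt (chart_source_mem_nhds _ x₀)
    exact ContMDiffAt.comp ξ₀ I.contDiff.contMDiff.contMDiffAt (ContMDiffAt.comp ξ₀ h4 h1)
  have h4 := (hkey ξ₀ (mem_chart_source _ x₀)).1
  have h5 := ContMDiffAt.comp ξ₀ (contDiffAt_graphPart h4).contMDiffAt h3
  have h6 := ContMDiffAt.comp ξ₀ (D.dualVector htr).contDiff.contMDiff.contMDiffAt h2
  have h7 := ContMDiffAt.comp ξ₀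
    (HasExpLieAlgebra.proj (offDiagonal 𝔤 E)).contDiff.contMDiff.contMDiffAt
    ((h6.add h5).neg.add h3)
  have h8 := ContMDiffAt.comp ξ₀ (C.contMDiff_chart_symm Quotient.out QuotientGroup.out_eq'
    (Subgroup.inclusion D.le x₀.out)).contMDiffAt h7
  refine h8.congr_of_eventuallyEq ?_
  filter_upwards [hn] with ξ hξ
  exact (hkey ξ hξ).2

end Smooth

end FlagDatum

/-! ### Equivariance and the realization of the cotangent bundle -/

namespace FlagDatum

variable {A : Type} [NormedRing A] [NormedAlgebra ℝ A] [CompleteSpace A]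
  [FiniteDimensional ℝ A] [StarRing A] [StarModule ℝ A] {𝔤 : Submodule ℝ A} {E : A}
  {tr : A →ₗ[ℝ] ℝ} {G U : Subgroup Aˣ} (D : FlagDatum G U 𝔤 E) {K : Subgroup U}

section Equivariance

variable
  [ChartedSpace (EuclideanSpace ℝ (Fin (Module.finrank ℝ (lowerBlock 𝔤 E)))) (U ⧸ K)]
  [IsManifold (𝓡 (Module.finrank ℝ (lowerBlock 𝔤 E))) ∞ (U ⧸ K)]
  {β : G → U ⧸ K} (B : IsFlagAtlas 𝔤 E β) (htr : IsTraceForm tr)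

include B htr in
/-- The cotangent vector of `u g` is obtained from that of `g` by the lift of the action of `u`. -/
lemma cotangentVector_smul
    (hsmul : ∀ u : U, ContMDiff (𝓡 (Module.finrank ℝ (lowerBlock 𝔤 E)))
      (𝓡 (Module.finrank ℝ (lowerBlock 𝔤 E))) ∞ (fun x : U ⧸ K => u • x)) (u : U) (g : G) :
    cotangentVector 𝔤 E tr β (Subgroup.inclusion D.le u * g) =
      cotangentLift (fun x : U ⧸ K => u • x) (cotangentVector 𝔤 E tr β g) := by
  set x := β g with hx
  -- `b` is the translation by `u` seen in the charts around `x` and `u x`; it lies in the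
  -- centralizer of `E`, and the transpose of its derivative is conjugation by `b⁻¹`.
  let F : (U ⧸ K) ≃ₘ⟮𝓡 (Module.finrank ℝ (lowerBlock 𝔤 E)),
      𝓡 (Module.finrank ℝ (lowerBlock 𝔤 E))⟯ (U ⧸ K) :=
    { toEquiv := MulAction.toPerm u
      contMDiff_toFun := hsmul u
      contMDiff_invFun := hsmul u⁻¹ }
  set b : G := (Subgroup.inclusion D.le (u • x).out)⁻¹ * Subgroup.inclusion D.le u *
    Subgroup.inclusion D.le x.out with hbdef
  have hb : (b : Aˣ) = (rep (u • x))⁻¹ * (u : Aˣ) * rep x := rfl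
  set c := chartAt (EuclideanSpace ℝ (Fin (Module.finrank ℝ (lowerBlock 𝔤 E)))) x
  set y₀ := c x
  have hsx : β (Subgroup.inclusion D.le x.out * D.lower y₀) = x := by
    rw [← B.chart_symm D, OpenPartialHomeomorph.left_inv _ (mem_chart_source _ x)]
  have hst : stabRange E ((b * D.lower y₀ : Aˣ) : A) := by
    have := B.stabRange_rep
      (Subgroup.inclusion D.le u * (Subgroup.inclusion D.le x.out * D.lower y₀))
    rw [B.base_smul D, hsx] at this
    rw [hb, mul_assoc, mul_assoc]
    exact this
  obtain ⟨T, hT, hTN⟩ := D.hasFDerivAt_translate htr b y₀ hst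
  have hmf : mfderiv (𝓡 (Module.finrank ℝ (lowerBlock 𝔤 E)))
      (𝓡 (Module.finrank ℝ (lowerBlock 𝔤 E))) (fun x : U ⧸ K => u • x) x = T := by
    refine HasMFDerivAt.mfderiv ⟨(hsmul u).continuous.continuousAt, ?_⟩
    simp only [mfld_simps, writtenInExtChartAt]
    refine (hT.congr_of_eventuallyEq ?_).hasFDerivWithinAt
    have hp : IsUnit (pivot E (((b : Aˣ) : A) *
        (1 + HasExpLieAlgebra.incl (lowerBlock 𝔤 E) y₀))) := by
      rw [← D.val_lower, ← Units.val_mul]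
      exact isUnit_pivot_of_stab D.idem _ hst (hst.inv D.idem)
    have hc : Continuous (fun y => pivot E (((b : Aˣ) : A) *
        (1 + HasExpLieAlgebra.incl (lowerBlock 𝔤 E) y))) := by
      unfold pivot; fun_prop
    filter_upwards [(Units.isOpen.preimage hc).mem_nhds hp] with y hy
    have := B.translate_chart D (u • x) x u y hy
    rw [B.base_smul D, ← B.chart_symm D] at this
    exact this
  have hbase : β (Subgroup.inclusion D.le u * g) = u • x := B.base_smul D u g
  have hbK : (((b : Aˣ)) : A) * E = E * ((b : Aˣ) : A) := by
    have hq : ((u * x.out : U) : U ⧸ K) = u • x := by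
      conv_rhs => rw [← QuotientGroup.out_eq' x]
      rfl
    have := B.rep_comm D hq
    rw [hb, mul_assoc]
    exact this
  have h1 : (rep (u • x))⁻¹ * ((Subgroup.inclusion D.le u * g : G) : Aˣ) =
      (b : Aˣ) * ((rep x)⁻¹ * (g : Aˣ)) := by
    rw [hb, Subgroup.coe_mul, mul_assoc _ (rep x), mul_inv_cancel_left, mul_assoc]
    rfl
  have h2 : (pairing 𝔤 E tr (upperPart E ((rep (u • x))⁻¹ *
      ((Subgroup.inclusion D.le u * g : G) : Aˣ)))).comp T =
      pairing 𝔤 E tr (upperPart E ((rep x)⁻¹ * (g : Aˣ))) := by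
    rw [hTN _ (isUpper_upperPart D.idem _), h1, upperPart_comm_mul hbK]
    simp only [← mul_assoc, Units.inv_mul, one_mul]
    rw [mul_assoc, Units.inv_mul, mul_one]
  obtain ⟨e, hTe⟩ : ∃ e : EuclideanSpace ℝ (Fin (Module.finrank ℝ (lowerBlock 𝔤 E))) ≃L[ℝ]
      EuclideanSpace ℝ (Fin (Module.finrank ℝ (lowerBlock 𝔤 E))), T = e :=
    ⟨F.mfderivToContinuousLinearEquiv (by simp) x, hmf.symm⟩
  have h3 : pairing 𝔤 E tr (upperPart E ((rep (u • x))⁻¹ *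
      ((Subgroup.inclusion D.le u * g : G) : Aˣ))) =
      (pairing 𝔤 E tr (upperPart E ((rep x)⁻¹ * (g : Aˣ)))).comp T.inverse := by
    rw [← h2, hTe, ContinuousLinearMap.inverse_equiv]
    ext η
    simp
  rw [cotangentVector_of_base hbase]
  have h4 := congrArg (fun α => (⟨u • x, α⟩ :
    CotangentBundle (d := Module.finrank ℝ (lowerBlock 𝔤 E)) (U ⧸ K))) h3
  refine Eq.trans h4 ?_
  rw [← hmf]
  rfl

end Equivariance

section Fiber

variable (htr : IsTraceForm tr)

include D in
lemma conj_mem_upperBlock {k : Aˣ} (hk : k ∈ G) (hkE : (k : A) * E = E * (k : A)) {X : A}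
    (hX : X ∈ upperBlock 𝔤 E) : (k : A) * X * ((k⁻¹ : Aˣ) : A) ∈ upperBlock 𝔤 E := by
  have h := D.upperPart_mem (G.mul_mem hk (D.unipotent hX).2)
  rwa [upperPart_comm_mul hkE, D.upperPart_unipotent] at h

/-- The identification of the upper block with the cotangent space at a point of the flag manifold
whose representative `k` commutes with `E`. -/
def fiberEquiv {k : Aˣ} (hk : k ∈ G) (hkE : (k : A) * E = E * (k : A)) :
    upperBlock 𝔤 E ≃ₗ[ℝ]
    (EuclideanSpace ℝ (Fin (Module.finrank ℝ (lowerBlock 𝔤 E))) →L[ℝ] ℝ) :=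
  LinearMap.linearEquivOfInjective
    (((pairing 𝔤 E tr).comp (LinearMap.mulLeftRight ℝ ((k : A), ((k⁻¹ : Aˣ) : A)))).comp
      (upperBlock 𝔤 E).subtype)
    ((injective_iff_map_eq_zero _).2 fun X h => by
      have h1 := D.eq_zero_of_pairing htr (D.conj_mem_upperBlock hk hkE X.2) h
      have h2 : (X : A) = ((k⁻¹ : Aˣ) : A) * ((k : A) * X * ((k⁻¹ : Aˣ) : A)) * k := by
        simp [mul_assoc]
      refine Subtype.ext ?_
      rw [h2, h1]
      simp)
    D.finrank_upperBlock

end Fiber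

section Realization

variable {𝔩 𝔲 : Submodule ℝ A} (hG : HasExpLieAlgebra G 𝔩) (hU : HasExpLieAlgebra U 𝔲)
  (hsub : ∀ Y ∈ lowerBlock 𝔤 E, Y - star Y ∈ 𝔲)
  {P Z : Subgroup G} (hP : ∀ g : G, g ∈ P ↔ stabRange E ((g : Aˣ) : A))
  (hK : ∀ u : U, u ∈ K ↔ ((u : Aˣ) : A) * E = E * ((u : Aˣ) : A))
  (hZ : ∀ g : G, g ∈ Z ↔ ((g : Aˣ) : A) * E = E * ((g : Aˣ) : A))
  (htr : IsTraceForm tr)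

include hsub hP hK hZ htr in
/-- The smooth structures on the compact and the complex model of a flag manifold and on the
adjoint orbit, and the realization of the cotangent bundle as the orbit. -/
theorem exists_cotangentRealization [CompactSpace U] [ConnectedSpace G] :
    letI := hG.chartedSpace
    letI := hU.chartedSpace
    ∃ (_ : ChartedSpace (EuclideanSpace ℝ (Fin (Module.finrank ℝ (lowerBlock 𝔤 E)))) (U ⧸ K))
      (_ : ChartedSpace (EuclideanSpace ℝ (Fin (Module.finrank ℝ (lowerBlock 𝔤 E)))) (G ⧸ P))
      (_ : ChartedSpace (EuclideanSpace ℝ (Fin (Module.finrank ℝ (offDiagonal 𝔤 E)))) (G ⧸ Z))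
      (_ : IsManifold (𝓡 (Module.finrank ℝ (lowerBlock 𝔤 E))) ∞ (U ⧸ K)),
      IsHomogeneousManifold (d := Module.finrank ℝ 𝔲)
        (e := Module.finrank ℝ (lowerBlock 𝔤 E)) U K ∧
      IsHomogeneousManifold (d := Module.finrank ℝ 𝔩)
        (e := Module.finrank ℝ (lowerBlock 𝔤 E)) G P ∧
      IsHomogeneousManifold (d := Module.finrank ℝ 𝔩)
        (e := Module.finrank ℝ (offDiagonal 𝔤 E)) G Z ∧
      ∃ φ : (U ⧸ K) ≃ₘ⟮𝓡 (Module.finrank ℝ (lowerBlock 𝔤 E)),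
          𝓡 (Module.finrank ℝ (lowerBlock 𝔤 E))⟯ (G ⧸ P),
        (∀ u : U, φ (QuotientGroup.mk u) = QuotientGroup.mk (Subgroup.inclusion D.le u)) ∧
        ∃ j : (G ⧸ Z) ≃ₘ⟮𝓡 (Module.finrank ℝ (offDiagonal 𝔤 E)),
          (𝓡 (Module.finrank ℝ (lowerBlock 𝔤 E))).prod
            𝓘(ℝ, EuclideanSpace ℝ (Fin (Module.finrank ℝ (lowerBlock 𝔤 E))) →L[ℝ] ℝ)⟯
          CotangentBundle (d := Module.finrank ℝ (lowerBlock 𝔤 E)) (U ⧸ K),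
          (∀ g : G, φ (j (QuotientGroup.mk g)).proj = QuotientGroup.mk g) ∧
          (∀ (u : U) (x : G ⧸ Z), j (Subgroup.inclusion D.le u • x) =
            cotangentLift (fun y : U ⧸ K => u • y) (j x)) ∧
          ∃ L : upperBlock 𝔤 E ≃ₗ[ℝ] CotangentSpace
              (d := Module.finrank ℝ (lowerBlock 𝔤 E)) (U ⧸ K) (QuotientGroup.mk 1),
            ∀ X : upperBlock 𝔤 E, ∃ g : G,
              ((g : Aˣ) : A) * E * (((g : Aˣ)⁻¹ : Aˣ) : A) = E + X ∧
              j (QuotientGroup.mk g) = ⟨QuotientGroup.mk 1, L X⟩ := by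
  let := hG.chartedSpace
  let := hU.chartedSpace
  have := hG.lieGroup
  have := hU.lieGroup
  have hTG := topologicalGroup_of_lieGroup (G := G) (𝓡 (Module.finrank ℝ 𝔩)) ∞
  obtain ⟨φ, hφ⟩ := D.exists_flagHomeo hP hK hG hU hsub
  let CP := D.flagCoord hG hP
  let CZ := D.orbitCosetCoord hG hZ
  -- The charts of `G ⧸ P` are translated by unitary representatives, so that the charts transported
  -- to `U ⧸ K` are translated by `Quotient.out`.
  let r : G ⧸ P → G := fun x => Subgroup.inclusion D.le (φ.symm x).out
  have hr : ∀ x, (r x : G ⧸ P) = x := fun x => by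
    rw [← hφ, QuotientGroup.out_eq', φ.apply_symm_apply]
  let iP := CP.chartedSpace r hr
  let iK := transportChartedSpace (f := Module.finrank ℝ (lowerBlock 𝔤 E)) φ
  let iZ := CZ.chartedSpace Quotient.out QuotientGroup.out_eq'
  have mP := CP.isManifold r hr
  have mK := isManifold_transport (f := Module.finrank ℝ (lowerBlock 𝔤 E)) φ
  let Φ := transportDiffeomorph (f := Module.finrank ℝ (lowerBlock 𝔤 E)) φ
  have hΦ : ∀ x, Φ x = φ x := fun x => rfl
  have hΦ' : ∀ x, Φ.symm x = φ.symm x := fun x => rfl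
  let β : G → U ⧸ K := fun g => φ.symm (g : G ⧸ P)
  have hβ : ContMDiff (𝓡 (Module.finrank ℝ 𝔩)) (𝓡 (Module.finrank ℝ (lowerBlock 𝔤 E))) ∞ β :=
    Φ.symm.contMDiff.comp (CP.contMDiff_mk r hr)
  have hchart : ∀ x : U ⧸ K,
      chartAt (EuclideanSpace ℝ (Fin (Module.finrank ℝ (lowerBlock 𝔤 E)))) x =
      φ.toOpenPartialHomeomorph ≫ₕ CP.chart (Subgroup.inclusion D.le x.out) := fun x => by
    change φ.toOpenPartialHomeomorph ≫ₕ
      CP.chart (Subgroup.inclusion D.le (φ.symm (φ x)).out) = _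
    rw [φ.symm_apply_apply]
  have B : IsFlagAtlas 𝔤 E β :=
    { mem_source := fun x u => by
        rw [hchart]
        simp only [OpenPartialHomeomorph.trans_source, Homeomorph.toOpenPartialHomeomorph_source,
          univ_inter, mem_preimage, Homeomorph.toOpenPartialHomeomorph_apply, hφ]
        exact CP.mk_mem_chart_source
      chart_apply := fun x u hu => by
        rw [hchart]
        simp only [OpenPartialHomeomorph.coe_trans, Function.comp_apply,
          Homeomorph.toOpenPartialHomeomorph_apply, hφ]
        exact CP.chart_mk hu
      base_eq_iff := fun g u => by
        rw [φ.symm_apply_eq, hφ, eq_comm, QuotientGroup.eq, hP]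
        rfl
      mem_iff := hK }
  have hincl : ContMDiff (𝓡 (Module.finrank ℝ 𝔲)) (𝓡 (Module.finrank ℝ 𝔩)) ∞
      (Subgroup.inclusion D.le) := hG.contMDiff_of_val hU.contMDiff_val
  have hmk : ContMDiff (𝓡 (Module.finrank ℝ 𝔲)) (𝓡 (Module.finrank ℝ (lowerBlock 𝔤 E))) ∞
      (QuotientGroup.mk : U → U ⧸ K) := by
    have h : (QuotientGroup.mk : U → U ⧸ K) = β ∘ Subgroup.inclusion D.le := by
      funext u
      exact (B.base_inclusion D u).symm
    rw [h]
    exact hβ.comp hincl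
  have hsmulP : ∀ u : U, ContMDiff (𝓡 (Module.finrank ℝ (lowerBlock 𝔤 E)))
      (𝓡 (Module.finrank ℝ (lowerBlock 𝔤 E))) ∞
      (fun x : G ⧸ P => Subgroup.inclusion D.le u • x) := fun u => by
    refine CP.contMDiff_of_comp_mk r hr ?_
    exact (CP.contMDiff_mk r hr).comp (contMDiff_mul_left (a := Subgroup.inclusion D.le u))
  have hsmul : ∀ u : U, ContMDiff (𝓡 (Module.finrank ℝ (lowerBlock 𝔤 E)))
      (𝓡 (Module.finrank ℝ (lowerBlock 𝔤 E))) ∞ (fun x : U ⧸ K => u • x) := fun u => by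
    have h : (fun x : U ⧸ K => u • x) =
        fun x => Φ.symm (Subgroup.inclusion D.le u • Φ x) := by
      funext x
      induction x using QuotientGroup.induction_on with
      | H v =>
      rw [hΦ, hΦ', hφ, eq_comm, φ.symm_apply_eq, MulAction.Quotient.smul_mk,
        MulAction.Quotient.smul_mk, hφ]
      rfl
    rw [h]
    exact Φ.symm.contMDiff.comp ((hsmulP u).comp Φ.contMDiff)
  refine ⟨iK, iP, iZ, mK, ⟨mK, hmk, fun u => ?_⟩, CP.isHomogeneousManifold r hr,
    CZ.isHomogeneousManifold Quotient.out QuotientGroup.out_eq', Φ, hφ, ?_⟩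
  · obtain ⟨L, hL, hLs⟩ := D.exists_strictFDerivAt_exp hsub
    -- The projection `U → U ⧸ K` is a submersion at `u`: its composition with `w ↦ u exp w` has a
    -- surjective derivative at `0`.
    let c := φ.toOpenPartialHomeomorph ≫ₕ CP.chart (Subgroup.inclusion D.le u)
    have hc : c ∈ atlas (EuclideanSpace ℝ (Fin (Module.finrank ℝ (lowerBlock 𝔤 E)))) (U ⧸ K) :=
      mem_image_of_mem _ (mem_range_self _)
    have hct : c.target = univ := by
      simp only [c, OpenPartialHomeomorph.trans_target,
        Homeomorph.toOpenPartialHomeomorph_target, preimage_univ, inter_univ]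
      rfl
    let S : EuclideanSpace ℝ (Fin (Module.finrank ℝ 𝔲)) → U := fun w => u * hU.exp w
    have hS : ContMDiff (𝓡 (Module.finrank ℝ 𝔲)) (𝓡 (Module.finrank ℝ 𝔲)) ∞ S := by
      refine hU.contMDiff_of_val (ContDiff.contMDiff ?_)
      exact contDiff_const.mul ((contDiff_exp.of_le (by simp)).comp
        (HasExpLieAlgebra.incl 𝔲).contDiff)
    have hS0 : S 0 = u := by
      have : hU.exp 0 = 1 := by
        ext1; ext1
        change NormedSpace.exp (HasExpLieAlgebra.incl 𝔲 0) = 1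
        rw [map_zero, NormedSpace.exp_zero]
      simp only [S, this, mul_one]
    set y : EuclideanSpace ℝ (Fin (Module.finrank ℝ 𝔲)) → _ := fun w =>
      HasExpLieAlgebra.proj (lowerBlock 𝔤 E)
        (cellCoord E (NormedSpace.exp (HasExpLieAlgebra.incl 𝔲 w))) with hy
    have heq : (QuotientGroup.mk ∘ S : _ → U ⧸ K) =ᶠ[𝓝 0] c.symm ∘ y := by
      have ho : {w | IsUnit (pivot E (NormedSpace.exp (HasExpLieAlgebra.incl 𝔲 w)))} ∈
          𝓝 (0 : EuclideanSpace ℝ (Fin (Module.finrank ℝ 𝔲))) := by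
        have hcont : Continuous
            (fun w => pivot E (NormedSpace.exp (HasExpLieAlgebra.incl 𝔲 w))) := by
          have := (contDiff_exp (A := A)).continuous
          unfold pivot
          fun_prop
        refine (Units.isOpen.preimage hcont).mem_nhds ?_
        simp [pivot, D.idem]
      filter_upwards [ho] with w hw
      have h1 : (Subgroup.inclusion D.le u)⁻¹ * Subgroup.inclusion D.le (S w) ∈ CP.dom := by
        simp only [S, map_mul, inv_mul_cancel_left]
        exact hw
      have h2 : (S w : U ⧸ K) ∈ c.source := by
        simp only [c, OpenPartialHomeomorph.trans_source,
          Homeomorph.toOpenPartialHomeomorph_source, univ_inter, mem_preimage,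
          Homeomorph.toOpenPartialHomeomorph_apply, hφ]
        exact CP.mk_mem_chart_source.2 h1
      have h3 : c (S w : U ⧸ K) = y w := by
        simp only [c, OpenPartialHomeomorph.coe_trans, Function.comp_apply,
          Homeomorph.toOpenPartialHomeomorph_apply, hφ]
        rw [CP.chart_mk h1]
        simp only [S, map_mul, inv_mul_cancel_left]
        rfl
      rw [Function.comp_apply, Function.comp_apply, ← h3, c.left_inv h2]
    have hys : HasMFDerivAt (𝓡 (Module.finrank ℝ 𝔲)) (𝓡 (Module.finrank ℝ (lowerBlock 𝔤 E))) y 0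
        L := hL.hasFDerivAt.hasMFDerivAt
    have hcs : MDifferentiableAt (𝓡 (Module.finrank ℝ (lowerBlock 𝔤 E)))
        (𝓡 (Module.finrank ℝ (lowerBlock 𝔤 E))) c.symm (y 0) :=
      (mdifferentiable_of_mem_atlas hc).symm.mdifferentiableAt (by
        rw [OpenPartialHomeomorph.symm_source, hct]; exact mem_univ _)
    have hcsurj : Function.Surjective (mfderiv (𝓡 (Module.finrank ℝ (lowerBlock 𝔤 E)))
        (𝓡 (Module.finrank ℝ (lowerBlock 𝔤 E))) c.symm (y 0)) :=
      (mdifferentiable_of_mem_atlas hc).symm.mfderiv_surjective (by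
        rw [OpenPartialHomeomorph.symm_source, hct]; exact mem_univ _)
    have h4 : Function.Surjective (mfderiv (𝓡 (Module.finrank ℝ 𝔲))
        (𝓡 (Module.finrank ℝ (lowerBlock 𝔤 E))) (QuotientGroup.mk ∘ S : _ → U ⧸ K) 0) := by
      rw [heq.mfderiv_eq, (hcs.hasMFDerivAt.comp 0 hys).mfderiv]
      exact hcsurj.comp hLs
    rw [mfderiv_comp (x := 0) (hmk.mdifferentiableAt (by simp))
      (hS.mdifferentiableAt (by simp))] at h4
    rw [← hS0]
    exact Function.Surjective.of_comp h4
  · let j₀ : G ⧸ Z → CotangentBundle (d := Module.finrank ℝ (lowerBlock 𝔤 E)) (U ⧸ K) :=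
      Quotient.lift (fun g : G => cotangentVector 𝔤 E tr β g) (fun a b hab => by
        have h := (hZ _).1 (QuotientGroup.leftRel_apply.1 hab)
        have h1 := D.cotangentVector_mul (tr := tr) B a h
        rw [mul_inv_cancel_left] at h1
        exact h1.symm)
    have hj₀ : ∀ g : G, j₀ (g : G ⧸ Z) = cotangentVector 𝔤 E tr β g := fun g => rfl
    let j : (G ⧸ Z) ≃ₘ⟮𝓡 (Module.finrank ℝ (offDiagonal 𝔤 E)),
          (𝓡 (Module.finrank ℝ (lowerBlock 𝔤 E))).prod
            𝓘(ℝ, EuclideanSpace ℝ (Fin (Module.finrank ℝ (lowerBlock 𝔤 E))) →L[ℝ] ℝ)⟯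
          CotangentBundle (d := Module.finrank ℝ (lowerBlock 𝔤 E)) (U ⧸ K) :=
      { toFun := j₀
        invFun := fun ξ => (D.cotangentRep htr ξ : G ⧸ Z)
        left_inv := fun x => by
          induction x using QuotientGroup.induction_on with
          | H g =>
          rw [hj₀, QuotientGroup.eq, hZ]
          exact D.cotangentRep_cotangentVector B htr g
        right_inv := fun ξ => by
          rw [hj₀]
          exact D.cotangentVector_cotangentRep B htr ξ
        contMDiff_toFun :=
          CZ.contMDiff_of_comp_mk Quotient.out QuotientGroup.out_eq'
            (D.contMDiff_cotangentVector B htr hG hβ)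
        contMDiff_invFun := D.contMDiff_mk_cotangentRep B htr hG hZ }
    have hj : ∀ g : G, j (g : G ⧸ Z) = cotangentVector 𝔤 E tr β g := fun g => rfl
    refine ⟨j, fun g => ?_, fun u x => ?_, ?_⟩
    · rw [hj]
      exact φ.apply_symm_apply _
    · induction x using QuotientGroup.induction_on with
      | H g =>
      exact D.cotangentVector_smul B htr hsmul u g
    · have h1 := B.rep_comm D (x := QuotientGroup.mk 1) (u := 1) rfl
      rw [Subgroup.coe_one, mul_one] at h1
      have hk : (rep (QuotientGroup.mk 1 : U ⧸ K))⁻¹ ∈ G := G.inv_mem (D.le (rep_mem _))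
      refine ⟨D.fiberEquiv htr hk h1, fun X => ⟨D.unipotent X.2, D.conj_unipotent X.2, ?_⟩⟩
      have hb : β (D.unipotent X.2) = QuotientGroup.mk 1 := by
        rw [B.base_eq_iff, Subgroup.coe_one, inv_one, one_mul]
        exact D.stabRange_unipotent X.2
      rw [hj, cotangentVector_of_base hb, upperPart_comm_mul h1, D.upperPart_unipotent]
      rfl

end Realization

end FlagDatum

/-! ### Groups of complex matrices -/

section MatrixGroups

open scoped Matrix.Norms.L2Operator ComplexOrder

variable {ι : Type} [Fintype ι] [DecidableEq ι]

/-- The real part of the trace. -/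
def reTrace (ι : Type) [Fintype ι] [DecidableEq ι] : Matrix ι ι ℂ →ₗ[ℝ] ℝ :=
  Complex.reLm.comp ((Matrix.traceLinearMap ι ℂ ℂ).restrictScalars ℝ)

lemma isTraceForm_reTrace : IsTraceForm (reTrace ι) where
  comm a b := congrArg Complex.re (Matrix.trace_mul_comm a b)
  definite a h := by
    have h1 : (0 : ℂ) ≤ (a * Matrix.conjTranspose a).trace :=
      (Matrix.posSemidef_self_mul_conjTranspose a).trace_nonneg
    have h2 : (a * Matrix.conjTranspose a).trace = 0 := by
      rw [Complex.le_def] at h1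
      exact Complex.ext h h1.2.symm
    exact Matrix.trace_mul_conjTranspose_self_eq_zero_iff.1 h2

lemma HasExpLieAlgebra.isLinearLieGroup {G : Subgroup (GL ι ℂ)} {𝔩 : Submodule ℝ (Matrix ι ι ℂ)}
    (h : HasExpLieAlgebra G 𝔩) :
    letI := h.chartedSpace
    IsLinearLieGroup (d := Module.finrank ℝ 𝔩) G := by
  let := h.chartedSpace
  let e : Matrix ι ι ℂ →ₗ[ℝ] (ι → ι → ℂ) :=
    { toFun := fun M a b => M a b, map_add' := fun _ _ => rfl, map_smul' := fun _ _ => rfl }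
  let e' := LinearMap.toContinuousLinearMap e
  have hent : entries G = e' ∘ (fun g : G => ((g : GL ι ℂ) : Matrix ι ι ℂ)) := rfl
  refine ⟨h.lieGroup, ?_, fun g => ?_⟩
  · rw [hent]
    exact e'.contDiff.contMDiff.comp h.contMDiff_val
  · have h1 := h.contMDiff_val.mdifferentiableAt (x := g) (by simp)
    have h2 : HasMFDerivAt 𝓘(ℝ, Matrix ι ι ℂ) 𝓘(ℝ, ι → ι → ℂ) e'
        ((g : GL ι ℂ) : Matrix ι ι ℂ) e' := e'.hasFDerivAt.hasMFDerivAt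
    rw [hent, (h2.comp g h1.hasMFDerivAt).mfderiv]
    have h3 := h.injective_mfderiv_val g
    have h4 : Function.Injective e' := fun M N hMN => by
      ext a b; exact congrFun (congrFun hMN a) b
    exact h4.comp h3

/-- The exponential of a multiple of an idempotent. -/
lemma exp_smul_idem {E : Matrix ι ι ℂ} (hE : E * E = E) (z : ℂ) :
    NormedSpace.exp (z • E) = 1 + (Complex.exp z - 1) • E := by
  have hpow : ∀ n : ℕ, n ≠ 0 → (z • E) ^ n = z ^ n • E := by
    intro n hn
    induction n with
    | zero => exact absurd rfl hn
    | succ n ih =>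
      rcases Nat.eq_zero_or_pos n with rfl | h
      · simp
      · rw [pow_succ, ih h.ne', smul_mul_smul_comm, hE, pow_succ]
  have h1 := NormedSpace.exp_series_hasSum_exp' (𝕂 := ℂ) (z • E)
  have h2 : HasSum (fun n : ℕ => ((n.factorial : ℂ)⁻¹ • z ^ n) • E + if n = 0 then (1 - E) else 0)
      (Complex.exp z • E + (1 - E)) := by
    refine HasSum.add ?_ (hasSum_ite_eq 0 (1 - E))
    have h3 := NormedSpace.exp_series_hasSum_exp' (𝕂 := ℂ) z
    rw [← Complex.exp_eq_exp_ℂ] at h3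
    exact h3.smul_const E
  have h3 : (fun n : ℕ => (n.factorial : ℂ)⁻¹ • (z • E) ^ n) =
      (fun n : ℕ => ((n.factorial : ℂ)⁻¹ • z ^ n) • E + if n = 0 then (1 - E) else 0) := by
    funext n
    rcases eq_or_ne n 0 with rfl | hn
    · simp
    · rw [hpow n hn, if_neg hn, add_zero, smul_assoc]
  rw [h3] at h1
  rw [h1.unique h2, sub_smul, one_smul]
  abel

/-- For `H = i π E + c` the exponential is a multiple of the reflection `1 - 2 E`. -/
lemma exp_flag {E : Matrix ι ι ℂ} (hE : E * E = E) (c : ℂ) :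
    NormedSpace.exp ((Complex.I * Real.pi) • E + c • (1 : Matrix ι ι ℂ)) =
      Complex.exp c • (1 - (2 : ℂ) • E) := by
  let := NormedAlgebra.restrictScalars ℚ ℂ (Matrix ι ι ℂ)
  have hc : Commute ((Complex.I * Real.pi) • E) (c • (1 : Matrix ι ι ℂ)) :=
    ((Commute.one_right E).smul_left _).smul_right _
  have h1 : (1 : Matrix ι ι ℂ) + (Complex.exp c - 1) • 1 = Complex.exp c • 1 := by module
  rw [NormedSpace.exp_add_of_commute hc, exp_smul_idem hE, exp_smul_idem (one_mul 1), h1,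
    mul_comm Complex.I, Complex.exp_pi_mul_I, mul_smul_comm, mul_one]
  congr 1
  module

end MatrixGroups

/-! ### The parabolic subgroup as the stabilizer of the range of an idempotent -/

section Bracket

variable {ι : Type} [Fintype ι] [DecidableEq ι]

variable {E H : Matrix ι ι ℂ} {c : ℂ}

lemma bracket_flag (hH : H = (Complex.I * Real.pi) • E + c • 1) (X : Matrix ι ι ℂ) :
    ⁅H, X⁆ = (Complex.I * Real.pi) • (E * X - X * E) := by
  rw [hH, Ring.lie_def]
  simp only [add_mul, mul_add, smul_mul_assoc, mul_smul_comm, one_mul, mul_one]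
  module

lemma bracket_eq_iff (hH : H = (Complex.I * Real.pi) • E + c • 1) (X : Matrix ι ι ℂ) (t : ℝ) :
    ⁅H, X⁆ = (Complex.I * t) • X ↔ E * X - X * E = ((t / Real.pi : ℝ) : ℂ) • X := by
  have hpi : (Real.pi : ℂ) ≠ 0 := by exact_mod_cast Real.pi_ne_zero
  have h1 : (Complex.I * t : ℂ) = (Complex.I * Real.pi) * ((t / Real.pi : ℝ) : ℂ) := by
    push_cast
    field_simp
  rw [bracket_flag hH, h1, mul_smul (Complex.I * Real.pi : ℂ) _ X]
  exact smul_right_inj (M := Matrix ι ι ℂ) (mul_ne_zero Complex.I_ne_zero hpi)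

/-- An eigenvector of `ad E` for an eigenvalue other than `-1` preserves the range of `E`. -/
lemma stabRange_of_eigen (hE : E * E = E) {X : Matrix ι ι ℂ} {t : ℝ} (ht : 0 ≤ t)
    (h : E * X - X * E = (t : ℂ) • X) : stabRange E X := by
  have h1 : (1 - E) * (E * X - X * E) * E = -((1 - E) * X * E) := by
    rw [mul_sub, sub_mul, ← mul_assoc (1 - E) E, sub_mul (1 : Matrix ι ι ℂ) E E, hE, one_mul,
      sub_self, zero_mul, zero_mul, zero_sub, mul_assoc, mul_assoc X, hE, ← mul_assoc]
  rw [h, mul_smul_comm, smul_mul_assoc] at h1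
  have h2 : ((1 : ℂ) + t) • ((1 - E) * X * E) = 0 := by
    rw [add_smul, h1, one_smul, add_neg_cancel]
  have h3 : (1 : ℂ) + t ≠ 0 := by
    have : (1 : ℝ) + t ≠ 0 := by positivity
    exact_mod_cast this
  have h4 := (smul_eq_zero.1 h2).resolve_left h3
  rw [sub_mul, sub_mul, one_mul, sub_eq_zero] at h4
  exact h4.symm

lemma isUpper_of_eigen (hE : E * E = E) {X : Matrix ι ι ℂ} {t : ℝ} (ht : 0 < t)
    (h : E * X - X * E = (t : ℂ) • X) : IsUpper E X := by
  have hs := stabRange_of_eigen hE ht.le h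
  have ht' : (t : ℂ) ≠ 0 := by exact_mod_cast ht.ne'
  have h1 : X * E = 0 := by
    have : (t : ℂ) • (X * E) = 0 := by
      rw [← smul_mul_assoc, ← h, sub_mul, mul_assoc X, hE, hs, sub_self]
    exact (smul_eq_zero.1 this).resolve_left ht'
  rw [h1, sub_zero] at h
  have h2 : (t : ℂ) • (E * X) = (t : ℂ) • X := by
    rw [← mul_smul_comm, ← h, ← mul_assoc, hE]
  exact ⟨smul_right_injective _ ht' h2, h1⟩

variable (𝔤 : LieSubalgebra ℂ (Matrix ι ι ℂ))

/-- A complex Lie algebra of matrices as a real vector space. -/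
abbrev realPart : Submodule ℝ (Matrix ι ι ℂ) := 𝔤.toSubmodule.restrictScalars ℝ

variable {𝔤}

lemma mem_nilradical_iff (hE : E * E = E) (hH : H = (Complex.I * Real.pi) • E + c • 1)
    (X : Matrix ι ι ℂ) : X ∈ nilradical 𝔤 H ↔ X ∈ 𝔤 ∧ IsUpper E X := by
  constructor
  · intro hX
    induction hX using Submodule.span_induction with
    | mem X hX =>
      obtain ⟨h1, t, ht, h2⟩ := hX
      exact ⟨h1, isUpper_of_eigen hE (div_pos ht Real.pi_pos) ((bracket_eq_iff hH X t).1 h2)⟩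
    | zero => exact ⟨zero_mem _, mul_zero _, zero_mul _⟩
    | add X Y _ _ hX hY =>
      exact ⟨add_mem hX.1 hY.1, by rw [mul_add, hX.2.left, hY.2.left],
        by rw [add_mul, hX.2.right, hY.2.right, add_zero]⟩
    | smul z X _ hX =>
      exact ⟨𝔤.smul_mem z hX.1, by rw [mul_smul_comm, hX.2.left],
        by rw [smul_mul_assoc, hX.2.right, smul_zero]⟩
  · rintro ⟨h1, h2⟩
    refine Submodule.subset_span ⟨h1, Real.pi, Real.pi_pos, ?_⟩
    rw [bracket_eq_iff hH, h2.left, h2.right, sub_zero, div_self Real.pi_ne_zero,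
      Complex.ofReal_one, one_smul]

/-- The parabolic subalgebra consists of the elements of `𝔤` which preserve the range of `E`. -/
lemma mem_parabolicSubalgebra_iff (hE : E * E = E)
    (hH : H = (Complex.I * Real.pi) • E + c • 1) (hHg : H ∈ 𝔤)
    (X : Matrix ι ι ℂ) : X ∈ parabolicSubalgebra 𝔤 H ↔ X ∈ 𝔤 ∧ stabRange E X := by
  have hpi : (Complex.I * Real.pi : ℂ) ≠ 0 :=
    mul_ne_zero Complex.I_ne_zero (by exact_mod_cast Real.pi_ne_zero)
  constructor
  · intro hX
    induction hX using Submodule.span_induction with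
    | mem X hX =>
      obtain ⟨h1, t, ht, h2⟩ := hX
      exact ⟨h1, stabRange_of_eigen hE (div_nonneg ht Real.pi_pos.le)
        ((bracket_eq_iff hH X t).1 h2)⟩
    | zero => exact ⟨zero_mem _, by simp [stabRange]⟩
    | add X Y _ _ hX hY =>
      exact ⟨add_mem hX.1 hY.1, by
        have h1 := hX.2; have h2 := hY.2
        simp only [stabRange] at h1 h2 ⊢
        rw [mul_add, add_mul, h1, h2, add_mul]⟩
    | smul z X _ hX =>
      exact ⟨𝔤.smul_mem z hX.1, by
        have h1 := hX.2
        simp only [stabRange] at h1 ⊢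
        rw [mul_smul_comm, smul_mul_assoc, h1, smul_mul_assoc]⟩
  · rintro ⟨h1, h2⟩
    -- `X = (X - N) + N` splits `X` into eigenvectors for the eigenvalues `0` and `π`.
    set N := E * X - X * E with hN
    have hNg : N ∈ 𝔤 := by
      have h3 := 𝔤.lie_mem hHg h1
      rw [bracket_flag hH] at h3
      have h4 := 𝔤.smul_mem (Complex.I * Real.pi)⁻¹ h3
      rwa [smul_smul, inv_mul_cancel₀ hpi, one_smul] at h4
    have hNu : IsUpper E N := by
      rw [stabRange] at h2
      refine ⟨?_, ?_⟩
      · rw [hN, mul_sub, ← mul_assoc, hE, ← mul_assoc, h2]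
      · rw [hN, sub_mul, mul_assoc X, hE, h2, sub_self]
    have h5 : N ∈ parabolicSubalgebra 𝔤 H := by
      refine Submodule.subset_span ⟨hNg, Real.pi, Real.pi_pos.le, ?_⟩
      rw [bracket_eq_iff hH, hNu.left, hNu.right, sub_zero, div_self Real.pi_ne_zero,
        Complex.ofReal_one, one_smul]
    have h6 : X - N ∈ parabolicSubalgebra 𝔤 H := by
      refine Submodule.subset_span ⟨sub_mem h1 hNg, 0, le_rfl, ?_⟩
      rw [bracket_eq_iff hH, zero_div, Complex.ofReal_zero, zero_smul, mul_sub, sub_mul, hNu.left,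
        hNu.right, sub_zero, hN]
      abel
    have := add_mem h6 h5
    rwa [sub_add_cancel] at this

end Bracket

section Normalizer

variable {A : Type} [NormedRing A] [NormedAlgebra ℝ A] [CompleteSpace A]
  [FiniteDimensional ℝ A] [StarRing A] [StarModule ℝ A] {𝔤 : Submodule ℝ A} {E : A}
  {tr : A →ₗ[ℝ] ℝ} {G U : Subgroup Aˣ} (D : FlagDatum G U 𝔤 E)

lemma stabRange_conj_iff (u : Aˣ) (X : A) :
    stabRange ((u : A) * E * ((u⁻¹ : Aˣ) : A)) X ↔
      stabRange E (((u⁻¹ : Aˣ) : A) * X * u) := by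
  have h1 : ∀ M N : A, (u : A) * M * ((u⁻¹ : Aˣ) : A) = (u : A) * N * ((u⁻¹ : Aˣ) : A) ↔
      M = N := fun M N => by
    rw [Units.mul_left_inj, Units.mul_right_inj]
  have h2 : (u : A) * (E * (((u⁻¹ : Aˣ) : A) * X * u) * E) * ((u⁻¹ : Aˣ) : A) =
      (u : A) * E * ((u⁻¹ : Aˣ) : A) * X * ((u : A) * E * ((u⁻¹ : Aˣ) : A)) := by
    simp only [mul_assoc]
  have h3 : (u : A) * ((((u⁻¹ : Aˣ) : A) * X * u) * E) * ((u⁻¹ : Aˣ) : A) =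
      X * ((u : A) * E * ((u⁻¹ : Aˣ) : A)) := by
    simp only [mul_assoc, Units.mul_inv_cancel_left]
  rw [stabRange, stabRange, ← h2, ← h3, h1]

lemma comm_of_stabRange_star (hs : star E = E) {X : A} (h : stabRange E X)
    (h' : stabRange E (star X)) : X * E = E * X := by
  have := congrArg star h'
  simp only [star_mul, star_star, hs] at this
  exact h.symm.trans ((mul_assoc _ _ _).trans this)

lemma star_mul_comm {F W : A} (hs : star F = F) (h : W * F = F * W) :
    star W * F = F * star W := by
  have := congrArg star h
  rw [star_mul, star_mul, hs] at this
  exact this.symm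

include D in
/-- If a unitary `u` preserves `𝔭` then `E` and `u E u⁻¹` act in the same way on the upper block:
the orthogonal complement in `𝔭` of the Levi part `𝔭 ∩ 𝔭*` is the same for both. -/
lemma unitary_conj_upper (htr : IsTraceForm tr) {u : Aˣ} (hu : u ∈ U)
    (hAd : ∀ g ∈ G, ∀ X ∈ 𝔤, (g : A) * X * ((g⁻¹ : Aˣ) : A) ∈ 𝔤)
    (hup : ∀ X ∈ 𝔤, stabRange E X → E * X * (1 - E) ∈ 𝔤)
    (h : ∀ X ∈ 𝔤, stabRange E X ↔ stabRange E (((u⁻¹ : Aˣ) : A) * X * u))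
    {X : A} (hX : X ∈ upperBlock 𝔤 E) :
    IsUpper ((u : A) * E * ((u⁻¹ : Aˣ) : A)) X := by
  set Q := (u : A) * E * ((u⁻¹ : Aˣ) : A) with hQ
  have hQQ : Q * Q = Q := by
    calc Q * Q = (u : A) * (E * E) * ((u⁻¹ : Aˣ) : A) := by simp [hQ, mul_assoc]
      _ = Q := by rw [D.idem]
  have hQs : star Q = Q := by
    rw [hQ, star_mul, star_mul, D.star_idem, ← D.unitary u hu, star_star, mul_assoc]
  have hiff : ∀ Y ∈ 𝔤, stabRange E Y ↔ stabRange Q Y := fun Y hY => by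
    rw [h Y hY, hQ, stabRange_conj_iff]
  have huG := D.le hu
  -- split `X` into its part commuting with `Q` and its `Q`-upper part
  have hXp : stabRange E X := by rw [stabRange, mul_assoc, hX.2.right, mul_zero]
  have hX'g : ((u⁻¹ : Aˣ) : A) * X * u ∈ 𝔤 := by
    have := hAd _ (G.inv_mem huG) X hX.1
    rwa [inv_inv] at this
  have hN'g := hup _ hX'g ((h X hX.1).1 hXp)
  set N := Q * X * (1 - Q) with hN
  have hNg : N ∈ 𝔤 := by
    have h1 := hAd _ huG _ hN'g
    have h2 : (u : A) * (E * (((u⁻¹ : Aˣ) : A) * X * u) * (1 - E)) * ((u⁻¹ : Aˣ) : A) = N := by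
      rw [hN, hQ]
      simp only [mul_sub, sub_mul, mul_one, mul_assoc, Units.mul_inv]
    rwa [h2] at h1
  have hNu : IsUpper Q N := isUpper_mul hQQ X
  have hXQ : stabRange Q X := (hiff X hX.1).1 hXp
  set C := X - N with hC
  have hCg : C ∈ 𝔤 := sub_mem hX.1 hNg
  have hCQ : C * Q = Q * C := by
    rw [hC, sub_mul, mul_sub, hNu.right, hNu.left, hN, mul_sub, mul_one, hXQ]
    abel
  have hCQs : star C * Q = Q * star C := star_mul_comm hQs hCQ
  have hCE : C * E = E * C := comm_of_stabRange_star D.star_idem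
    ((hiff C hCg).2 (FlagDatum.stabRange_of_comm hQQ hCQ))
    ((hiff _ (D.star_mem C hCg)).2 (FlagDatum.stabRange_of_comm hQQ hCQs))
  have hCEs : star C * E = E * star C := star_mul_comm D.star_idem hCE
  -- Upper blocks are orthogonal to the centralizer of the idempotent, and `C` commutes with both
  -- idempotents; hence `C = X - N` is orthogonal to itself.
  have horth : ∀ F Y W : A, IsUpper F Y → W * F = F * W → tr (Y * W) = 0 := by
    intro F Y W hY hW
    rw [← hY.left, mul_assoc, htr.comm, mul_assoc, hW, ← mul_assoc, hY.right, zero_mul, map_zero]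
  have h0 : tr (C * star C) = 0 := by
    conv_lhs => enter [2, 1]; rw [hC]
    rw [sub_mul, map_sub, horth E X _ hX.2 hCEs, horth Q N _ hNu hCQs, sub_zero]
  have hXN : X = N := by
    have := htr.definite C h0
    rwa [hC, sub_eq_zero] at this
  rwa [hXN]

include D in
/-- A unitary element which preserves `𝔭` commutes with `E`, when the upper block acts
faithfully. -/
lemma unitary_comm_of_normalizes (htr : IsTraceForm tr) {u : Aˣ} (hu : u ∈ U)
    (hAd : ∀ g ∈ G, ∀ X ∈ 𝔤, (g : A) * X * ((g⁻¹ : Aˣ) : A) ∈ 𝔤)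
    (hup : ∀ X ∈ 𝔤, stabRange E X → E * X * (1 - E) ∈ 𝔤)
    (h : ∀ X ∈ 𝔤, stabRange E X ↔ stabRange E (((u⁻¹ : Aˣ) : A) * X * u))
    (hQ : stabRange E ((u : A) * E * ((u⁻¹ : Aˣ) : A)))
    (hfaith : ∀ a, a * E = E * a → (∀ X ∈ upperBlock 𝔤 E, a * X = 0 ∧ X * a = 0) → a = 0) :
    (u : A) * E = E * (u : A) := by
  set Q := (u : A) * E * ((u⁻¹ : Aˣ) : A) with hQdef
  have hQs : star Q = Q := by
    rw [hQdef, star_mul, star_mul, D.star_idem, ← D.unitary u hu, star_star, mul_assoc]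
  have hQE : Q * E = E * Q := comm_of_stabRange_star D.star_idem hQ (by rwa [hQs])
  have h1 : E - Q = 0 := by
    refine hfaith _ (by rw [sub_mul, mul_sub, hQE]) fun X hX => ?_
    have h2 := unitary_conj_upper D htr hu hAd hup h hX
    rw [sub_mul, mul_sub, hX.2.left, hX.2.right, h2.left, h2.right, sub_self, sub_self]
    exact ⟨rfl, rfl⟩
  rw [sub_eq_zero] at h1
  conv_rhs => rw [h1, hQdef]
  rw [mul_assoc _ ((u⁻¹ : Aˣ) : A), Units.inv_mul, mul_one]

include D in
/-- If the upper block vanishes then the connected group `G` preserves the range of `E`. -/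
lemma stabRange_of_upperBlock_eq_bot (hbot : upperBlock 𝔤 E = ⊥) [IsTopologicalGroup G]
    [ConnectedSpace G] (g : G) : stabRange E ((g : Aˣ) : A) := by
  have hlow : ∀ Y ∈ lowerBlock 𝔤 E, Y = 0 := fun Y hY => by
    have := D.star_mem_upper hY
    rw [hbot, Submodule.mem_bot] at this
    rw [← star_star Y, this, star_zero]
  let S : Subgroup G :=
    { carrier := {g | stabRange E ((g : Aˣ) : A)}
      one_mem' := by simp [stabRange, D.idem]
      mul_mem' := fun {a b} ha hb => ha.mul hb
      inv_mem' := fun {a} ha => ha.inv D.idem }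
  have hmem : (S : Set G) ∈ 𝓝 (1 : G) := by
    refine mem_of_superset ((FlagDatum.isOpen_cell (E := E) G).mem_nhds ?_) fun g hg => ?_
    · simp [pivot, D.idem]
    · have h1 := mul_idem_eq D.idem hg
      rw [hlow _ (D.cellCoord_mem hg), add_zero] at h1
      exact h1.symm
  have hopen := Subgroup.isOpen_of_mem_nhds S hmem
  have huniv := IsClopen.eq_univ ⟨S.isClosed_of_isOpen hopen, hopen⟩ ⟨1, S.one_mem⟩
  have : g ∈ (S : Set G) := by rw [huniv]; trivial
  exact this

end Normalizer

section Bridge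

open scoped Matrix.Norms.L2Operator

variable {ι : Type} [Fintype ι] [DecidableEq ι]

/-- The facts about a matrix group `G` with Lie algebra `𝔤`, its compact form `U`, and the element
`H = i π E + c` which make `U ⧸ K` a symmetric flag manifold and `G ⧸ Z` its cotangent bundle.
The last condition makes the normalizer of `𝔭` equal to the stabilizer of the range of `E`: unless
the upper block vanishes, no nonzero matrix commuting with `E` is annihilated by it on both
sides. -/
structure IsSymmetricDatum (G U K Z : Subgroup (GL ι ℂ)) (𝔤 : LieSubalgebra ℂ (Matrix ι ι ℂ))
    (𝔲 : Submodule ℝ (Matrix ι ι ℂ)) (E H : Matrix ι ι ℂ) : Prop where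
  datum : FlagDatum G U (realPart 𝔤) E
  eq_flag : ∃ c : ℂ, H = (Complex.I * Real.pi) • E + c • 1
  mem_Z : ∀ g, g ∈ Z ↔ g ∈ G ∧ (g : Matrix ι ι ℂ) * E = E * (g : Matrix ι ι ℂ)
  mem_K : ∀ g, g ∈ K ↔ g ∈ U ∧ (g : Matrix ι ι ℂ) * E = E * (g : Matrix ι ι ℂ)
  expG : HasExpLieAlgebra G (realPart 𝔤)
  expU : HasExpLieAlgebra U 𝔲
  le : 𝔲 ≤ realPart 𝔤
  sub_star_mem : ∀ Y ∈ realPart 𝔤, Y - star Y ∈ 𝔲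
  mem_lie : H ∈ 𝔲
  conj_mem : ∀ g ∈ G, ∀ X ∈ 𝔤, (g : Matrix ι ι ℂ) * X * ((g⁻¹ : GL ι ℂ) : Matrix ι ι ℂ) ∈ 𝔤
  compact : CompactSpace U
  connectedU : ConnectedSpace U
  connectedG : ConnectedSpace G
  faithful : upperBlock (realPart 𝔤) E = ⊥ ∨ ∀ a, a * E = E * a →
    (∀ X ∈ upperBlock (realPart 𝔤) E, a * X = 0 ∧ X * a = 0) → a = 0

namespace IsSymmetricDatum

variable {G U K Z : Subgroup (GL ι ℂ)} {𝔤 : LieSubalgebra ℂ (Matrix ι ι ℂ)}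
  {𝔲 : Submodule ℝ (Matrix ι ι ℂ)} {E H : Matrix ι ι ℂ} (S : IsSymmetricDatum G U K Z 𝔤 𝔲 E H)

lemma pi_mul_I_ne_zero : (Complex.I * Real.pi : ℂ) ≠ 0 :=
  mul_ne_zero Complex.I_ne_zero (by exact_mod_cast Real.pi_ne_zero)

include S

lemma comm_iff (M : Matrix ι ι ℂ) : M * H = H * M ↔ M * E = E * M := by
  obtain ⟨c, hc⟩ := S.eq_flag
  rw [hc, mul_add, add_mul, mul_smul_comm, smul_mul_assoc, mul_smul_comm, smul_mul_assoc, mul_one,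
    one_mul, add_left_inj]
  exact smul_right_inj (M := Matrix ι ι ℂ) pi_mul_I_ne_zero

lemma mem_subgroupOf_Z (g : G) : g ∈ Z.subgroupOf G ↔
    ((g : GL ι ℂ) : Matrix ι ι ℂ) * E = E * ((g : GL ι ℂ) : Matrix ι ι ℂ) := by
  rw [Subgroup.mem_subgroupOf, S.mem_Z]
  exact and_iff_right g.2

lemma mem_subgroupOf_K (g : U) : g ∈ K.subgroupOf U ↔
    ((g : GL ι ℂ) : Matrix ι ι ℂ) * E = E * ((g : GL ι ℂ) : Matrix ι ι ℂ) := by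
  rw [Subgroup.mem_subgroupOf, S.mem_K]
  exact and_iff_right g.2

lemma conj_eq (g : GL ι ℂ) :
    ∃ c : ℂ, (g : Matrix ι ι ℂ) * H * ((g⁻¹ : GL ι ℂ) : Matrix ι ι ℂ) =
      (Complex.I * Real.pi) • ((g : Matrix ι ι ℂ) * E * ((g⁻¹ : GL ι ℂ) : Matrix ι ι ℂ)) + c • 1 ∧
      H = (Complex.I * Real.pi) • E + c • 1 := by
  obtain ⟨c, hc⟩ := S.eq_flag
  refine ⟨c, ?_, hc⟩
  rw [hc]
  simp only [mul_add, add_mul, mul_smul_comm, smul_mul_assoc, mul_one, Units.mul_inv]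

/-- The normalizer of `𝔭` consists of the elements which preserve the range of `E`. -/
lemma mem_parabolicSubgroup (g : G) : g ∈ parabolicSubgroup G 𝔤 H ↔
    stabRange E ((g : GL ι ℂ) : Matrix ι ι ℂ) := by
  have D := S.datum
  have := S.compact
  have := S.connectedG
  obtain ⟨c, hc⟩ := S.eq_flag
  have hHg : H ∈ 𝔤 := S.le S.mem_lie
  have hp : ∀ X, X ∈ parabolicSubalgebra 𝔤 H ↔ X ∈ 𝔤 ∧ stabRange E X :=
    mem_parabolicSubalgebra_iff D.idem hc hHg
  have hconj : ∀ h : GL ι ℂ, stabRange E (h : Matrix ι ι ℂ) → ∀ X, stabRange E X →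
      stabRange E ((h : Matrix ι ι ℂ) * X * ((h⁻¹ : GL ι ℂ) : Matrix ι ι ℂ)) :=
    fun h hh X hX => (hh.mul hX).mul (hh.inv D.idem)
  constructor
  · intro hg
    replace hg : ∀ X : Matrix ι ι ℂ, ((g : GL ι ℂ) : Matrix ι ι ℂ) * X *
      (((g : GL ι ℂ)⁻¹ : GL ι ℂ) : Matrix ι ι ℂ) ∈ parabolicSubalgebra 𝔤 H ↔
        X ∈ parabolicSubalgebra 𝔤 H := hg
    rcases S.faithful with hbot | hfaith
    · let := S.expG.chartedSpace
      have := S.expG.lieGroup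
      have hTG := topologicalGroup_of_lieGroup (G := G) (𝓡 (Module.finrank ℝ (realPart 𝔤))) ∞
      exact stabRange_of_upperBlock_eq_bot D hbot g
    · -- write `g = u p` with `u` unitary and `p` preserving the range of `E`
      let P : Subgroup G :=
        { carrier := {g | stabRange E ((g : GL ι ℂ) : Matrix ι ι ℂ)}
          one_mem' := by simp [stabRange, D.idem]
          mul_mem' := fun {a b} ha hb => ha.mul hb
          inv_mem' := fun {a} ha => ha.inv D.idem }
      have hP : ∀ g : G, g ∈ P ↔ stabRange E ((g : GL ι ℂ) : Matrix ι ι ℂ) := fun g => Iff.rfl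
      obtain ⟨x, hx⟩ := D.surjective_flagMap hP S.mem_subgroupOf_K S.expG S.expU
        (fun Y hY => S.sub_star_mem Y hY.1) (QuotientGroup.mk g)
      induction x using QuotientGroup.induction_on with
      | H u =>
      rw [D.flagMap_mk, QuotientGroup.eq, hP] at hx
      set p : GL ι ℂ := (u : GL ι ℂ)⁻¹ * (g : GL ι ℂ) with hpdef
      have hps : stabRange E (p : Matrix ι ι ℂ) := hx
      have hu : (u : GL ι ℂ) = g * p⁻¹ := by rw [hpdef]; group
      clear_value p
      have hnorm : ∀ X ∈ 𝔤, stabRange E X ↔ stabRange E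
          ((((u : GL ι ℂ)⁻¹ : GL ι ℂ) : Matrix ι ι ℂ) * X * ((u : GL ι ℂ) : Matrix ι ι ℂ)) := by
        intro X hX
        have hX' := S.conj_mem _ (G.inv_mem g.2) X hX
        rw [inv_inv] at hX'
        have h1 := hg ((((g : GL ι ℂ)⁻¹ : GL ι ℂ) : Matrix ι ι ℂ) * X *
          ((g : GL ι ℂ) : Matrix ι ι ℂ))
        rw [hp, hp, and_iff_right hX'] at h1
        have h2 : ((g : GL ι ℂ) : Matrix ι ι ℂ) * ((((g : GL ι ℂ)⁻¹ : GL ι ℂ) : Matrix ι ι ℂ) * X *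
          ((g : GL ι ℂ) : Matrix ι ι ℂ)) * (((g : GL ι ℂ)⁻¹ : GL ι ℂ) : Matrix ι ι ℂ) = X := by
          simp only [mul_assoc, Units.mul_inv_cancel_left, Units.mul_inv, mul_one]
        rw [h2, and_iff_right hX] at h1
        rw [h1]
        have h3 : (((u : GL ι ℂ)⁻¹ : GL ι ℂ) : Matrix ι ι ℂ) * X * ((u : GL ι ℂ) : Matrix ι ι ℂ) =
            (p : Matrix ι ι ℂ) * ((((g : GL ι ℂ)⁻¹ : GL ι ℂ) : Matrix ι ι ℂ) * X *
              ((g : GL ι ℂ) : Matrix ι ι ℂ)) * ((p⁻¹ : GL ι ℂ) : Matrix ι ι ℂ) := by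
          rw [hu, mul_inv_rev, inv_inv, Units.val_mul, Units.val_mul]
          simp only [mul_assoc]
        rw [h3]
        refine ⟨fun h => hconj p hps _ h, fun h => ?_⟩
        have h4 := hconj p⁻¹ (hps.inv D.idem) _ h
        rw [inv_inv] at h4
        simpa only [mul_assoc, Units.inv_mul_cancel_left, Units.inv_mul, mul_one] using h4
      have hHp : stabRange E H := ((hp H).1 (by
        rw [hp]
        refine ⟨hHg, FlagDatum.stabRange_of_comm D.idem ?_⟩
        rw [hc]
        simp [add_mul, mul_add])).2
      -- `H` lies in `𝔭`, so `u H u⁻¹` does, and with it `u E u⁻¹`.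
      have hQ : stabRange E (((u : GL ι ℂ) : Matrix ι ι ℂ) * E *
          (((u : GL ι ℂ)⁻¹ : GL ι ℂ) : Matrix ι ι ℂ)) := by
        have h1 := (hnorm _ (S.conj_mem _ (D.le u.2) H hHg)).2 (by
          simpa only [mul_assoc, Units.inv_mul_cancel_left, Units.inv_mul, mul_one] using hHp)
        obtain ⟨c', h2, -⟩ := S.conj_eq (u : GL ι ℂ)
        rw [h2, stabRange] at h1
        simp only [mul_add, add_mul, mul_smul_comm, smul_mul_assoc, mul_one, one_mul, D.idem,
          add_left_inj] at h1
        exact smul_right_injective _ pi_mul_I_ne_zero h1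
      have hup : ∀ X ∈ realPart 𝔤, stabRange E X → E * X * (1 - E) ∈ realPart 𝔤 := by
        intro X hX hs
        have h3 := 𝔤.lie_mem hHg hX
        rw [bracket_flag hc] at h3
        have h4 := 𝔤.smul_mem (Complex.I * Real.pi)⁻¹ h3
        rw [smul_smul, inv_mul_cancel₀ pi_mul_I_ne_zero, one_smul] at h4
        rw [mul_sub, mul_one, hs]
        exact h4
      have hcomm := unitary_comm_of_normalizes D isTraceForm_reTrace u.2
        (fun g hg X hX => S.conj_mem g hg X hX) hup hnorm hQ hfaith
      have hug : ((g : GL ι ℂ) : Matrix ι ι ℂ) = ((u : GL ι ℂ) : Matrix ι ι ℂ) * p := by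
        rw [← Units.val_mul, hpdef, mul_inv_cancel_left]
      rw [hug]
      exact (FlagDatum.stabRange_of_comm D.idem hcomm).mul hps
  · intro hg X
    rw [hp, hp]
    have hgi := hg.inv D.idem
    refine ⟨fun h => ?_, fun h => ⟨S.conj_mem _ g.2 X h.1, hconj _ hg X h.2⟩⟩
    replace h : ((g : GL ι ℂ) : Matrix ι ι ℂ) * X * (((g : GL ι ℂ)⁻¹ : GL ι ℂ) : Matrix ι ι ℂ) ∈ 𝔤 ∧
      stabRange E (((g : GL ι ℂ) : Matrix ι ι ℂ) * X *
        (((g : GL ι ℂ)⁻¹ : GL ι ℂ) : Matrix ι ι ℂ)) := h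
    have h1 := S.conj_mem _ (G.inv_mem g.2) _ h.1
    have h2 := hconj _ hgi _ h.2
    rw [inv_inv] at h1 h2
    have h3 : (((g : GL ι ℂ)⁻¹ : GL ι ℂ) : Matrix ι ι ℂ) * (((g : GL ι ℂ) : Matrix ι ι ℂ) * X *
      (((g : GL ι ℂ)⁻¹ : GL ι ℂ) : Matrix ι ι ℂ)) * ((g : GL ι ℂ) : Matrix ι ι ℂ) = X := by
      simp only [mul_assoc, Units.inv_mul_cancel_left, Units.inv_mul, mul_one]
    rw [h3] at h1 h2
    exact ⟨h1, h2⟩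

/-- The involution of the symmetric space is the conjugation by `exp H`, a multiple of the
reflection `1 - 2 E`. -/
lemma isSymmetricSpace {Γ Δ : Subgroup (GL ι ℂ)} {𝔥 : Submodule ℝ (Matrix ι ι ℂ)}
    (hΓ : HasExpLieAlgebra Γ 𝔥) (hconn : ConnectedSpace Γ)
    (hΔ : ∀ g : Γ, g ∈ Δ.subgroupOf Γ ↔
      ((g : GL ι ℂ) : Matrix ι ι ℂ) * E = E * ((g : GL ι ℂ) : Matrix ι ι ℂ))
    (s : Γ) (hs : ((s : GL ι ℂ) : Matrix ι ι ℂ) = NormedSpace.exp H) :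
    letI := hΓ.chartedSpace
    IsSymmetricSpace (d := Module.finrank ℝ 𝔥) Γ (Δ.subgroupOf Γ) (MulAut.conj s) := by
  let := hΓ.chartedSpace
  have hL := hΓ.lieGroup
  have hTG := topologicalGroup_of_lieGroup (G := Γ) (𝓡 (Module.finrank ℝ 𝔥)) ∞
  have D := S.datum
  obtain ⟨c, hc⟩ := S.eq_flag
  rw [hc, exp_flag D.idem] at hs
  have hfix : ∀ g : Γ, MulAut.conj s g = g ↔ g ∈ Δ.subgroupOf Γ := by
    intro g
    rw [hΔ, MulAut.conj_apply, mul_inv_eq_iff_eq_mul, Subtype.ext_iff, Units.ext_iff,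
      Subgroup.coe_mul, Subgroup.coe_mul, Units.val_mul, Units.val_mul, hs, smul_mul_assoc,
      mul_smul_comm]
    have h1 : ∀ M N : Matrix ι ι ℂ, Complex.exp c • M = Complex.exp c • N ↔ M = N :=
      fun M N => smul_right_inj (Complex.exp_ne_zero c)
    rw [h1, sub_mul, mul_sub, one_mul, mul_one, sub_right_inj, smul_mul_assoc, mul_smul_comm]
    have h2 : ∀ M N : Matrix ι ι ℂ, (2 : ℂ) • M = (2 : ℂ) • N ↔ M = N :=
      fun M N => smul_right_inj two_ne_zero
    rw [h2]
    exact eq_comm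
  refine
    { lieGroup := hL
      connected := hconn
      isClosed := ?_
      contMDiff := ?_
      involutive := ?_
      le_fixed := fun g hg => (hfix g).2 hg
      component_le := fun g hg => by
        have h := connectedComponentIn_subset {g : Γ | MulAut.conj s g = g} 1 hg
        exact (hfix g).1 h }
  · have : ((Δ.subgroupOf Γ : Subgroup Γ) : Set Γ) = {g : Γ |
        ((g : GL ι ℂ) : Matrix ι ι ℂ) * E = E * ((g : GL ι ℂ) : Matrix ι ι ℂ)} :=
      Set.ext fun g => hΔ g
    rw [this]
    exact isClosed_eq (by fun_prop) (by fun_prop)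
  · exact (contMDiff_mul_left (a := s)).mul contMDiff_const
  · have hsq : (((s * s : Γ) : GL ι ℂ) : Matrix ι ι ℂ) = (Complex.exp c * Complex.exp c) • 1 := by
      rw [Subgroup.coe_mul, Units.val_mul, hs, smul_mul_smul_comm]
      congr 1
      simp only [sub_mul, mul_sub, one_mul, mul_one, smul_mul_assoc, mul_smul_comm, D.idem]
      module
    intro g
    have hcomm : s * s * g = g * (s * s) := by
      rw [Subtype.ext_iff, Units.ext_iff, Subgroup.coe_mul _ (s * s) g,
        Subgroup.coe_mul _ g (s * s), Units.val_mul, Units.val_mul, hsq, smul_mul_assoc,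
        mul_smul_comm, one_mul, mul_one]
    calc MulAut.conj s (MulAut.conj s g) = s * s * g * (s * s)⁻¹ := by
          simp only [MulAut.conj_apply]; group
      _ = g := by rw [hcomm, mul_inv_cancel_right]

/-- The nilradical in terms of the upper block. -/
def nilradicalEquiv : nilradical 𝔤 H ≃ₗ[ℝ] upperBlock (realPart 𝔤) E where
  toFun X := ⟨(Complex.I * Real.pi)⁻¹ • X.1, by
    obtain ⟨c, hc⟩ := S.eq_flag
    exact (mem_nilradical_iff S.datum.idem hc _).1 (Submodule.smul_mem _ _ X.2)⟩
  invFun X := ⟨(Complex.I * Real.pi) • X.1, by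
    obtain ⟨c, hc⟩ := S.eq_flag
    exact Submodule.smul_mem _ _ ((mem_nilradical_iff S.datum.idem hc _).2 X.2)⟩
  left_inv X := Subtype.ext (smul_inv_smul₀ pi_mul_I_ne_zero _)
  right_inv X := Subtype.ext (inv_smul_smul₀ pi_mul_I_ne_zero _)
  map_add' X Y := Subtype.ext (smul_add _ _ _)
  map_smul' r X := Subtype.ext (smul_comm _ r X.1)

/-- The three assertions about flag manifold, symmetric spaces and cotangent bundle follow from the
properties of a symmetric datum. -/
theorem isSymmetricFlag : IsSymmetricFlagWithSymmetricCotangent G U K Z 𝔤 H := by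
  have D := S.datum
  have := S.compact
  have := S.connectedG
  let iG := S.expG.chartedSpace
  let iU := S.expU.chartedSpace
  obtain ⟨iK, iP, iZ, mK, hK, hP, hZ, φ, hφ, j, hj1, hj2, L, hL⟩ :=
    D.exists_cotangentRealization S.expG S.expU (fun Y hY => S.sub_star_mem Y hY.1)
      S.mem_parabolicSubgroup S.mem_subgroupOf_K S.mem_subgroupOf_Z isTraceForm_reTrace
  have hsU := S.expU.exp_mem H S.mem_lie
  refine ⟨D.le, fun g hg => ((S.mem_K g).1 hg).1, fun g hg => ((S.mem_Z g).1 hg).1,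
    fun g hg => ?_, Module.finrank ℝ (realPart 𝔤), Module.finrank ℝ 𝔲, _, _, iG, iU, iK, iP, iZ,
    mK, S.expG.isLinearLieGroup, S.expU.isLinearLieGroup, hK, hP, hZ,
    ⟨⟨expUnit H, hsU⟩, rfl,
      S.isSymmetricSpace S.expU S.connectedU S.mem_subgroupOf_K _ rfl,
      S.isSymmetricSpace S.expG S.connectedG S.mem_subgroupOf_Z _ rfl⟩, φ, hφ, j, hj1, hj2, ?_⟩
  · rw [S.mem_Z, S.comm_iff, and_iff_right hg]
  · refine ⟨S.nilradicalEquiv.trans L, fun X => ?_⟩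
    obtain ⟨g, hg1, hg2⟩ := hL (S.nilradicalEquiv X)
    refine ⟨g, ?_, hg2⟩
    obtain ⟨c, h1, h2⟩ := S.conj_eq (g : GL ι ℂ)
    rw [h1, hg1]
    refine Eq.trans ?_ (congrArg (fun M => M + (X : Matrix ι ι ℂ)) h2.symm)
    have h3 : (Complex.I * Real.pi) • ((S.nilradicalEquiv X : upperBlock (realPart 𝔤) E) :
        Matrix ι ι ℂ) = X := smul_inv_smul₀ pi_mul_I_ne_zero _
    rw [smul_add, h3]
    abel

end IsSymmetricDatum

end Bridge

/-! ### The determinant of an exponential -/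

section DetExp

open scoped Matrix.Norms.L2Operator

variable {ι : Type} [Fintype ι] [DecidableEq ι]

lemma differentiable_det : Differentiable ℂ (fun M : Matrix ι ι ℂ => M.det) := by
  have h : ∀ i j, Differentiable ℂ (fun M : Matrix ι ι ℂ => M i j) := fun i j =>
    (LinearMap.toContinuousLinearMap (Matrix.entryLinearMap ℂ ℂ i j)).differentiable
  simp only [Matrix.det_apply']
  refine Differentiable.fun_sum fun σ _ => Differentiable.const_mul ?_ _
  refine fun M => (HasFDerivAt.finsetProd (u := Finset.univ)
    (g := fun i (M : Matrix ι ι ℂ) => M (σ i) i) fun i _ => (h _ _ M).hasFDerivAt).differentiableAt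

lemma fderiv_det_one (M : Matrix ι ι ℂ) :
    fderiv ℂ (fun M : Matrix ι ι ℂ => M.det) 1 M = M.trace := by
  have h1 : HasDerivAt (fun r : ℂ => (1 + r • M).det) M.trace 0 := by
    rw [funext fun r : ℂ => Matrix.det_one_add_smul r M]
    have h2 := ((hasDerivAt_id (0 : ℂ)).const_mul M.trace).const_add 1
    have h3 := ((Polynomial.hasDerivAt
      (((Matrix.det (1 + (Polynomial.X : Polynomial ℂ) • M.map Polynomial.C)).divX.divX)) 0).fun_mul
        ((hasDerivAt_id' (0 : ℂ)).fun_pow 2))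
    simpa using h2.fun_add h3
  have h4 : HasDerivAt (fun r : ℂ => 1 + r • M) M 0 := by
    simpa using ((hasDerivAt_id (0 : ℂ)).smul_const M).const_add 1
  have h5 : HasFDerivAt (fun M : Matrix ι ι ℂ => M.det)
      (fderiv ℂ (fun M : Matrix ι ι ℂ => M.det) 1) (1 + (0 : ℂ) • M) := by
    rw [zero_smul, add_zero]
    exact (differentiable_det 1).hasFDerivAt
  exact (h5.comp_hasDerivAt (0 : ℂ) h4).unique h1

lemma det_exp (X : Matrix ι ι ℂ) : (NormedSpace.exp X).det = Complex.exp X.trace := by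
  let := NormedAlgebra.restrictScalars ℚ ℂ (Matrix ι ι ℂ)
  set f : ℂ → ℂ := fun t => (NormedSpace.exp (t • X)).det with hf
  -- `f t = det (exp (t X))` is a homomorphism with derivative `tr X` at `0`.
  have hadd : ∀ s t, f (s + t) = f s * f t := fun s t => by
    rw [hf]
    simp only [add_smul]
    rw [NormedSpace.exp_add_of_commute (((Commute.refl X).smul_left s).smul_right t),
      Matrix.det_mul]
  have h0 : HasDerivAt f X.trace 0 := by
    have h1 : HasDerivAt (fun t : ℂ => NormedSpace.exp (t • X)) X 0 := by
      simpa using hasDerivAt_exp_smul_const (𝕂 := ℂ) X (0 : ℂ)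
    have h2 : HasFDerivAt (fun M : Matrix ι ι ℂ => M.det)
        (fderiv ℂ (fun M : Matrix ι ι ℂ => M.det) 1) (NormedSpace.exp ((0 : ℂ) • X)) := by
      rw [zero_smul, NormedSpace.exp_zero]
      exact (differentiable_det 1).hasFDerivAt
    have h3 := h2.comp_hasDerivAt (0 : ℂ) h1
    rwa [fderiv_det_one] at h3
  have hd : ∀ t, HasDerivAt f (f t * X.trace) t := fun t => by
    have h1 : HasDerivAt (fun s => f t * f (s - t)) (f t * X.trace) t := by
      have h2 : HasDerivAt (fun s : ℂ => f (s - t)) X.trace t := by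
        have h3 : HasDerivAt f X.trace (t - t) := by rwa [sub_self]
        exact h3.comp_sub_const t t
      exact h2.const_mul _
    refine h1.congr_of_eventuallyEq (Eventually.of_forall fun s => ?_)
    change f s = f t * f (s - t)
    rw [← hadd, add_sub_cancel]
  have hg : ∀ t, HasDerivAt (fun t => f t * Complex.exp (-(t * X.trace))) 0 t := fun t => by
    have h1 : HasDerivAt (fun t : ℂ => Complex.exp (-(t * X.trace)))
        (Complex.exp (-(t * X.trace)) * -X.trace) t :=
      (by simpa using ((hasDerivAt_id t).mul_const X.trace).fun_neg : HasDerivAt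
        (fun t : ℂ => -(t * X.trace)) (-X.trace) t).cexp
    refine ((hd t).mul h1).congr_deriv ?_
    ring
  have hc := is_const_of_deriv_eq_zero (fun t => (hg t).differentiableAt)
    (fun t => (hg t).deriv) 1 0
  simp only [hf, one_smul, zero_smul, NormedSpace.exp_zero, Matrix.det_one, one_mul, zero_mul,
    neg_zero, Complex.exp_zero] at hc
  rw [Complex.exp_neg, ← div_eq_mul_inv, div_eq_one_iff_eq (Complex.exp_ne_zero _)] at hc
  exact hc

end DetExp

/-! ### Self-adjoint matrix groups -/

section SelfAdjoint

open scoped Matrix.Norms.L2Operator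

variable {ι : Type} [Fintype ι] [DecidableEq ι]

/-- A closed matrix group `G` with Lie algebra `𝔥`, both stable under the adjoint. The last
condition says that the logarithm of a positive definite element of `G` lies in `𝔥`. -/
structure IsSelfAdjointGroup (G : Subgroup (GL ι ℂ)) (𝔥 : Submodule ℝ (Matrix ι ι ℂ)) : Prop where
  isClosed : IsClosed (G : Set (GL ι ℂ))
  expLie : HasExpLieAlgebra G 𝔥
  star_mem_group : ∀ g ∈ G, star g ∈ G
  star_mem : ∀ X ∈ 𝔥, star X ∈ 𝔥
  conj_mem : ∀ g ∈ G, ∀ X ∈ 𝔥, (g : Matrix ι ι ℂ) * X * ((g⁻¹ : GL ι ℂ) : Matrix ι ι ℂ) ∈ 𝔥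
  mem_of_isSelfAdjoint : ∀ X, IsSelfAdjoint X → expUnit X ∈ G → X ∈ 𝔥

lemma IsSelfAdjointGroup.inf {G G' : Subgroup (GL ι ℂ)} {𝔥 𝔥' : Submodule ℝ (Matrix ι ι ℂ)}
    (h : IsSelfAdjointGroup G 𝔥) (h' : IsSelfAdjointGroup G' 𝔥') :
    IsSelfAdjointGroup (G ⊓ G') (𝔥 ⊓ 𝔥') where
  isClosed := h.isClosed.inter h'.isClosed
  expLie := h.expLie.inf h'.expLie
  star_mem_group g hg := ⟨h.star_mem_group g hg.1, h'.star_mem_group g hg.2⟩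
  star_mem X hX := ⟨h.star_mem X hX.1, h'.star_mem X hX.2⟩
  conj_mem g hg X hX := ⟨h.conj_mem g hg.1 X hX.1, h'.conj_mem g hg.2 X hX.2⟩
  mem_of_isSelfAdjoint X hX hm :=
    ⟨h.mem_of_isSelfAdjoint X hX hm.1, h'.mem_of_isSelfAdjoint X hX hm.2⟩

/-- The real space of matrices of trace zero. -/
def traceless (ι : Type) [Fintype ι] [DecidableEq ι] : Submodule ℝ (Matrix ι ι ℂ) :=
  (LinearMap.ker (Matrix.traceLinearMap ι ℂ ℂ)).restrictScalars ℝ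

lemma mem_traceless {X : Matrix ι ι ℂ} : X ∈ traceless ι ↔ X.trace = 0 := Iff.rfl

lemma mem_SL {g : GL ι ℂ} : g ∈ SL ι ↔ (g : Matrix ι ι ℂ).det = 1 := by
  rw [SL, MonoidHom.mem_ker, Units.ext_iff]
  rfl

lemma continuous_val_GL : Continuous (fun g : GL ι ℂ => (g : Matrix ι ι ℂ)) := Units.continuous_val

lemma isSelfAdjointGroup_SL : IsSelfAdjointGroup (SL ι) (traceless ι) where
  isClosed := by
    have : (SL ι : Set (GL ι ℂ)) = {g : GL ι ℂ | (g : Matrix ι ι ℂ).det = 1} :=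
      Set.ext fun g => mem_SL
    rw [this]
    exact isClosed_eq continuous_val_GL.matrix_det continuous_const
  expLie :=
    { exp_mem := fun X hX => by
        rw [mem_SL, val_expUnit, det_exp, mem_traceless.1 hX, Complex.exp_zero]
      mem_of_exp := by
        have h1 : ContinuousAt (fun X : Matrix ι ι ℂ => X.trace) 0 :=
          (continuous_id.matrix_trace).continuousAt
        have h2 := exp_eventually_inj (A := ℂ) (σ := id) (τ := fun _ => 0) continuousAt_id
          continuousAt_const rfl rfl
        rw [← Matrix.trace_zero (R := ℂ) (n := ι)] at h2
        filter_upwards [h1.eventually h2] with X hX hm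
        rw [mem_SL, val_expUnit, det_exp, Complex.exp_eq_exp_ℂ] at hm
        exact mem_traceless.2 ((hX (by simpa using hm)).trans (Matrix.trace_zero ι ℂ)) }
  star_mem_group g hg := by
    rw [mem_SL] at hg ⊢
    change (star (g : Matrix ι ι ℂ)).det = 1
    rw [Matrix.star_eq_conjTranspose, Matrix.det_conjTranspose, hg, star_one]
  star_mem X hX := by
    rw [mem_traceless] at hX ⊢
    rw [Matrix.star_eq_conjTranspose, Matrix.trace_conjTranspose, hX, star_zero]
  conj_mem g _ X hX := by
    rw [mem_traceless] at hX ⊢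
    rw [Matrix.trace_mul_comm, ← mul_assoc, Units.inv_mul, one_mul, hX]
  mem_of_isSelfAdjoint X hX hm := by
    rw [mem_SL, val_expUnit, det_exp, Complex.exp_eq_one_iff] at hm
    obtain ⟨n, hn⟩ := hm
    -- The trace is real and a multiple of `2 π i`, hence zero.
    have h1 : star X.trace = X.trace := by
      rw [← Matrix.trace_conjTranspose, ← Matrix.star_eq_conjTranspose, hX.star_eq]
    have h2 : X.trace.im = 0 := Complex.conj_eq_iff_im.1 h1
    rw [hn] at h2
    have h3 : (n : ℝ) * (2 * Real.pi) = 0 := by simpa using h2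
    have h4 : (n : ℝ) = 0 := by
      rcases mul_eq_zero.1 h3 with h | h
      · exact h
      · exact absurd h Real.two_pi_pos.ne'
    rw [mem_traceless, hn, Int.cast_eq_zero.1 h4]
    simp

variable (ι) in
/-- The real space of skew-adjoint matrices. -/
def skewHermitian : Submodule ℝ (Matrix ι ι ℂ) where
  carrier := {X | star X = -X}
  add_mem' := fun {a b} ha hb => by
    have ha' : star a = -a := ha
    have hb' : star b = -b := hb
    change star (a + b) = -(a + b)
    rw [star_add, ha', hb', neg_add]
  zero_mem' := by change star (0 : Matrix ι ι ℂ) = -0; rw [star_zero, neg_zero]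
  smul_mem' := fun c a ha => by
    have ha' : star a = -a := ha
    change star (c • a) = -(c • a)
    rw [star_smul, ha', star_trivial, smul_neg]

lemma mem_skewHermitian {X : Matrix ι ι ℂ} : X ∈ skewHermitian ι ↔ star X = -X := Iff.rfl

lemma mem_U {g : GL ι ℂ} : g ∈ U ι ↔ star (g : Matrix ι ι ℂ) = ((g⁻¹ : GL ι ℂ) : Matrix ι ι ℂ) := by
  rw [U, Submonoid.mem_units_iff]
  constructor
  · rintro ⟨h1, -⟩
    calc star (g : Matrix ι ι ℂ) = star (g : Matrix ι ι ℂ) * (g * (g⁻¹ : GL ι ℂ)) := by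
          rw [Units.mul_inv, mul_one]
      _ = _ := by rw [← mul_assoc, (Unitary.mem_iff.1 h1).1, one_mul]
  · intro h
    have h' : star ((g⁻¹ : GL ι ℂ) : Matrix ι ι ℂ) = g := by rw [← h, star_star]
    exact ⟨Unitary.mem_iff.2 (by rw [h, Units.inv_mul, Units.mul_inv]; exact ⟨rfl, rfl⟩),
      Unitary.mem_iff.2 (by rw [h', Units.inv_mul, Units.mul_inv]; exact ⟨rfl, rfl⟩)⟩

lemma hasExpLieAlgebra_U : HasExpLieAlgebra (U ι) (skewHermitian ι) where
  exp_mem X hX := by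
    let := NormedAlgebra.restrictScalars ℚ ℂ (Matrix ι ι ℂ)
    rw [mem_U, val_expUnit, NormedSpace.star_exp, mem_skewHermitian.1 hX]
    rfl
  mem_of_exp := by
    filter_upwards [exp_eventually_inj (A := Matrix ι ι ℂ) (σ := star) (τ := fun X => -X)
      continuous_star.continuousAt continuous_neg.continuousAt (star_zero _) neg_zero] with X hX hm
    let := NormedAlgebra.restrictScalars ℚ ℂ (Matrix ι ι ℂ)
    rw [mem_U, val_expUnit, NormedSpace.star_exp] at hm
    exact mem_skewHermitian.2 (hX hm)

/-- The anti-automorphism `X ↦ Bᵀ Xᵀ B` of the algebra of matrices. For orthogonal `B` it maps a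
matrix to its adjoint for the bilinear form `B`. -/
def bilinAdjoint (B : Matrix ι ι ℂ) : Matrix ι ι ℂ →ₗ[ℂ] Matrix ι ι ℂ where
  toFun X := B.transpose * X.transpose * B
  map_add' X Y := by rw [Matrix.transpose_add, mul_add, add_mul]
  map_smul' c X := by
    rw [Matrix.transpose_smul, mul_smul_comm, smul_mul_assoc, RingHom.id_apply]

/-- A real orthogonal matrix, seen as a complex matrix. -/
structure IsFormMatrix (B : Matrix ι ι ℂ) : Prop where
  orthogonal : B * B.transpose = 1
  real : star B = B.transpose

namespace IsFormMatrix

variable {B : Matrix ι ι ℂ} (hB : IsFormMatrix B)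
include hB

lemma orthogonal' : B.transpose * B = 1 := mul_eq_one_comm.1 hB.orthogonal

lemma adjoint_one : bilinAdjoint B 1 = 1 := by
  change B.transpose * Matrix.transpose 1 * B = 1
  rw [Matrix.transpose_one, mul_one, hB.orthogonal']

lemma adjoint_mul (X Y : Matrix ι ι ℂ) :
    bilinAdjoint B (X * Y) = bilinAdjoint B Y * bilinAdjoint B X := by
  change B.transpose * (X * Y).transpose * B =
    B.transpose * Y.transpose * B * (B.transpose * X.transpose * B)
  rw [Matrix.transpose_mul]
  simp only [mul_assoc]
  rw [← mul_assoc B, hB.orthogonal, one_mul]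

lemma adjoint_star (X : Matrix ι ι ℂ) : bilinAdjoint B (star X) = star (bilinAdjoint B X) := by
  have h : star B.transpose = B := by rw [← hB.real, star_star]
  change B.transpose * (star X).transpose * B = star (B.transpose * X.transpose * B)
  rw [star_mul, star_mul, h, hB.real, mul_assoc]
  rfl

lemma adjoint_exp (X : Matrix ι ι ℂ) :
    bilinAdjoint B (NormedSpace.exp X) = NormedSpace.exp (bilinAdjoint B X) := by
  have h := Matrix.exp_conj' B X.transpose (IsUnit.of_mul_eq_one _ hB.orthogonal)
  rw [Matrix.inv_eq_right_inv hB.orthogonal, Matrix.exp_transpose] at h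
  exact h.symm

lemma trace_adjoint (X : Matrix ι ι ℂ) : (bilinAdjoint B X).trace = X.trace := by
  change (B.transpose * X.transpose * B).trace = _
  rw [Matrix.trace_mul_comm, ← mul_assoc, hB.orthogonal, one_mul, Matrix.trace_transpose]

lemma continuous_adjoint : Continuous (bilinAdjoint B) :=
  LinearMap.continuous_of_finiteDimensional _

/-- The group of isometries of the bilinear form `B`. -/
def isometryGroup : Subgroup (GL ι ℂ) where
  carrier := {g | bilinAdjoint B g * g = 1}
  mul_mem' := fun {a b} ha hb => by
    have ha' : bilinAdjoint B a * a = 1 := ha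
    have hb' : bilinAdjoint B b * b = 1 := hb
    change bilinAdjoint B (a * b : Matrix ι ι ℂ) * (a * b) = 1
    rw [hB.adjoint_mul, mul_assoc, ← mul_assoc _ (a : Matrix ι ι ℂ), ha', one_mul, hb']
  one_mem' := by
    change bilinAdjoint B ((1 : GL ι ℂ) : Matrix ι ι ℂ) * ((1 : GL ι ℂ) : Matrix ι ι ℂ) = 1
    rw [Units.val_one, hB.adjoint_one, mul_one]
  inv_mem' := fun {a} ha => by
    have ha' : (a : Matrix ι ι ℂ) * bilinAdjoint B a = 1 := mul_eq_one_comm.1 ha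
    change bilinAdjoint B ((a⁻¹ : GL ι ℂ) : Matrix ι ι ℂ) * ((a⁻¹ : GL ι ℂ) : Matrix ι ι ℂ) = 1
    have h : ((a⁻¹ : GL ι ℂ) : Matrix ι ι ℂ) = bilinAdjoint B a := by
      rw [Units.inv_eq_of_mul_eq_one_right ha']
    rw [h, ← hB.adjoint_mul, ha', hB.adjoint_one]

lemma mem_isometryGroup {g : GL ι ℂ} :
    g ∈ hB.isometryGroup ↔ bilinAdjoint B (g : Matrix ι ι ℂ) = ((g⁻¹ : GL ι ℂ) : Matrix ι ι ℂ) :=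
  ⟨fun h => (Units.inv_eq_of_mul_eq_one_left h).symm, fun h => by
    change bilinAdjoint B (g : Matrix ι ι ℂ) * g = 1
    rw [h, Units.inv_mul]⟩

end IsFormMatrix

/-- The real space of matrices which are skew-adjoint for the bilinear form `B`. -/
def bilinSkew (B : Matrix ι ι ℂ) : Submodule ℝ (Matrix ι ι ℂ) :=
  (LinearMap.ker (bilinAdjoint B + LinearMap.id)).restrictScalars ℝ

lemma mem_bilinSkew {B X : Matrix ι ι ℂ} : X ∈ bilinSkew B ↔ bilinAdjoint B X = -X :=
  eq_neg_iff_add_eq_zero.symm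

/-- The exponential is injective on self-adjoint matrices. -/
lemma IsSelfAdjoint.exp_inj {X Y : Matrix ι ι ℂ} (hX : IsSelfAdjoint X) (hY : IsSelfAdjoint Y)
    (h : NormedSpace.exp X = NormedSpace.exp Y) : X = Y := by
  rw [← CFC.log_exp X hX, h, CFC.log_exp Y hY]

lemma isSelfAdjointGroup_isometryGroup {B : Matrix ι ι ℂ} (hB : IsFormMatrix B) :
    IsSelfAdjointGroup hB.isometryGroup (bilinSkew B) where
  isClosed := isClosed_eq ((hB.continuous_adjoint.comp continuous_val_GL).mul continuous_val_GL)
    continuous_const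
  expLie :=
    { exp_mem := fun X hX => by
        rw [hB.mem_isometryGroup, val_expUnit, hB.adjoint_exp, mem_bilinSkew.1 hX]
        rfl
      mem_of_exp := by
        filter_upwards [exp_eventually_inj (A := Matrix ι ι ℂ) (σ := bilinAdjoint B)
          (τ := fun X => -X) hB.continuous_adjoint.continuousAt continuous_neg.continuousAt
          (map_zero _) neg_zero] with X hX hm
        rw [hB.mem_isometryGroup, val_expUnit, hB.adjoint_exp] at hm
        exact mem_bilinSkew.2 (hX hm) }
  star_mem_group g hg := by
    have h1 : (g : Matrix ι ι ℂ) * bilinAdjoint B g = 1 := mul_eq_one_comm.1 hg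
    change bilinAdjoint B (star (g : Matrix ι ι ℂ)) * star (g : Matrix ι ι ℂ) = 1
    rw [hB.adjoint_star, ← star_mul, h1, star_one]
  star_mem X hX := by
    rw [mem_bilinSkew] at hX ⊢
    rw [hB.adjoint_star, hX, star_neg]
  conj_mem g hg X hX := by
    have h1 := hB.mem_isometryGroup.1 hg
    have h2 := hB.mem_isometryGroup.1 (inv_mem hg)
    rw [inv_inv] at h2
    rw [mem_bilinSkew] at hX ⊢
    rw [hB.adjoint_mul, hB.adjoint_mul, h1, h2, hX, neg_mul, mul_neg, mul_assoc]
  mem_of_isSelfAdjoint X hX hm := by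
    rw [hB.mem_isometryGroup, val_expUnit, hB.adjoint_exp] at hm
    refine mem_bilinSkew.2 (IsSelfAdjoint.exp_inj ?_ hX.neg hm)
    rw [IsSelfAdjoint, ← hB.adjoint_star, hX.star_eq]

end SelfAdjoint

/-! ### Polar decomposition and connectedness -/

section Polar

open scoped Matrix.Norms.L2Operator MatrixOrder Pointwise

variable {ι : Type} [Fintype ι] [DecidableEq ι]

lemma isCompact_U : IsCompact (U ι : Set (GL ι ℂ)) := by
  have hp : ProperSpace (Matrix ι ι ℂ) := FiniteDimensional.proper ℂ _
  have h1 : IsCompact (Matrix.unitaryGroup ι ℂ : Set (Matrix ι ι ℂ)) := by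
    refine Metric.isCompact_of_isClosed_isBounded ?_ ?_
    · have : (Matrix.unitaryGroup ι ℂ : Set (Matrix ι ι ℂ)) =
          {M | star M * M = 1 ∧ M * star M = 1} :=
        Set.ext fun M => Unitary.mem_iff
      rw [this]
      exact (isClosed_eq (continuous_star.mul continuous_id) continuous_const).inter
        (isClosed_eq (continuous_id.mul continuous_star) continuous_const)
    · rw [isBounded_iff_forall_norm_le]
      refine ⟨1, fun M hM => ?_⟩
      rcases isEmpty_or_nonempty ι with h | h
      · rw [Subsingleton.elim M 0, norm_zero]; exact zero_le_one
      · exact (CStarRing.norm_of_mem_unitary hM).le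
  have : CompactSpace (Matrix.unitaryGroup ι ℂ) := isCompact_iff_compactSpace.1 h1
  have h2 : Continuous (Unitary.toUnits : Matrix.unitaryGroup ι ℂ → GL ι ℂ) :=
    Units.continuous_iff.2 ⟨continuous_subtype_val, continuous_star.comp continuous_subtype_val⟩
  have h3 : (U ι : Set (GL ι ℂ)) = range (Unitary.toUnits : Matrix.unitaryGroup ι ℂ → GL ι ℂ) := by
    ext g
    constructor
    · intro hg
      exact ⟨⟨g, hg.1⟩, Units.ext rfl⟩
    · rintro ⟨u, rfl⟩
      exact ⟨u.2, (u⁻¹).2⟩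
  rw [h3]
  exact isCompact_range h2

lemma mem_U' {g : GL ι ℂ} : g ∈ U ι ↔ star g = g⁻¹ := by
  rw [mem_U, Units.ext_iff]; rfl

lemma star_expUnit {X : Matrix ι ι ℂ} (hX : IsSelfAdjoint X) : star (expUnit X) = expUnit X := by
  let := NormedAlgebra.restrictScalars ℚ ℂ (Matrix ι ι ℂ)
  refine Units.ext ?_
  change star (NormedSpace.exp X) = NormedSpace.exp X
  rw [NormedSpace.star_exp, hX.star_eq]

lemma expUnit_half_mul_self (X : Matrix ι ι ℂ) :
    expUnit ((2⁻¹ : ℝ) • X) * expUnit ((2⁻¹ : ℝ) • X) = expUnit X := by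
  let := NormedAlgebra.restrictScalars ℚ ℂ (Matrix ι ι ℂ)
  refine Units.ext ?_
  change NormedSpace.exp _ * NormedSpace.exp _ = NormedSpace.exp X
  rw [← NormedSpace.exp_add_of_commute (Commute.refl _), ← add_smul]
  norm_num

lemma exists_log_of_nonneg {g : GL ι ℂ} (hg : 0 ≤ (g : Matrix ι ι ℂ)) :
    ∃ X : Matrix ι ι ℂ, IsSelfAdjoint X ∧ expUnit X = g := by
  have hp : IsStrictlyPositive (g : Matrix ι ι ℂ) := ⟨hg, g.isUnit⟩
  exact ⟨CFC.log (g : Matrix ι ι ℂ), IsSelfAdjoint.log, Units.ext (CFC.exp_log _ hp)⟩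

lemma isClosed_nonneg_GL : IsClosed {g : GL ι ℂ | 0 ≤ (g : Matrix ι ι ℂ)} :=
  isClosed_le continuous_const continuous_val_GL

variable {G : Subgroup (GL ι ℂ)} {𝔥 : Submodule ℝ (Matrix ι ι ℂ)}

lemma IsSelfAdjointGroup.exists_polar (h : IsSelfAdjointGroup G 𝔥) {g : GL ι ℂ} (hg : g ∈ G) :
    ∃ u ∈ G ⊓ U ι, ∃ X ∈ 𝔥, IsSelfAdjoint X ∧ g = u * expUnit X := by
  -- `exp X` is the positive square root of `g* g`.
  obtain ⟨L, hL, hexp⟩ := exists_log_of_nonneg (g := star g * g)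
    (star_mul_self_nonneg (g : Matrix ι ι ℂ))
  have hLm : L ∈ 𝔥 := h.mem_of_isSelfAdjoint L hL
    (by rw [hexp]; exact mul_mem (h.star_mem_group g hg) hg)
  have hX : IsSelfAdjoint ((2⁻¹ : ℝ) • L) := (IsSelfAdjoint.all (2⁻¹ : ℝ)).smul hL
  have hXm : (2⁻¹ : ℝ) • L ∈ 𝔥 := 𝔥.smul_mem _ hLm
  set x := expUnit ((2⁻¹ : ℝ) • L) with hx
  have hxx : x * x = star g * g := by rw [hx, expUnit_half_mul_self, hexp]
  refine ⟨g * x⁻¹, Subgroup.mem_inf.2 ⟨mul_mem hg (inv_mem (h.expLie.exp_mem _ hXm)), ?_⟩, _, hXm,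
    hX, by rw [inv_mul_cancel_right]⟩
  have hsx : star x = x := star_expUnit hX
  rw [mem_U', star_mul, star_inv, hsx, eq_inv_iff_mul_eq_one, mul_assoc,
    ← mul_assoc (star g), ← hxx]
  group

lemma polar_unique {u u' : GL ι ℂ} (hu : u ∈ U ι) (hu' : u' ∈ U ι) {X X' : Matrix ι ι ℂ}
    (hX : IsSelfAdjoint X) (hX' : IsSelfAdjoint X') (h : u * expUnit X = u' * expUnit X') :
    u = u' := by
  have key : ∀ {v : GL ι ℂ} {Y : Matrix ι ι ℂ}, v ∈ U ι → IsSelfAdjoint Y →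
      star (v * expUnit Y) * (v * expUnit Y) = expUnit ((2 : ℝ) • Y) := by
    intro v Y hv hY
    have h2 := expUnit_half_mul_self ((2 : ℝ) • Y)
    rw [inv_smul_smul₀ two_ne_zero] at h2
    rw [star_mul, star_expUnit hY, mem_U'.1 hv, mul_assoc, inv_mul_cancel_left, h2]
  have h1 : expUnit ((2 : ℝ) • X) = expUnit ((2 : ℝ) • X') := by
    rw [← key hu hX, h, key hu' hX']
  have h2 := IsSelfAdjoint.exp_inj ((IsSelfAdjoint.all (2 : ℝ)).smul hX)
    ((IsSelfAdjoint.all (2 : ℝ)).smul hX') (congrArg Units.val h1)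
  have h3 : X = X' := smul_right_injective _ (two_ne_zero (α := ℝ)) h2
  rw [h3] at h
  exact mul_right_cancel h

lemma IsSelfAdjointGroup.isCompact (h : IsSelfAdjointGroup G 𝔥) :
    IsCompact ((G ⊓ U ι : Subgroup (GL ι ℂ)) : Set (GL ι ℂ)) :=
  isCompact_U.inter_left h.isClosed

/-- If `G` is connected then so is its unitary part: otherwise the polar decomposition would
give a partition of `G` into two closed sets. -/
lemma IsSelfAdjointGroup.isConnected_unitary (h : IsSelfAdjointGroup G 𝔥)
    (hG : IsConnected (G : Set (GL ι ℂ))) :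
    IsConnected ((G ⊓ U ι : Subgroup (GL ι ℂ)) : Set (GL ι ℂ)) := by
  refine ⟨⟨1, one_mem _⟩, isPreconnected_closed_iff.2 fun t t' ht ht' hst hne hne' => ?_⟩
  set S : Set (GL ι ℂ) := ((G ⊓ U ι : Subgroup (GL ι ℂ)) : Set (GL ι ℂ))
  set Q : Set (GL ι ℂ) := (G : Set (GL ι ℂ)) ∩ {g | 0 ≤ (g : Matrix ι ι ℂ)}
  have hQ : IsClosed Q := h.isClosed.inter isClosed_nonneg_GL
  have hmem : ∀ X, IsSelfAdjoint X → expUnit X ∈ G → expUnit X ∈ Q := fun X hX hm =>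
    ⟨hm, hX.exp_nonneg⟩
  have hcl : ∀ r : Set (GL ι ℂ), IsClosed r → IsClosed ((S ∩ r) * Q) := fun r hr =>
    hQ.mul_left_of_isCompact (h.isCompact.inter_right hr)
  have hsub : ∀ r : Set (GL ι ℂ), S ∩ r ⊆ (S ∩ r) * Q := fun r u hu =>
    ⟨u, hu, 1, ⟨one_mem G, by simp⟩, mul_one u⟩
  have hSG : S ⊆ G := fun u hu => hu.1
  have hcov : (G : Set (GL ι ℂ)) ⊆ (S ∩ t) * Q ∪ (S ∩ t') * Q := by
    intro g hg
    obtain ⟨u, hu, X, hXm, hX, rfl⟩ := h.exists_polar hg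
    have hq := hmem X hX (h.expLie.exp_mem X hXm)
    rcases hst hu with hut | hut
    · exact Or.inl ⟨u, ⟨hu, hut⟩, _, hq, rfl⟩
    · exact Or.inr ⟨u, ⟨hu, hut⟩, _, hq, rfl⟩
  obtain ⟨u₀, hu₀⟩ := hne
  obtain ⟨u₁, hu₁⟩ := hne'
  obtain ⟨g, -, ⟨u, hu, q, hq, rfl⟩, ⟨u', hu', q', hq', he⟩⟩ :=
    isPreconnected_closed_iff.1 hG.isPreconnected _ _ (hcl t ht) (hcl t' ht') hcov
      ⟨u₀, hSG hu₀.1, hsub t hu₀⟩ ⟨u₁, hSG hu₁.1, hsub t' hu₁⟩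
  obtain ⟨X, hX, rfl⟩ := exists_log_of_nonneg hq.2
  obtain ⟨X', hX', rfl⟩ := exists_log_of_nonneg hq'.2
  have := polar_unique hu'.1.2 hu.1.2 hX' hX he
  subst this
  exact ⟨u', hu.1, hu.2, hu'.2⟩

lemma continuous_expUnit : Continuous (expUnit : Matrix ι ι ℂ → GL ι ℂ) :=
  Units.continuous_iff.2 ⟨contDiff_exp.continuous, contDiff_exp.continuous.comp continuous_neg⟩

/-- `G` is connected if its unitary part is: the polar decomposition joins `u exp X` to `u`. -/
lemma IsSelfAdjointGroup.isConnected_of_unitary (h : IsSelfAdjointGroup G 𝔥)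
    (hU : IsConnected ((G ⊓ U ι : Subgroup (GL ι ℂ)) : Set (GL ι ℂ))) :
    IsConnected (G : Set (GL ι ℂ)) := by
  refine ⟨⟨1, one_mem _⟩, isPreconnected_of_forall 1 fun g hg => ?_⟩
  obtain ⟨u, hu, X, hXm, hX, rfl⟩ := h.exists_polar hg
  have hc : Continuous (fun t : ℝ => u * expUnit (t • X)) :=
    continuous_const.mul (continuous_expUnit.comp (continuous_id.smul continuous_const))
  refine ⟨((G ⊓ U ι : Subgroup (GL ι ℂ)) : Set (GL ι ℂ)) ∪ range (fun t : ℝ => u * expUnit (t • X)),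
    ?_, Or.inl (one_mem _), Or.inr ⟨1, by simp⟩, ?_⟩
  · rintro x (hx | ⟨t, rfl⟩)
    · exact hx.1
    · exact mul_mem hu.1 (h.expLie.exp_mem _ (𝔥.smul_mem t hXm))
  · refine hU.isPreconnected.union u hu ⟨0, ?_⟩ (isPreconnected_range hc)
    refine Units.ext ?_
    simp

end Polar

/-! ### Symmetric data from self-adjoint groups -/

section Builder

open scoped Matrix.Norms.L2Operator

variable {ι : Type} [Fintype ι] [DecidableEq ι]

theorem IsSelfAdjointGroup.isSymmetricDatum {G V K Z : Subgroup (GL ι ℂ)}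
    {𝔤 : LieSubalgebra ℂ (Matrix ι ι ℂ)} {E H : Matrix ι ι ℂ}
    (h : IsSelfAdjointGroup G (realPart 𝔤)) (hV : V = G ⊓ U ι) (D : FlagDatum G V (realPart 𝔤) E)
    (hconn : IsConnected (G : Set (GL ι ℂ)))
    (hH : ∃ c : ℂ, H = (Complex.I * Real.pi) • E + c • 1)
    (hmem : H ∈ 𝔤) (hskew : star H = -H)
    (hZ : ∀ g, g ∈ Z ↔ g ∈ G ∧ (g : Matrix ι ι ℂ) * E = E * (g : Matrix ι ι ℂ))
    (hK : ∀ g, g ∈ K ↔ g ∈ V ∧ (g : Matrix ι ι ℂ) * E = E * (g : Matrix ι ι ℂ))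
    (hfaithful : upperBlock (realPart 𝔤) E = ⊥ ∨ ∀ a, a * E = E * a →
      (∀ X ∈ upperBlock (realPart 𝔤) E, a * X = 0 ∧ X * a = 0) → a = 0) :
    IsSymmetricDatum G V K Z 𝔤 (realPart 𝔤 ⊓ skewHermitian ι) E H where
  datum := D
  eq_flag := hH
  mem_Z := hZ
  mem_K := hK
  expG := h.expLie
  expU := hV ▸ h.expLie.inf hasExpLieAlgebra_U
  le := inf_le_left
  sub_star_mem Y hY := ⟨sub_mem hY (h.star_mem Y hY), by
    rw [SetLike.mem_coe, mem_skewHermitian, star_sub, star_star, neg_sub]⟩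
  mem_lie := ⟨hmem, hskew⟩
  conj_mem := h.conj_mem
  compact := isCompact_iff_compactSpace.1 (hV ▸ h.isCompact)
  connectedU := isConnected_iff_connectedSpace.1 (hV ▸ h.isConnected_unitary hconn)
  connectedG := isConnected_iff_connectedSpace.1 hconn
  faithful := hfaithful

end Builder

/-! ### The big cell in special linear groups and in isometry groups -/

section Cells

open scoped Matrix.Norms.L2Operator

variable {ι : Type} [Fintype ι] [DecidableEq ι] {E : Matrix ι ι ℂ}

lemma IsLower.trace_eq_zero {Y : Matrix ι ι ℂ} (hY : IsLower E Y) : Y.trace = 0 := by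
  rw [← hY.right, Matrix.trace_mul_comm, hY.left, Matrix.trace_zero]

lemma IsUpper.trace_eq_zero {X : Matrix ι ι ℂ} (hX : IsUpper E X) : X.trace = 0 := by
  rw [← hX.left, Matrix.trace_mul_comm, hX.right, Matrix.trace_zero]

lemma IsLower.det_one_add {Y : Matrix ι ι ℂ} (hY : IsLower E Y) : (1 + Y).det = 1 := by
  rw [← hY.right, Matrix.det_one_add_mul_comm, hY.left, add_zero, Matrix.det_one]

lemma IsUpper.det_one_add {X : Matrix ι ι ℂ} (hX : IsUpper E X) : (1 + X).det = 1 := by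
  rw [← hX.left, Matrix.det_one_add_mul_comm, hX.right, add_zero, Matrix.det_one]

/-- `1 + Y` as a unit, for `Y² = 0`. -/
def unipotentUnit (Y : Matrix ι ι ℂ) (hY : Y * Y = 0) : GL ι ℂ where
  val := 1 + Y
  inv := 1 - Y
  val_inv := by rw [add_mul, mul_sub, mul_sub, hY]; simp
  inv_val := by rw [sub_mul, mul_add, mul_add, hY]; simp

lemma flagDatum_SL (hE : E * E = E) (hs : star E = E) :
    FlagDatum (SL ι) (SL ι ⊓ U ι) (traceless ι) E where
  idem := hE
  star_idem := hs
  le := inf_le_left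
  unitary u hu := mem_U.1 hu.2
  star_mem := isSelfAdjointGroup_SL.star_mem
  one_add_lower Y _ hY := ⟨unipotentUnit Y (hY.mul_eq_zero hY), mem_SL.2 hY.det_one_add, rfl⟩
  one_add_upper X _ hX := ⟨unipotentUnit X (hX.mul_eq_zero hX), mem_SL.2 hX.det_one_add, rfl⟩
  coord_mem _ _ _ hY _ := hY.trace_eq_zero
  upper_mem g _ := by
    have h := isUpper_mul hE ((g : Matrix ι ι ℂ) * E * ((g⁻¹ : GL ι ℂ) : Matrix ι ι ℂ))
    simp only [← mul_assoc] at h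
    exact h.trace_eq_zero

variable {B : Matrix ι ι ℂ} (hB : IsFormMatrix B)

/-- The isometries of determinant one of the bilinear form `B`. -/
def specialIsometryGroup : Subgroup (GL ι ℂ) := hB.isometryGroup ⊓ SL ι

include hB in
lemma bilinSkew_le_traceless : bilinSkew B ≤ traceless ι := fun X hX => by
  have h := hB.trace_adjoint X
  rw [mem_bilinSkew.1 hX, Matrix.trace_neg] at h
  exact mem_traceless.2 (self_eq_neg.1 h.symm)

lemma isSelfAdjointGroup_specialIsometryGroup :
    IsSelfAdjointGroup (specialIsometryGroup hB) (bilinSkew B) := by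
  have h := (isSelfAdjointGroup_isometryGroup hB).inf isSelfAdjointGroup_SL
  rwa [inf_eq_left.2 (bilinSkew_le_traceless hB)] at h

lemma unipotentUnit_mem {Y : Matrix ι ι ℂ} (hY : Y * Y = 0) (hm : Y ∈ bilinSkew B) :
    unipotentUnit Y hY ∈ hB.isometryGroup := by
  rw [hB.mem_isometryGroup]
  change bilinAdjoint B (1 + Y) = 1 - Y
  rw [map_add, hB.adjoint_one, mem_bilinSkew.1 hm, sub_eq_add_neg]

/-- The bilinear form vanishes on the range of `E` and on its kernel when the adjoint of `E` is
`1 - E`; the range of every `g E g⁻¹` with `g` an isometry is then isotropic too, and so the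
coordinate of such a range in the big cell is skew-adjoint. -/
lemma flagDatum_specialIsometryGroup (hE : E * E = E) (hs : star E = E)
    (hBE : bilinAdjoint B E = 1 - E) :
    FlagDatum (specialIsometryGroup hB) (specialIsometryGroup hB ⊓ U ι) (bilinSkew B) E where
  idem := hE
  star_idem := hs
  le := inf_le_left
  unitary u hu := mem_U.1 hu.2
  star_mem := (isSelfAdjointGroup_isometryGroup hB).star_mem
  one_add_lower Y hYm hY := ⟨unipotentUnit Y (hY.mul_eq_zero hY),
    ⟨unipotentUnit_mem hB _ hYm, mem_SL.2 hY.det_one_add⟩, rfl⟩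
  one_add_upper X hXm hX := ⟨unipotentUnit X (hX.mul_eq_zero hX),
    ⟨unipotentUnit_mem hB _ hXm, mem_SL.2 hX.det_one_add⟩, rfl⟩
  coord_mem g hg Y hY h := by
    have h1 := hB.mem_isometryGroup.1 hg.1
    have h2 := hB.mem_isometryGroup.1 (inv_mem hg.1)
    rw [inv_inv] at h2
    -- `Q` projects onto the graph of `Y`, so `(1 - E - Y) Q = 0`; taking adjoints, with
    -- `Q† = 1 - Q`, gives `(1 - Q) (E - Y†) = 0`, and the two combine to `Y† = -Y`.
    set Q : Matrix ι ι ℂ := g * E * ((g⁻¹ : GL ι ℂ) : Matrix ι ι ℂ) with hQ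
    have hQa : bilinAdjoint B Q = 1 - Q := by
      rw [hQ, hB.adjoint_mul, hB.adjoint_mul, h1, h2, hBE, sub_mul, mul_sub, one_mul,
        Units.mul_inv, mul_assoc]
    have hYa : bilinAdjoint B Y = (1 - E) * bilinAdjoint B Y * E := by
      conv_lhs => rw [← hY.eq]
      rw [hB.adjoint_mul, hB.adjoint_mul, map_sub, hB.adjoint_one, hBE, sub_sub_cancel, mul_assoc]
    have hQY : (1 - E - Y) * Q = 0 := by
      have h3 : (1 - E - Y) * Q = (g * E - (E + Y) * g * E) * ((g⁻¹ : GL ι ℂ) : Matrix ι ι ℂ) := by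
        rw [hQ]; noncomm_ring
      rw [h3, ← h, sub_self, zero_mul]
    have h4 : (1 - Q) * (E - bilinAdjoint B Y) = 0 := by
      have h5 := congrArg (bilinAdjoint B) hQY
      rw [hB.adjoint_mul, hQa, map_sub, map_sub, hB.adjoint_one, hBE, sub_sub_cancel,
        map_zero] at h5
      exact h5
    have h6 : E - bilinAdjoint B Y = Q * (E - bilinAdjoint B Y) := by
      rw [sub_mul, one_mul, sub_eq_zero] at h4
      exact h4
    have h7 : (1 - E - Y) * (E - bilinAdjoint B Y) = 0 := by
      rw [h6, ← mul_assoc, hQY, zero_mul]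
    have hl : IsLower E (bilinAdjoint B Y) := hYa ▸ isLower_mul hE _
    rw [mul_sub, sub_mul, sub_mul, sub_mul, sub_mul, one_mul, one_mul, hE, hY.right, hl.left,
      hY.mul_eq_zero hl] at h7
    rw [mem_bilinSkew, eq_neg_iff_add_eq_zero, ← neg_eq_zero, ← h7]
    abel
  upper_mem g hg := by
    have h1 := hB.mem_isometryGroup.1 hg.1
    have h2 := hB.mem_isometryGroup.1 (inv_mem hg.1)
    rw [inv_inv] at h2
    have h3 : bilinAdjoint B (1 - E) = E := by
      rw [map_sub, hB.adjoint_one, hBE, sub_sub_cancel]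
    rw [mem_bilinSkew, hB.adjoint_mul, hB.adjoint_mul, hB.adjoint_mul, hB.adjoint_mul, h1, h2, h3,
      hBE]
    have h4 : E * ((g : Matrix ι ι ℂ) * ((1 - E) * (((g⁻¹ : GL ι ℂ) : Matrix ι ι ℂ) * (1 - E)))) =
        E * ((g : Matrix ι ι ℂ) * ((g⁻¹ : GL ι ℂ) : Matrix ι ι ℂ)) * (1 - E) -
        E * g * E * ((g⁻¹ : GL ι ℂ) : Matrix ι ι ℂ) * (1 - E) := by noncomm_ring
    rw [h4, Units.mul_inv, mul_one, mul_sub, mul_one, hE, sub_self, zero_sub]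

end Cells

/-! ### Connectedness of the complex groups -/

section Connected

open scoped Matrix.Norms.L2Operator

variable {ι : Type} [Fintype ι] [DecidableEq ι]

lemma isConnected_GL : IsConnected (univ : Set (GL ι ℂ)) := by
  refine ⟨⟨1, trivial⟩, isPreconnected_of_forall 1 fun g _ => ?_⟩
  let M : Matrix ι ι ℂ := g - 1
  let p : Polynomial ℂ := Matrix.det (1 + (Polynomial.X : Polynomial ℂ) • M.map Polynomial.C)
  have hp : ∀ t : ℂ, p.eval t = (1 + t • M).det := fun t => by
    change Polynomial.evalRingHom t p = _
    rw [RingHom.map_det]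
    congr 1
    ext i j
    simpa [Matrix.one_apply, apply_ite (Polynomial.eval t)] using mul_comm _ _
  have hp0 : p ≠ 0 := fun h => by
    have := hp 0
    rw [h, Polynomial.eval_zero, zero_smul, add_zero, Matrix.det_one] at this
    exact zero_ne_one this
  -- The invertible matrices on the complex line through `1` and `g` form the complement of a
  -- finite set of that line.
  set S : Set ℂ := {t | p.eval t = 0}ᶜ with hS
  have hSc : IsConnected S := by
    refine (Set.Countable.isPathConnected_compl_of_one_lt_rank ?_ ?_).isConnected
    · rw [Complex.rank_real_complex]; exact Cardinal.one_lt_two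
    · have : {t | p.eval t = 0} = (p.rootSet ℂ) := by
        ext t; simp [Polynomial.mem_rootSet, hp0]
      rw [this]
      exact (Polynomial.rootSet_finite p ℂ).countable
  let f : S → GL ι ℂ := fun t => Matrix.GeneralLinearGroup.mk'' (1 + (t : ℂ) • M) (by
    rw [← hp]; exact isUnit_iff_ne_zero.2 t.2)
  have hf : Continuous f := by
    rw [(Units.isOpenEmbedding_val (R := Matrix ι ι ℂ)).isEmbedding.continuous_iff]
    change Continuous fun t : S => 1 + (t : ℂ) • M
    fun_prop
  have := isConnected_iff_connectedSpace.1 hSc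
  refine ⟨range f, subset_univ _, ⟨⟨0, ?_⟩, ?_⟩, ⟨⟨1, ?_⟩, ?_⟩, isPreconnected_range hf⟩
  · rw [hS]; change ¬ (p.eval 0 = 0); rw [hp]; simp
  · exact Units.ext (by change 1 + (0 : ℂ) • M = 1; simp)
  · rw [hS]; change ¬ (p.eval 1 = 0); rw [hp, one_smul]
    simpa [M] using g.isUnit.map Matrix.detMonoidHom |>.ne_zero
  · exact Units.ext (by change 1 + (1 : ℂ) • M = g; simp [M])

/-- The special linear group is a retract of the general linear group. -/
lemma isConnected_SL : IsConnected (SL ι : Set (GL ι ℂ)) := by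
  rcases isEmpty_or_nonempty ι with h | ⟨⟨i⟩⟩
  · have : Subsingleton (GL ι ℂ) := ⟨fun a b => Units.ext (Subsingleton.elim _ _)⟩
    exact ⟨⟨1, one_mem _⟩, Set.subsingleton_of_subsingleton.isPreconnected⟩
  -- `d c` is the diagonal matrix with one entry `c` and the other entries `1`.
  let d₀ : ℂ →* Matrix ι ι ℂ :=
    (Matrix.diagonalRingHom ι ℂ).toMonoidHom.comp (MonoidHom.mulSingle (fun _ => ℂ) i)
  have hd₀ : Continuous d₀ := by
    change Continuous fun c : ℂ => Matrix.diagonal (Pi.mulSingle i c)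
    exact (continuous_mulSingle i).matrix_diagonal
  let d : ℂˣ →* GL ι ℂ := Units.map d₀
  have hdc : Continuous d := hd₀.units_map d₀
  have hdet : ∀ c : ℂˣ, ((d c : GL ι ℂ) : Matrix ι ι ℂ).det = c := fun c => by
    change (Matrix.diagonal (Pi.mulSingle i (c : ℂ))).det = c
    rw [Matrix.det_diagonal, Finset.prod_eq_single i (fun j _ hj => Pi.mulSingle_eq_of_ne hj _)
      (fun h => absurd (Finset.mem_univ i) h), Pi.mulSingle_eq_same]
  -- `f` is a continuous retraction of the general onto the special linear group.
  let f : GL ι ℂ → GL ι ℂ := fun g => g * d (Matrix.GeneralLinearGroup.det g)⁻¹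
  have hdetc : Continuous (Matrix.GeneralLinearGroup.det : GL ι ℂ → ℂˣ) := by
    rw [(Units.isOpenEmbedding_val (R := ℂ)).isEmbedding.continuous_iff]
    exact continuous_val_GL.matrix_det
  have hf : Continuous f := continuous_id.mul (hdc.comp hdetc.inv)
  have himg : (SL ι : Set (GL ι ℂ)) = f '' univ := by
    ext g
    constructor
    · intro hg
      refine ⟨g, trivial, ?_⟩
      have h1 : Matrix.GeneralLinearGroup.det g = 1 := hg
      change g * d (Matrix.GeneralLinearGroup.det g)⁻¹ = g
      rw [h1, inv_one, map_one, mul_one]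
    · rintro ⟨g, -, rfl⟩
      refine mem_SL.2 ?_
      rw [Units.val_mul, Matrix.det_mul, hdet]
      exact (Matrix.GeneralLinearGroup.det g).mul_inv
  rw [himg]
  exact isConnected_GL.image f hf.continuousOn

/-- The identity component of a matrix group. -/
def identityComponent (G : Subgroup (GL ι ℂ)) : Subgroup (GL ι ℂ) :=
  (Subgroup.connectedComponentOfOne G).map G.subtype

variable {G : Subgroup (GL ι ℂ)}

lemma mem_identityComponent {S : Set (GL ι ℂ)} (hS : IsPreconnected S) (h1 : 1 ∈ S)
    (hSG : S ⊆ G) {g : GL ι ℂ} (hg : g ∈ S) : g ∈ identityComponent G := by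
  have h2 : IsPreconnected ((↑) ⁻¹' S : Set G) := by
    have h3 : ((↑) : G → GL ι ℂ) '' ((↑) ⁻¹' S) = S :=
      image_preimage_eq_of_subset fun x hx => ⟨⟨x, hSG hx⟩, rfl⟩
    exact IsInducing.subtypeVal.isPreconnected_image.1 ((congrArg IsPreconnected h3).mpr hS)
  exact ⟨⟨g, hSG hg⟩, h2.subset_connectedComponent (x := (1 : G)) h1 hg, rfl⟩

lemma isConnected_of_le_identityComponent (h : G ≤ identityComponent G) :
    IsConnected (G : Set (GL ι ℂ)) := by
  have h1 : (G : Set (GL ι ℂ)) = (↑) '' (connectedComponent (1 : G)) := by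
    ext g
    constructor
    · intro hg
      obtain ⟨x, hx, rfl⟩ := h hg
      exact ⟨x, hx, rfl⟩
    · rintro ⟨x, -, rfl⟩
      exact x.2
  rw [h1]
  exact isConnected_connectedComponent.image _ continuous_subtype_val.continuousOn

lemma unipotent_mem_identityComponent {g : GL ι ℂ} {Y : Matrix ι ι ℂ} (hY : Y * Y = 0)
    (hg : (g : Matrix ι ι ℂ) = 1 + Y)
    (hm : ∀ t : ℝ, ∀ g' : GL ι ℂ, (g' : Matrix ι ι ℂ) = 1 + t • Y → g' ∈ G) :
    g ∈ identityComponent G := by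
  have h2 : ∀ t : ℝ, (t • Y) * (t • Y) = 0 := fun t => by rw [smul_mul_smul_comm, hY, smul_zero]
  let f : ℝ → GL ι ℂ := fun t => unipotentUnit (t • Y) (h2 t)
  have hf : Continuous f := by
    rw [(Units.isOpenEmbedding_val (R := Matrix ι ι ℂ)).isEmbedding.continuous_iff]
    change Continuous fun t : ℝ => 1 + t • Y
    fun_prop
  refine mem_identityComponent (isPreconnected_range hf) ⟨0, Units.ext ?_⟩ ?_
    ⟨1, Units.ext ?_⟩
  · change 1 + (0 : ℝ) • Y = 1
    rw [zero_smul, add_zero]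
  · rintro _ ⟨t, rfl⟩
    exact hm t _ rfl
  · change 1 + (1 : ℝ) • Y = g
    rw [one_smul, hg]

/-- `G` is connected if the centralizer of `E` lies in the identity component and every element
of `G` can be moved into the big cell by a unipotent element. -/
lemma FlagDatum.isConnected {V : Subgroup (GL ι ℂ)} {𝔥 : Submodule ℝ (Matrix ι ι ℂ)}
    {E : Matrix ι ι ℂ} (D : FlagDatum G V 𝔥 E)
    (hcomm : ∀ z ∈ G, (z : Matrix ι ι ℂ) * E = E * (z : Matrix ι ι ℂ) → z ∈ identityComponent G)
    (hcell : ∀ g ∈ G, ∃ X ∈ upperBlock 𝔥 E,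
      IsUnit (pivot E ((1 + X) * (g : Matrix ι ι ℂ)))) :
    IsConnected (G : Set (GL ι ℂ)) := by
  have hmem : ∀ {g g' : GL ι ℂ} {Y : Matrix ι ι ℂ}, g ∈ G → (g : Matrix ι ι ℂ) = Y →
    (g' : Matrix ι ι ℂ) = Y → g' ∈ G := fun {g g' Y} h h1 h2 => by
      have : g' = g := Units.ext (h2.trans h1.symm)
      rwa [this]
  have hup : ∀ X ∈ upperBlock 𝔥 E, ∀ g : GL ι ℂ, (g : Matrix ι ι ℂ) = 1 + X →
      g ∈ identityComponent G := fun X hX g hg =>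
    unipotent_mem_identityComponent (hX.2.mul_eq_zero hX.2) hg fun t g' hg' => by
      have hX' := Submodule.smul_mem _ t hX
      obtain ⟨g₁, h1, h2⟩ := D.one_add_upper _ hX'.1 hX'.2
      exact hmem h1 h2 hg'
  have hlow : ∀ Y ∈ lowerBlock 𝔥 E, ∀ g : GL ι ℂ, (g : Matrix ι ι ℂ) = 1 + Y →
      g ∈ identityComponent G := fun Y hY g hg =>
    unipotent_mem_identityComponent (hY.2.mul_eq_zero hY.2) hg fun t g' hg' => by
      have hY' := Submodule.smul_mem _ t hY
      obtain ⟨g₁, h1, h2⟩ := D.one_add_lower _ hY'.1 hY'.2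
      exact hmem h1 h2 hg'
  have key : ∀ g ∈ G, IsUnit (pivot E (g : Matrix ι ι ℂ)) → g ∈ identityComponent G := by
    intro g hg hp
    have hY := D.cellCoord_mem (g := ⟨g, hg⟩) hp
    have hX := D.orbitCoord_mem (g := ⟨g, hg⟩)
    obtain ⟨l, hl, hl'⟩ := D.one_add_lower _ hY.1 hY.2
    obtain ⟨r, hr, hr'⟩ := D.one_add_upper _ hX.1 hX.2
    have h1 := hcomm _ (mul_mem (inv_mem (mul_mem hl hr)) hg)
      (FlagDatum.inv_mul_comm_of_isUnit_pivot D.idem hp hl' hr')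
    have h2 := mul_mem (mul_mem (hlow _ hY l hl') (hup _ hX r hr')) h1
    rwa [mul_inv_cancel_left] at h2
  refine isConnected_of_le_identityComponent fun g hg => ?_
  obtain ⟨X, hX, hp⟩ := hcell g hg
  obtain ⟨r, hr, hr'⟩ := D.one_add_upper _ hX.1 hX.2
  have h1 := key (r * g) (mul_mem hr hg) (by rwa [Units.val_mul, hr'])
  have h2 := mul_mem (inv_mem (hup X hX r hr')) h1
  rwa [inv_mul_cancel_left] at h2

/-- For a symmetric pair `(A, C)` with `ker A ∩ ker C = 0` there is a symmetric `S` for which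
`A + S C` is invertible. Adding `v vᵀ` to `S` removes the vector `x ∈ ker A` from the kernel when
`v` is not orthogonal to `C x`. -/
lemma exists_isSymm_isUnit_add_mul (A C : Matrix ι ι ℂ)
    (hker : ∀ x, A.mulVec x = 0 → C.mulVec x = 0 → x = 0)
    (hsymm : A.transpose * C = C.transpose * A) :
    ∃ S : Matrix ι ι ℂ, S.IsSymm ∧ IsUnit (A + S * C) := by
  induction hn : Module.finrank ℂ (LinearMap.ker A.mulVecLin) using Nat.strong_induction_on
    generalizing A with
  | _ n ih =>
    by_cases hA : IsUnit A
    · exact ⟨0, Matrix.isSymm_zero, by rwa [zero_mul, add_zero]⟩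
    obtain ⟨x, hx, hx0⟩ : ∃ x, A.mulVec x = 0 ∧ x ≠ 0 := by
      by_contra! hcon
      refine hA (Matrix.mulVec_injective_iff_isUnit.1 ?_)
      rw [← Matrix.coe_mulVecLin, ← LinearMap.ker_eq_bot]
      exact Matrix.ker_mulVecLin_eq_bot_iff.2 hcon
    have hCx : C.mulVec x ≠ 0 := fun h => hx0 (hker x hx h)
    obtain ⟨i, hi⟩ := Function.ne_iff.1 hCx
    let v : ι → ℂ := Pi.single i 1
    have hv : v ⬝ᵥ C.mulVec x ≠ 0 := by
      rw [single_one_dotProduct]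
      exact hi
    set T := Matrix.vecMulVec v v with hT
    have hTs : T.IsSymm := Matrix.transpose_vecMulVec v v
    have hmul : ∀ y, (A + T * C).mulVec y = A.mulVec y + (v ⬝ᵥ C.mulVec y) • v := fun y => by
      rw [Matrix.add_mulVec, ← Matrix.mulVec_mulVec, hT, Matrix.vecMulVec_mulVec]
      simp
    -- By symmetry the range of `A` is orthogonal to `C x`, while `v` is not; so the kernel of
    -- `A + v vᵀ C` is the part of `ker A` on which `v ⬝ᵥ C y` vanishes.
    have hort : ∀ y, C.mulVec x ⬝ᵥ A.mulVec y = 0 := fun y => by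
      rw [Matrix.dotProduct_mulVec, ← Matrix.mulVec_transpose, Matrix.mulVec_mulVec, hsymm,
        ← Matrix.mulVec_mulVec, hx]
      simp
    have hk : ∀ y, (A + T * C).mulVec y = 0 → A.mulVec y = 0 ∧ v ⬝ᵥ C.mulVec y = 0 := fun y hy => by
      rw [hmul] at hy
      have h1 := congrArg (C.mulVec x ⬝ᵥ ·) hy
      simp only [dotProduct_add, hort, dotProduct_smul, zero_add, dotProduct_zero,
        smul_eq_mul] at h1
      rw [dotProduct_comm _ v] at h1
      have h2 := (mul_eq_zero.1 h1).resolve_right hv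
      rw [h2, zero_smul, add_zero] at hy
      exact ⟨hy, h2⟩
    have hlt : LinearMap.ker (A + T * C).mulVecLin < LinearMap.ker A.mulVecLin := by
      refine lt_of_le_of_ne (fun y hy => (hk y hy).1) fun h => ?_
      have h1 : x ∈ LinearMap.ker (A + T * C).mulVecLin := by rw [h]; exact hx
      exact hv (hk x h1).2
    obtain ⟨S, hS, hu⟩ := ih _ (hn ▸ Submodule.finrank_lt_finrank_of_lt hlt) (A + T * C)
      (fun y hy => hker y (hk y hy).1)
      (by rw [Matrix.transpose_add, Matrix.transpose_mul, hTs.eq, add_mul, mul_add, hsymm,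
        mul_assoc]) rfl
    exact ⟨T + S, hTs.add hS, by rwa [add_mul, ← add_assoc]⟩

end Connected

/-! ### Connectedness of the real special orthogonal group -/

section Reflections

open scoped Matrix.Norms.L2Operator

variable {ι : Type} [Fintype ι] [DecidableEq ι]

/-- The reflection in the hyperplane orthogonal to `v`, which is the identity for `v = 0`. -/
def reflMatrix (v : ι → ℝ) : Matrix ι ι ℝ := 1 - (2 / (v ⬝ᵥ v)) • Matrix.vecMulVec v v

lemma reflMatrix_transpose (v : ι → ℝ) : (reflMatrix v).transpose = reflMatrix v := by
  rw [reflMatrix, Matrix.transpose_sub, Matrix.transpose_one, Matrix.transpose_smul,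
    Matrix.transpose_vecMulVec]

lemma reflMatrix_mul_self (v : ι → ℝ) : reflMatrix v * reflMatrix v = 1 := by
  rcases eq_or_ne (v ⬝ᵥ v) 0 with h | h
  · rw [reflMatrix, h, div_zero, zero_smul, sub_zero, one_mul]
  · rw [reflMatrix, sub_mul, mul_sub, mul_sub, one_mul, mul_one, one_mul, smul_mul_smul_comm,
      Matrix.vecMulVec_mul_vecMulVec, Matrix.vecMulVec_smul, smul_smul]
    have : 2 / (v ⬝ᵥ v) * (2 / (v ⬝ᵥ v)) * (v ⬝ᵥ v) = 2 / (v ⬝ᵥ v) + 2 / (v ⬝ᵥ v) := by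
      field_simp
      norm_num
    rw [this, add_smul]
    abel

lemma reflMatrix_det {v : ι → ℝ} (hv : v ≠ 0) : (reflMatrix v).det = -1 := by
  have h0 : v ⬝ᵥ v ≠ 0 := fun h => hv (dotProduct_self_eq_zero.1 h)
  have h : reflMatrix v = 1 + Matrix.replicateCol Unit ((-(2 / (v ⬝ᵥ v))) • v) *
      Matrix.replicateRow Unit v := by
    rw [reflMatrix, sub_eq_add_neg, ← neg_smul, ← Matrix.smul_vecMulVec,
      Matrix.vecMulVec_eq Unit]
  rw [h, Matrix.det_one_add_replicateCol_mul_replicateRow, dotProduct_smul, smul_eq_mul,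
    neg_mul, div_mul_cancel₀ _ h0]
  norm_num

/-- The Cartan–Dieudonné theorem for orthogonal matrices. -/
lemma exists_eq_prod_reflMatrix {M : Matrix ι ι ℝ} (hM : M ∈ Matrix.unitaryGroup ι ℝ) :
    ∃ L : List (ι → ℝ), M = (L.map reflMatrix).prod := by
  let Θ := Matrix.toEuclideanCLM (n := ι) (𝕜 := ℝ)
  let χ : (EuclideanSpace ℝ ι ≃ₗᵢ[ℝ] EuclideanSpace ℝ ι) →* Matrix ι ι ℝ :=
    (Θ.symm : _ →* _).comp ((unitary _).subtype.comp
      (Unitary.linearIsometryEquiv (𝕜 := ℝ) (H := EuclideanSpace ℝ ι)).symm.toMonoidHom)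
  have hΘ : Θ M ∈ unitary (EuclideanSpace ℝ ι →L[ℝ] EuclideanSpace ℝ ι) := by
    rw [Unitary.mem_iff] at hM ⊢
    rw [← map_star, ← map_mul, ← map_mul, hM.1, hM.2, map_one]
    exact ⟨rfl, rfl⟩
  have hχ : χ (Unitary.linearIsometryEquiv ⟨Θ M, hΘ⟩) = M := by
    change Θ.symm ((Unitary.linearIsometryEquiv.symm (Unitary.linearIsometryEquiv ⟨Θ M, hΘ⟩) :
      unitary (EuclideanSpace ℝ ι →L[ℝ] EuclideanSpace ℝ ι)) :
      EuclideanSpace ℝ ι →L[ℝ] EuclideanSpace ℝ ι) = M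
    rw [MulEquiv.symm_apply_apply]
    exact Θ.symm_apply_apply M
  have hrefl : ∀ v : EuclideanSpace ℝ ι,
      χ (Submodule.reflection (Submodule.span ℝ {v})ᗮ) = reflMatrix v.ofLp := fun v => by
    change Θ.symm _ = _
    rw [StarAlgEquiv.symm_apply_eq]
    ext x i
    have h1 : v.ofLp ⬝ᵥ v.ofLp = ‖v‖ ^ 2 := by
      rw [EuclideanSpace.real_norm_sq_eq, dotProduct]
      exact Finset.sum_congr rfl fun i _ => (sq _).symm
    have h2 : inner ℝ v x = v.ofLp ⬝ᵥ x.ofLp := by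
      rw [PiLp.inner_apply, dotProduct]
      exact Finset.sum_congr rfl fun i _ => mul_comm _ _
    have h3 : (Θ (reflMatrix v.ofLp) x).ofLp = (reflMatrix v.ofLp).mulVec x.ofLp := rfl
    change (Submodule.reflection (Submodule.span ℝ {v})ᗮ x) i = (Θ (reflMatrix v.ofLp) x).ofLp i
    rw [h3, Submodule.reflection_orthogonal_apply, Submodule.reflection_singleton_apply, h2,
      reflMatrix, Matrix.sub_mulVec, Matrix.smul_mulVec, Matrix.vecMulVec_mulVec, h1]
    simp
    ring
  obtain ⟨L, -, hL⟩ := (Unitary.linearIsometryEquiv ⟨Θ M, hΘ⟩).reflections_generate_dim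
  refine ⟨L.map fun v => v.ofLp, ?_⟩
  rw [← hχ, hL, map_list_prod, List.map_map, List.map_map]
  congr 1
  exact List.map_congr_left fun v _ => hrefl v

/-- A reflection as an invertible complex matrix. -/
def reflGL (v : ι → ℝ) : GL ι ℂ :=
  Units.map (Complex.ofRealHom.mapMatrix : Matrix ι ι ℝ →+* Matrix ι ι ℂ).toMonoidHom
    ⟨reflMatrix v, reflMatrix v, reflMatrix_mul_self v, reflMatrix_mul_self v⟩

lemma val_reflGL (v : ι → ℝ) : (reflGL v : Matrix ι ι ℂ) = (reflMatrix v).map Complex.ofReal := rfl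

lemma reflGL_mul_self (v : ι → ℝ) : reflGL v * reflGL v = 1 := by
  refine Units.ext ?_
  change Complex.ofRealHom.mapMatrix (reflMatrix v) * Complex.ofRealHom.mapMatrix (reflMatrix v) = 1
  rw [← map_mul, reflMatrix_mul_self, map_one]

lemma reflGL_inv (v : ι → ℝ) : (reflGL v)⁻¹ = reflGL v :=
  inv_eq_of_mul_eq_one_left (reflGL_mul_self v)

lemma isFormMatrix_one : IsFormMatrix (1 : Matrix ι ι ℂ) :=
  ⟨by rw [Matrix.transpose_one, mul_one], by rw [star_one, Matrix.transpose_one]⟩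

lemma bilinAdjoint_one (X : Matrix ι ι ℂ) : bilinAdjoint 1 X = X.transpose := by
  change Matrix.transpose 1 * X.transpose * 1 = _
  rw [Matrix.transpose_one, one_mul, mul_one]

lemma reflGL_mem_isometryGroup (v : ι → ℝ) :
    reflGL v ∈ (isFormMatrix_one (ι := ι)).isometryGroup := by
  rw [isFormMatrix_one.mem_isometryGroup, reflGL_inv, bilinAdjoint_one, val_reflGL,
    ← Matrix.transpose_map, reflMatrix_transpose]

lemma reflGL_mem_U (v : ι → ℝ) : reflGL v ∈ U ι := by
  rw [mem_U, reflGL_inv, val_reflGL]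
  nth_rw 2 [← reflMatrix_transpose v]
  ext i j
  simp [Matrix.star_apply]

lemma reflGL_det {v : ι → ℝ} (hv : v ≠ 0) : (reflGL v : Matrix ι ι ℂ).det = -1 := by
  change (Complex.ofRealHom.mapMatrix (reflMatrix v)).det = -1
  rw [← RingHom.map_det, reflMatrix_det hv, map_neg, map_one]

variable (ι) in
/-- The special orthogonal group of real matrices, as a group of complex matrices. -/
def realSpecialOrthogonal : Subgroup (GL ι ℂ) := specialIsometryGroup isFormMatrix_one ⊓ U ι

lemma reflGL_mul_mem {v w : ι → ℝ} (hv : v ≠ 0) (hw : w ≠ 0) :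
    reflGL v * reflGL w ∈ realSpecialOrthogonal ι :=
  ⟨⟨mul_mem (reflGL_mem_isometryGroup v) (reflGL_mem_isometryGroup w), mem_SL.2 (by
    rw [Units.val_mul, Matrix.det_mul, reflGL_det hv, reflGL_det hw]; norm_num)⟩,
    mul_mem (reflGL_mem_U v) (reflGL_mem_U w)⟩

lemma continuousOn_reflGL : ContinuousOn (reflGL : (ι → ℝ) → GL ι ℂ) {0}ᶜ := by
  rw [(Units.isOpenEmbedding_val (R := Matrix ι ι ℂ)).isEmbedding.continuousOn_iff]
  have h1 : ContinuousOn (reflMatrix : (ι → ℝ) → Matrix ι ι ℝ) {0}ᶜ := by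
    have h0 : ∀ v : ι → ℝ, v ∈ ({0}ᶜ : Set (ι → ℝ)) → v ⬝ᵥ v ≠ 0 := fun v hv h =>
      hv (dotProduct_self_eq_zero.1 h)
    refine continuousOn_const.sub (ContinuousOn.smul (continuousOn_const.div ?_ h0) ?_)
    · exact (continuous_id.dotProduct continuous_id).continuousOn
    · exact (continuous_id.matrix_vecMulVec continuous_id).continuousOn
  have h2 : Continuous fun M : Matrix ι ι ℝ => M.map Complex.ofReal :=
    continuous_id.matrix_map Complex.continuous_ofReal
  exact h2.comp_continuousOn h1

lemma reflGL_mul_mem_identityComponent [Nontrivial ι] {v w : ι → ℝ} (hv : v ≠ 0) (hw : w ≠ 0) :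
    reflGL v * reflGL w ∈ identityComponent (realSpecialOrthogonal ι) := by
  have h1 : IsPreconnected ({0}ᶜ : Set (ι → ℝ)) := by
    refine (isConnected_compl_singleton_of_one_lt_rank ?_ 0).isPreconnected
    rw [rank_fun']
    exact_mod_cast Fintype.one_lt_card
  refine mem_identityComponent
    (h1.image (fun v => reflGL v * reflGL w) (continuousOn_reflGL.mul continuousOn_const))
    ⟨w, hw, reflGL_mul_self w⟩ ?_ ⟨v, hv, rfl⟩
  rintro _ ⟨v', hv', rfl⟩
  exact reflGL_mul_mem hv' hw

lemma identityComponent_le (G : Subgroup (GL ι ℂ)) : identityComponent G ≤ G := by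
  rintro _ ⟨x, -, rfl⟩
  exact x.2

lemma reflGL_zero : reflGL (0 : ι → ℝ) = 1 := by
  refine Units.ext ?_
  rw [val_reflGL, reflMatrix]
  simp

/-- The real special orthogonal group is connected, since the nonzero vectors which define
reflections form a connected set in dimension at least two. -/
theorem isConnected_realSpecialOrthogonal [Nontrivial ι] :
    IsConnected (realSpecialOrthogonal ι : Set (GL ι ℂ)) := by
  set T := realSpecialOrthogonal ι
  let i : ι := Classical.arbitrary ι
  let e : ι → ℝ := Pi.single i 1
  have he : e ≠ 0 := by
    intro h
    have := congrFun h i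
    simp [e] at this
  -- A product of an even number of nontrivial reflections lies in the identity component; for an
  -- odd number one multiplies by the reflection in `e`. The determinant decides between the two
  -- cases.
  have key : ∀ L : List (ι → ℝ), (L.map reflGL).prod ∈ identityComponent T ∨
      reflGL e * (L.map reflGL).prod ∈ identityComponent T := by
    intro L
    induction L with
    | nil => exact Or.inl (one_mem _)
    | cons v L ih =>
      rw [List.map_cons, List.prod_cons]
      rcases eq_or_ne v 0 with rfl | hv
      · rwa [reflGL_zero, one_mul]
      rcases ih with h | h
      · right
        rw [← mul_assoc]
        exact mul_mem (reflGL_mul_mem_identityComponent he hv) h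
      · left
        have h2 := mul_mem (reflGL_mul_mem_identityComponent hv he) h
        rwa [mul_assoc, ← mul_assoc (reflGL e), reflGL_mul_self, one_mul] at h2
  refine isConnected_of_le_identityComponent fun g hg => ?_
  have h1 := isFormMatrix_one.mem_isometryGroup.1 hg.1.1
  have h2 := mem_U.1 hg.2
  rw [bilinAdjoint_one, ← h2] at h1
  set M : Matrix ι ι ℝ := (g : Matrix ι ι ℂ).map Complex.re with hMdef
  have hM : M.map Complex.ofReal = g := by
    ext a b
    have h3 := congrFun (congrFun h1 b) a
    exact (Complex.conj_eq_iff_re.1 h3.symm)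
  have hMu : M ∈ Matrix.unitaryGroup ι ℝ := by
    rw [Matrix.mem_unitaryGroup_iff]
    have hinj : Function.Injective (Complex.ofRealHom.mapMatrix : Matrix ι ι ℝ →+* Matrix ι ι ℂ) :=
      Matrix.map_injective Complex.ofReal_injective
    refine hinj ?_
    rw [map_mul, map_one]
    have h4 : Complex.ofRealHom.mapMatrix (star M) = star (g : Matrix ι ι ℂ) := by
      rw [← hM]
      ext a b
      simp [Matrix.star_apply]
    rw [h4]
    change M.map Complex.ofReal * _ = 1
    rw [hM, h2, Units.mul_inv]
  obtain ⟨L, hL⟩ := exists_eq_prod_reflMatrix hMu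
  have hgL : g = (L.map reflGL).prod := by
    refine Units.ext ?_
    rw [← hM, hL]
    change Complex.ofRealHom.mapMatrix _ = Units.coeHom _ _
    rw [map_list_prod, map_list_prod, List.map_map, List.map_map]
    rfl
  rcases key L with h | h
  · rwa [hgL]
  · rw [← hgL] at h
    have h5 := mem_SL.1 (identityComponent_le T h).1.2
    rw [Units.val_mul, Matrix.det_mul, reflGL_det he, mem_SL.1 hg.1.2] at h5
    norm_num at h5

end Reflections

/-! ### Block matrices -/

section Blocks

open scoped Matrix.Norms.L2Operator

variable (m n : Type) [Fintype m] [DecidableEq m] [Fintype n] [DecidableEq n]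

/-- The projection onto the first block. -/
def blockProj : Matrix (m ⊕ n) (m ⊕ n) ℂ := Matrix.fromBlocks 1 0 0 0

lemma blockProj_mul_self : blockProj m n * blockProj m n = blockProj m n := by
  rw [blockProj, Matrix.fromBlocks_multiply]
  simp

lemma star_blockProj : star (blockProj m n) = blockProj m n := by
  rw [blockProj, Matrix.star_eq_conjTranspose, Matrix.fromBlocks_conjTranspose]
  simp

lemma one_sub_blockProj : 1 - blockProj m n = Matrix.fromBlocks 0 0 0 1 := by
  rw [blockProj, ← Matrix.fromBlocks_one, sub_eq_add_neg, Matrix.fromBlocks_neg,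
    Matrix.fromBlocks_add]
  simp

variable {m n}

lemma mul_blockProj_comm_iff {X : Matrix (m ⊕ n) (m ⊕ n) ℂ} :
    X * blockProj m n = blockProj m n * X ↔ ∃ a d, X = Matrix.fromBlocks a 0 0 d := by
  constructor
  · intro h
    rw [← X.fromBlocks_toBlocks, blockProj, Matrix.fromBlocks_multiply,
      Matrix.fromBlocks_multiply] at h
    simp only [Matrix.mul_one, Matrix.mul_zero, add_zero, Matrix.one_mul, Matrix.zero_mul,
      Matrix.fromBlocks_inj] at h
    refine ⟨X.toBlocks₁₁, X.toBlocks₂₂, ?_⟩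
    conv_lhs => rw [← X.fromBlocks_toBlocks, h.2.2.1, ← h.2.1]
  · rintro ⟨a, d, rfl⟩
    rw [blockProj, Matrix.fromBlocks_multiply, Matrix.fromBlocks_multiply]
    simp

lemma isUpper_blockProj_iff {X : Matrix (m ⊕ n) (m ⊕ n) ℂ} :
    IsUpper (blockProj m n) X ↔ ∃ S, X = Matrix.fromBlocks 0 S 0 0 := by
  constructor
  · intro h
    have h1 := h.left
    have h2 := h.right
    rw [← X.fromBlocks_toBlocks, blockProj, Matrix.fromBlocks_multiply] at h1 h2
    rw [← Matrix.fromBlocks_zero] at h2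
    simp only [Matrix.mul_one, Matrix.mul_zero, add_zero, Matrix.one_mul, Matrix.zero_mul,
      Matrix.fromBlocks_inj] at h1 h2
    refine ⟨X.toBlocks₁₂, ?_⟩
    conv_lhs => rw [← X.fromBlocks_toBlocks, h2.1, ← h1.2.2.1, ← h1.2.2.2]
  · rintro ⟨S, rfl⟩
    constructor
    · rw [blockProj, Matrix.fromBlocks_multiply]; simp
    · rw [blockProj, Matrix.fromBlocks_multiply]; simp

lemma val_blockDiag (x : GL m ℂ × GL n ℂ) :
    (blockDiag m n x : Matrix (m ⊕ n) (m ⊕ n) ℂ) = Matrix.fromBlocks x.1 0 0 x.2 := rfl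

lemma mem_range_blockDiag {g : GL (m ⊕ n) ℂ} :
    g ∈ (blockDiag m n).range ↔ (g : Matrix (m ⊕ n) (m ⊕ n) ℂ) * blockProj m n =
      blockProj m n * (g : Matrix (m ⊕ n) (m ⊕ n) ℂ) := by
  constructor
  · rintro ⟨x, rfl⟩
    exact mul_blockProj_comm_iff.2 ⟨_, _, val_blockDiag x⟩
  · intro h
    have h' : ((g⁻¹ : GL (m ⊕ n) ℂ) : Matrix (m ⊕ n) (m ⊕ n) ℂ) * blockProj m n =
        blockProj m n * ((g⁻¹ : GL (m ⊕ n) ℂ) : Matrix (m ⊕ n) (m ⊕ n) ℂ) :=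
      (Commute.units_inv_left (show Commute (g : Matrix (m ⊕ n) (m ⊕ n) ℂ) _ from h))
    obtain ⟨a, d, h1⟩ := mul_blockProj_comm_iff.1 h
    obtain ⟨a', d', h2⟩ := mul_blockProj_comm_iff.1 h'
    have h3 := g.mul_inv
    have h4 := g.inv_mul
    rw [h1, h2, Matrix.fromBlocks_multiply, ← Matrix.fromBlocks_one, Matrix.fromBlocks_inj] at h3 h4
    simp only [Matrix.mul_zero, add_zero, Matrix.zero_mul, zero_add] at h3 h4
    exact ⟨(⟨a, a', h3.1, h4.1⟩, ⟨d, d', h3.2.2.2, h4.2.2.2⟩), Units.ext h1.symm⟩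

lemma blockDiag_mem_U {x : GL m ℂ × GL n ℂ} :
    blockDiag m n x ∈ U (m ⊕ n) ↔ x.1 ∈ U m ∧ x.2 ∈ U n := by
  rw [mem_U, mem_U, mem_U]
  change star (Matrix.fromBlocks (x.1 : Matrix m m ℂ) 0 0 (x.2 : Matrix n n ℂ)) =
    Matrix.fromBlocks ((x.1⁻¹ : GL m ℂ) : Matrix m m ℂ) 0 0 ((x.2⁻¹ : GL n ℂ) : Matrix n n ℂ) ↔ _
  rw [Matrix.star_eq_conjTranspose, Matrix.fromBlocks_conjTranspose, Matrix.fromBlocks_inj]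
  simp [Matrix.star_eq_conjTranspose]

lemma SU_eq {ι : Type} [Fintype ι] [DecidableEq ι] : SU ι = SL ι ⊓ U ι := by
  ext g
  rw [Subgroup.mem_inf, mem_SL, SU, U, Submonoid.mem_units_iff, Submonoid.mem_units_iff,
    Matrix.mem_specialUnitaryGroup_iff, Matrix.mem_specialUnitaryGroup_iff]
  constructor
  · rintro ⟨⟨h1, h2⟩, h3, -⟩
    exact ⟨h2, h1, h3⟩
  · rintro ⟨h1, h2, h3⟩
    refine ⟨⟨h2, h1⟩, h3, ?_⟩
    have h4 := congrArg Matrix.det g.mul_inv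
    rwa [Matrix.det_mul, h1, one_mul, Matrix.det_one] at h4

end Blocks

/-! ### The special linear group -/

section TypeA

open scoped Matrix.Norms.L2Operator

variable (p q : ℕ)

lemma HA_eq : ∃ c : ℂ, HA p q = (Complex.I * Real.pi) • blockProj (Fin p) (Fin q) + c • 1 := by
  rcases eq_or_ne (p + q) 0 with h | h
  · obtain ⟨rfl, rfl⟩ := Nat.add_eq_zero_iff.1 h
    exact ⟨0, Subsingleton.elim _ _⟩
  · have h0 : (p : ℂ) + q ≠ 0 := by exact_mod_cast h
    refine ⟨-(Complex.I * Real.pi * p / (p + q)), ?_⟩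
    rw [HA, blockProj, ← Matrix.fromBlocks_one, Matrix.fromBlocks_smul, Matrix.fromBlocks_smul,
      Matrix.fromBlocks_smul, Matrix.fromBlocks_add, Matrix.fromBlocks_inj]
    refine ⟨?_, by simp, by simp, ?_⟩
    · rw [smul_smul, ← add_smul]
      congr 1
      field_simp
      ring
    · rw [smul_smul, smul_zero, zero_add]
      congr 1
      field_simp

lemma trace_HA : (HA p q).trace = 0 := by
  have h : (Matrix.fromBlocks ((q : ℂ) • 1) 0 0 (-(p : ℂ) • 1) :
      Matrix (Fin p ⊕ Fin q) (Fin p ⊕ Fin q) ℂ).trace = 0 := by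
    simp [Matrix.trace]
    ring
  rw [HA, Matrix.trace_smul, h, smul_zero]

lemma star_HA : star (HA p q) = -HA p q := by
  rw [HA, Matrix.star_eq_conjTranspose, Matrix.conjTranspose_smul,
    Matrix.fromBlocks_conjTranspose, ← neg_smul]
  congr 1
  · simp
    ring
  · simp

lemma mem_SGLGL (g : GL (Fin p ⊕ Fin q) ℂ) : g ∈ SGLGL p q ↔ g ∈ SL (Fin p ⊕ Fin q) ∧
    g.val * blockProj (Fin p) (Fin q) = blockProj (Fin p) (Fin q) * g.val := by
  rw [SGLGL, Subgroup.mem_inf, mem_range_blockDiag, and_comm]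

lemma mem_SUU (g : GL (Fin p ⊕ Fin q) ℂ) : g ∈ SUU p q ↔ g ∈ SU (Fin p ⊕ Fin q) ∧
    g.val * blockProj (Fin p) (Fin q) = blockProj (Fin p) (Fin q) * g.val := by
  rw [SUU, Subgroup.mem_inf, ← mem_range_blockDiag, SU_eq, Subgroup.mem_inf]
  constructor
  · rintro ⟨⟨x, hx, rfl⟩, h⟩
    exact ⟨⟨h, blockDiag_mem_U.2 hx⟩, x, rfl⟩
  · rintro ⟨⟨h1, h2⟩, x, rfl⟩
    exact ⟨⟨x, blockDiag_mem_U.1 h2, rfl⟩, h1⟩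

/-- The upper block vanishes if one of the two blocks is empty, and acts faithfully otherwise. -/
lemma faithful_traceless (m n : Type) [Fintype m] [DecidableEq m] [Fintype n] [DecidableEq n] :
    upperBlock (traceless (m ⊕ n)) (blockProj m n) = ⊥ ∨
      ∀ a, a * blockProj m n = blockProj m n * a →
        (∀ X ∈ upperBlock (traceless (m ⊕ n)) (blockProj m n), a * X = 0 ∧ X * a = 0) → a = 0 := by
  by_cases hmn : Nonempty m ∧ Nonempty n
  · obtain ⟨⟨i₀⟩, ⟨j₀⟩⟩ := hmn
    refine Or.inr fun a ha h => ?_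
    obtain ⟨b, d, rfl⟩ := mul_blockProj_comm_iff.1 ha
    -- The upper block contains all elementary matrices.
    have h1 : ∀ (i : m) (j : n), b * Matrix.single i j (1 : ℂ) = 0 ∧
        Matrix.single i j (1 : ℂ) * d = 0 := fun i j => by
      have hX : IsUpper (blockProj m n) (Matrix.fromBlocks 0 (Matrix.single i j 1) 0 0) :=
        isUpper_blockProj_iff.2 ⟨_, rfl⟩
      have h2 := h _ ⟨mem_traceless.2 hX.trace_eq_zero, hX⟩
      rw [Matrix.fromBlocks_multiply, Matrix.fromBlocks_multiply, ← Matrix.fromBlocks_zero,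
        Matrix.fromBlocks_inj, Matrix.fromBlocks_inj] at h2
      simpa using h2
    have hb : b = 0 := by
      ext k i
      simpa using congrFun (congrFun (h1 i j₀).1 k) j₀
    have hd : d = 0 := by
      ext j k
      simpa using congrFun (congrFun (h1 i₀ j).2 i₀) k
    rw [hb, hd, Matrix.fromBlocks_zero]
  · refine Or.inl ((Submodule.eq_bot_iff _).2 fun X hX => ?_)
    obtain ⟨S, rfl⟩ := isUpper_blockProj_iff.1 hX.2
    have : S = 0 := by
      ext i j
      exact absurd ⟨⟨i⟩, ⟨j⟩⟩ hmn
    rw [this, Matrix.fromBlocks_zero]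

theorem isSymmetricFlag_SL :
    IsSymmetricFlagWithSymmetricCotangent (SL (Fin p ⊕ Fin q)) (SU (Fin p ⊕ Fin q)) (SUU p q)
      (SGLGL p q) (LieAlgebra.SpecialLinear.sl (Fin p ⊕ Fin q) ℂ) (HA p q) :=
  (IsSelfAdjointGroup.isSymmetricDatum (𝔤 := LieAlgebra.SpecialLinear.sl (Fin p ⊕ Fin q) ℂ)
    isSelfAdjointGroup_SL SU_eq
    (SU_eq (ι := Fin p ⊕ Fin q) ▸ flagDatum_SL (blockProj_mul_self _ _) (star_blockProj _ _))
    isConnected_SL (HA_eq p q) (trace_HA p q) (star_HA p q) (mem_SGLGL p q) (mem_SUU p q)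
    (faithful_traceless _ _)).isSymmetricFlag

end TypeA

/-! ### Isometry groups of bilinear forms -/

section Forms

open scoped Matrix.Norms.L2Operator

variable {ι : Type} [Fintype ι] [DecidableEq ι] {B : Matrix ι ι ℂ}

lemma realPart_skewAdjoint (hB : IsFormMatrix B) :
    realPart (skewAdjointMatricesLieSubalgebra B) = bilinSkew B := by
  ext X
  rw [mem_bilinSkew]
  change X ∈ skewAdjointMatricesLieSubalgebra B ↔ B.transpose * X.transpose * B = -X
  rw [mem_skewAdjointMatricesLieSubalgebra, mem_skewAdjointMatricesSubmodule,
    Matrix.IsSkewAdjoint, Matrix.IsAdjointPair]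
  constructor
  · intro h
    rw [mul_assoc, h, ← mul_assoc, hB.orthogonal', one_mul]
  · intro h
    rw [← h, ← mul_assoc, ← mul_assoc, hB.orthogonal, one_mul]

lemma flag_mem_bilinSkew {E : Matrix ι ι ℂ} (hB : IsFormMatrix B)
    (hBE : bilinAdjoint B E = 1 - E) :
    (Complex.I * Real.pi) • E + (-(Complex.I * Real.pi / 2)) • (1 : Matrix ι ι ℂ) ∈
      bilinSkew B := by
  rw [mem_bilinSkew, map_add, map_smul, map_smul, hB.adjoint_one, hBE]
  module

lemma star_flag {E : Matrix ι ι ℂ} (hE : star E = E) :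
    star ((Complex.I * Real.pi) • E + (-(Complex.I * Real.pi / 2)) • (1 : Matrix ι ι ℂ)) =
      -((Complex.I * Real.pi) • E + (-(Complex.I * Real.pi / 2)) • (1 : Matrix ι ι ℂ)) := by
  rw [star_add, star_smul, star_smul, hE, star_one, neg_add, ← neg_smul, ← neg_smul]
  congr 2
  · simp
  · simp [neg_div]

theorem isSymmetricFlag_specialIsometryGroup {E H : Matrix ι ι ℂ} {G V K Z : Subgroup (GL ι ℂ)}
    (hB : IsFormMatrix B) (hE : E * E = E) (hs : star E = E) (hBE : bilinAdjoint B E = 1 - E)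
    (hG : G = specialIsometryGroup hB) (hV : V = G ⊓ U ι)
    (hH : H = (Complex.I * Real.pi) • E + (-(Complex.I * Real.pi / 2)) • (1 : Matrix ι ι ℂ))
    (hconn : IsConnected (G : Set (GL ι ℂ)))
    (hZ : ∀ g, g ∈ Z ↔ g ∈ G ∧ (g : Matrix ι ι ℂ) * E = E * (g : Matrix ι ι ℂ))
    (hK : ∀ g, g ∈ K ↔ g ∈ V ∧ (g : Matrix ι ι ℂ) * E = E * (g : Matrix ι ι ℂ))
    (hfaithful : upperBlock (bilinSkew B) E = ⊥ ∨ ∀ a, a * E = E * a →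
      (∀ X ∈ upperBlock (bilinSkew B) E, a * X = 0 ∧ X * a = 0) → a = 0) :
    IsSymmetricFlagWithSymmetricCotangent G V K Z (skewAdjointMatricesLieSubalgebra B) H := by
  subst hG hV hH
  have h𝔤 := realPart_skewAdjoint hB
  refine (IsSelfAdjointGroup.isSymmetricDatum (𝔤 := skewAdjointMatricesLieSubalgebra B)
    (h𝔤 ▸ isSelfAdjointGroup_specialIsometryGroup hB) rfl
    (h𝔤 ▸ flagDatum_specialIsometryGroup hB hE hs hBE) hconn ⟨_, rfl⟩ ?_ (star_flag hs) hZ hK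
    (h𝔤 ▸ hfaithful)).isSymmetricFlag
  have := flag_mem_bilinSkew hB hBE
  rwa [← h𝔤] at this

end Forms

/-! ### The symplectic group -/

section TypeC

open scoped Matrix.Norms.L2Operator

variable {l : ℕ}

lemma isFormMatrix_J : IsFormMatrix (Matrix.J (Fin l) ℂ) where
  orthogonal := by rw [Matrix.J_transpose, mul_neg, Matrix.J_squared, neg_neg]
  real := by
    rw [Matrix.J, Matrix.star_eq_conjTranspose, Matrix.fromBlocks_conjTranspose,
      Matrix.fromBlocks_transpose]
    simp

lemma bilinAdjoint_J (a b c d : Matrix (Fin l) (Fin l) ℂ) :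
    bilinAdjoint (Matrix.J (Fin l) ℂ) (Matrix.fromBlocks a b c d) =
      Matrix.fromBlocks d.transpose (-b.transpose) (-c.transpose) a.transpose := by
  change (Matrix.J (Fin l) ℂ).transpose * (Matrix.fromBlocks a b c d).transpose *
    Matrix.J (Fin l) ℂ = _
  rw [Matrix.J, Matrix.fromBlocks_transpose, Matrix.fromBlocks_transpose,
    Matrix.fromBlocks_multiply, Matrix.fromBlocks_multiply]
  simp

lemma bilinAdjoint_J_blockProj : bilinAdjoint (Matrix.J (Fin l) ℂ) (blockProj (Fin l) (Fin l)) =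
    1 - blockProj (Fin l) (Fin l) := by
  rw [one_sub_blockProj, blockProj, bilinAdjoint_J]
  simp

lemma mem_SpC {g : GL (Fin l ⊕ Fin l) ℂ} :
    g ∈ SpC l ↔ g.val ∈ Matrix.symplecticGroup (Fin l) ℂ := by
  rw [SpC, Submonoid.mem_units_iff]
  refine ⟨fun h => h.1, fun h => ⟨h, ?_⟩⟩
  have h1 := ((⟨g.val, h⟩ : Matrix.symplecticGroup (Fin l) ℂ)⁻¹).2
  rwa [SymplecticGroup.coe_inv', ← Matrix.coe_units_inv] at h1

lemma SpC_eq : SpC l = specialIsometryGroup isFormMatrix_J := by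
  ext g
  rw [mem_SpC, specialIsometryGroup, Subgroup.mem_inf, mem_SL]
  have h : g ∈ (isFormMatrix_J (l := l)).isometryGroup ↔
      g.val ∈ Matrix.symplecticGroup (Fin l) ℂ := by
    rw [SymplecticGroup.mem_iff']
    change (Matrix.J (Fin l) ℂ).transpose * g.val.transpose * Matrix.J (Fin l) ℂ * g.val = 1 ↔ _
    constructor
    · intro h
      have h1 := congrArg (Matrix.J (Fin l) ℂ * ·) h
      simpa only [← mul_assoc, isFormMatrix_J.orthogonal, one_mul, mul_one] using h1
    · intro h
      rw [mul_assoc, mul_assoc, ← mul_assoc g.val.transpose, h, isFormMatrix_J.orthogonal']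
  rw [h]
  exact ⟨fun h => ⟨h, SymplecticGroup.det_eq_one h⟩, fun h => h.1⟩

lemma SpCompact_eq : SpCompact l = SpC l ⊓ U (Fin l ⊕ Fin l) := by
  have h : SpC l ≤ SL (Fin l ⊕ Fin l) := by
    rw [SpC_eq]
    exact inf_le_right
  rw [SpCompact, SU_eq, ← inf_assoc, inf_eq_left.2 h]

lemma HC_eq : HC l = (Complex.I * Real.pi) • blockProj (Fin l) (Fin l) +
    (-(Complex.I * Real.pi / 2)) • 1 := by
  rw [HC, blockProj, ← Matrix.fromBlocks_one, Matrix.fromBlocks_smul, Matrix.fromBlocks_smul,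
    Matrix.fromBlocks_smul, Matrix.fromBlocks_add, Matrix.fromBlocks_inj]
  refine ⟨?_, by simp, by simp, ?_⟩ <;> module

lemma val_glToSp (a : GL (Fin l) ℂ) : (glToSp l a).val =
    Matrix.fromBlocks a.val 0 0 (a⁻¹).val.transpose := rfl

lemma contragredient_eq {a d : GL (Fin l) ℂ} (h : d.val.transpose * a.val = 1) :
    d = contragredient (Fin l) a := by
  refine Units.ext ?_
  change d.val = (a⁻¹).val.transpose
  rw [← Matrix.transpose_transpose d.val]
  congr 1
  exact (Units.inv_eq_of_mul_eq_one_left h).symm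

lemma contragredient_mem_U {a : GL (Fin l) ℂ} (h : a ∈ U (Fin l)) :
    contragredient (Fin l) a ∈ U (Fin l) := by
  rw [mem_U] at h ⊢
  change star ((a⁻¹).val.transpose) = a.val.transpose
  rw [← h]
  ext i j
  simp [Matrix.star_apply]

lemma glToSp_mem_U {a : GL (Fin l) ℂ} : glToSp l a ∈ U (Fin l ⊕ Fin l) ↔ a ∈ U (Fin l) := by
  change blockDiag (Fin l) (Fin l) (a, contragredient (Fin l) a) ∈ _ ↔ _
  rw [blockDiag_mem_U]
  exact ⟨fun h => h.1, fun h => ⟨h, contragredient_mem_U h⟩⟩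

lemma glToSp_mem_SpC (a : GL (Fin l) ℂ) : glToSp l a ∈ SpC l := by
  rw [SpC_eq, specialIsometryGroup, Subgroup.mem_inf, mem_SL, isFormMatrix_J.mem_isometryGroup,
    val_glToSp, bilinAdjoint_J]
  constructor
  · change _ = Matrix.fromBlocks (a⁻¹).val 0 0 a.val.transpose
    simp
  · rw [Matrix.det_fromBlocks_zero₂₁, Matrix.det_transpose, ← Matrix.det_mul, Units.mul_inv,
      Matrix.det_one]

lemma mem_range_glToSp (g : GL (Fin l ⊕ Fin l) ℂ) : g ∈ (glToSp l).range ↔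
    g ∈ SpC l ∧ g.val * blockProj (Fin l) (Fin l) = blockProj (Fin l) (Fin l) * g.val := by
  constructor
  · rintro ⟨a, rfl⟩
    exact ⟨glToSp_mem_SpC a, mul_blockProj_comm_iff.2 ⟨_, _, val_glToSp a⟩⟩
  · rintro ⟨h1, h2⟩
    obtain ⟨⟨a, d⟩, rfl⟩ := mem_range_blockDiag.2 h2
    rw [SpC_eq] at h1
    have h3 : bilinAdjoint (Matrix.J (Fin l) ℂ) (blockDiag (Fin l) (Fin l) (a, d)).val *
      (blockDiag (Fin l) (Fin l) (a, d)).val = 1 := h1.1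
    rw [val_blockDiag, bilinAdjoint_J, Matrix.fromBlocks_multiply, ← Matrix.fromBlocks_one,
      Matrix.fromBlocks_inj] at h3
    have h4 := h3.1
    rw [Matrix.mul_zero, add_zero] at h4
    refine ⟨a, ?_⟩
    change blockDiag (Fin l) (Fin l) (a, contragredient (Fin l) a) = _
    rw [← contragredient_eq h4]

lemma mem_map_glToSp (g : GL (Fin l ⊕ Fin l) ℂ) : g ∈ (U (Fin l)).map (glToSp l) ↔
    g ∈ SpCompact l ∧ g.val * blockProj (Fin l) (Fin l) = blockProj (Fin l) (Fin l) * g.val := by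
  rw [SpCompact_eq, Subgroup.mem_inf, and_right_comm, ← mem_range_glToSp]
  constructor
  · rintro ⟨a, ha, rfl⟩
    exact ⟨⟨a, rfl⟩, glToSp_mem_U.2 ha⟩
  · rintro ⟨⟨a, rfl⟩, h⟩
    exact ⟨a, glToSp_mem_U.1 h, rfl⟩

lemma continuous_glToSp : Continuous (glToSp l) := by
  rw [(Units.isOpenEmbedding_val (R := Matrix (Fin l ⊕ Fin l) (Fin l ⊕ Fin l) ℂ)
    ).isEmbedding.continuous_iff]
  change Continuous fun a : GL (Fin l) ℂ =>
    Matrix.fromBlocks a.val 0 0 (a⁻¹).val.transpose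
  exact continuous_val_GL.matrix_fromBlocks continuous_const continuous_const
    (continuous_val_GL.comp continuous_inv).matrix_transpose

/-- Every symplectic matrix with first block column `(A, C)` is moved into the big cell by a
symmetric `S` with `A + S C` invertible. -/
lemma isConnected_SpC : IsConnected (SpC l : Set (GL (Fin l ⊕ Fin l) ℂ)) := by
  have D := flagDatum_specialIsometryGroup (isFormMatrix_J (l := l)) (blockProj_mul_self _ _)
    (star_blockProj _ _) bilinAdjoint_J_blockProj
  rw [← SpC_eq] at D
  refine D.isConnected (fun z hz hcomm => ?_) (fun g hg => ?_)
  · obtain ⟨a, rfl⟩ := (mem_range_glToSp z).2 ⟨hz, hcomm⟩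
    refine mem_identityComponent
      (isConnected_GL.image _ continuous_glToSp.continuousOn).isPreconnected
      ⟨1, trivial, map_one _⟩ ?_ ⟨a, trivial, rfl⟩
    rintro _ ⟨b, -, rfl⟩
    exact glToSp_mem_SpC b
  · have h1 := mem_SpC.1 hg
    rw [← g.val.fromBlocks_toBlocks, SymplecticGroup.fromBlocks_mem_iff] at h1
    have hker : ∀ x, g.val.toBlocks₁₁.mulVec x = 0 → g.val.toBlocks₂₁.mulVec x = 0 → x = 0 := by
      intro x hA hC
      have h2 := congrArg Matrix.transpose h1.2.2
      rw [Matrix.transpose_sub, Matrix.transpose_mul, Matrix.transpose_mul,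
        Matrix.transpose_transpose, Matrix.transpose_transpose, Matrix.transpose_one] at h2
      rw [← Matrix.one_mulVec x, ← h2, Matrix.sub_mulVec, ← Matrix.mulVec_mulVec,
        ← Matrix.mulVec_mulVec, hA, hC]
      simp
    obtain ⟨S, hS, hu⟩ := exists_isSymm_isUnit_add_mul _ _ hker h1.1
    refine ⟨Matrix.fromBlocks 0 S 0 0, ⟨?_, isUpper_blockProj_iff.2 ⟨S, rfl⟩⟩, ?_⟩
    · rw [mem_bilinSkew, bilinAdjoint_J, Matrix.fromBlocks_neg, hS.eq]
      simp
    · have h3 : pivot (blockProj (Fin l) (Fin l)) ((1 + Matrix.fromBlocks 0 S 0 0) * g.val) =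
          Matrix.fromBlocks (g.val.toBlocks₁₁ + S * g.val.toBlocks₂₁) 0 0 1 := by
        conv_lhs => rw [← g.val.fromBlocks_toBlocks]
        rw [pivot, one_sub_blockProj, blockProj, add_mul, one_mul]
        simp only [Matrix.fromBlocks_multiply, Matrix.fromBlocks_add]
        simp
      rw [h3, Matrix.isUnit_iff_isUnit_det, Matrix.det_fromBlocks_zero₂₁, Matrix.det_one, mul_one,
        ← Matrix.isUnit_iff_isUnit_det]
      exact hu

theorem isSymmetricFlag_SpC (l : ℕ) :
    IsSymmetricFlagWithSymmetricCotangent (SpC l) (SpCompact l) ((U (Fin l)).map (glToSp l))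
      (glToSp l).range (LieAlgebra.Symplectic.sp (Fin l) ℂ) (HC l) := by
  refine isSymmetricFlag_specialIsometryGroup isFormMatrix_J (blockProj_mul_self _ _)
    (star_blockProj _ _) bilinAdjoint_J_blockProj SpC_eq SpCompact_eq HC_eq isConnected_SpC
    mem_range_glToSp mem_map_glToSp (Or.inr fun a ha h => ?_)
  obtain ⟨b, d, rfl⟩ := mul_blockProj_comm_iff.1 ha
  have h1 := h (Matrix.fromBlocks 0 1 0 0) ⟨by
    rw [mem_bilinSkew, bilinAdjoint_J, Matrix.fromBlocks_neg]
    simp, isUpper_blockProj_iff.2 ⟨1, rfl⟩⟩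
  rw [Matrix.fromBlocks_multiply, Matrix.fromBlocks_multiply, ← Matrix.fromBlocks_zero,
    Matrix.fromBlocks_inj, Matrix.fromBlocks_inj] at h1
  have hb : b = 0 := by simpa using h1.1.2.1
  have hd : d = 0 := by simpa using h1.2.2.1
  rw [hb, hd, Matrix.fromBlocks_zero]

end TypeC

/-! ### The even orthogonal group -/

section TypeD

open scoped Matrix.Norms.L2Operator

variable {l : ℕ}

lemma mem_SOC {g : GL (Fin l ⊕ Fin l) ℂ} :
    g ∈ SOC l ↔ g.val.transpose * g.val = 1 ∧ g.val.det = 1 := by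
  rw [SOC, Submonoid.mem_units_iff, Matrix.mem_specialOrthogonalGroup_iff,
    Matrix.mem_specialOrthogonalGroup_iff, Matrix.mem_orthogonalGroup_iff',
    Matrix.mem_orthogonalGroup_iff']
  refine ⟨fun h => h.1, fun h => ⟨h, ?_⟩⟩
  have h1 : (g⁻¹).val = g.val.transpose := Units.inv_eq_of_mul_eq_one_left h.1
  rw [h1, Matrix.transpose_transpose, Matrix.det_transpose]
  exact ⟨mul_eq_one_comm.1 h.1, h.2⟩

lemma SOC_eq : SOC l = specialIsometryGroup isFormMatrix_one := by
  ext g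
  rw [mem_SOC, specialIsometryGroup, Subgroup.mem_inf, mem_SL]
  change _ ↔ bilinAdjoint 1 g.val * g.val = 1 ∧ _
  rw [bilinAdjoint_one]

lemma SOR_eq : SOR l = SOC l ⊓ U (Fin l ⊕ Fin l) := by
  have hmem : ∀ M : Matrix (Fin l ⊕ Fin l) (Fin l ⊕ Fin l) ℂ,
      M ∈ (Matrix.specialOrthogonalGroup (Fin l ⊕ Fin l) ℝ).map Complex.ofRealHom.mapMatrix ↔
      M.transpose * M = 1 ∧ M.det = 1 ∧ star M = M.transpose := fun M => by
    have hinj : Function.Injective (Complex.ofRealHom.mapMatrix :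
        Matrix (Fin l ⊕ Fin l) (Fin l ⊕ Fin l) ℝ →+* Matrix (Fin l ⊕ Fin l) (Fin l ⊕ Fin l) ℂ) :=
      Matrix.map_injective Complex.ofReal_injective
    have htr : ∀ N : Matrix (Fin l ⊕ Fin l) (Fin l ⊕ Fin l) ℝ,
        (Complex.ofRealHom.mapMatrix N).transpose = Complex.ofRealHom.mapMatrix N.transpose :=
      fun N => rfl
    constructor
    · rintro ⟨N, hN, rfl⟩
      have h1 := (Matrix.mem_specialOrthogonalGroup_iff.1 hN)
      have h2 := (Matrix.mem_orthogonalGroup_iff' _ _).1 h1.1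
      change (Complex.ofRealHom.mapMatrix N).transpose * Complex.ofRealHom.mapMatrix N = 1 ∧
        (Complex.ofRealHom.mapMatrix N).det = 1 ∧ star (Complex.ofRealHom.mapMatrix N) =
        (Complex.ofRealHom.mapMatrix N).transpose
      rw [htr, ← map_mul, h2, map_one, ← RingHom.map_det, h1.2, map_one]
      refine ⟨rfl, rfl, ?_⟩
      rw [← htr]
      ext i j
      simp [Matrix.star_apply]
    · rintro ⟨h1, h2, h3⟩
      have hM : Complex.ofRealHom.mapMatrix (M.map Complex.re) = M := by
        ext i j
        exact Complex.conj_eq_iff_re.1 (congrFun (congrFun h3 j) i)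
      refine ⟨M.map Complex.re, Matrix.mem_specialOrthogonalGroup_iff.2
        ⟨(Matrix.mem_orthogonalGroup_iff' _ _).2 (hinj ?_), Complex.ofReal_injective ?_⟩, hM⟩
      · rw [map_mul, ← htr, hM, h1, map_one]
      · have h4 := RingHom.map_det Complex.ofRealHom (M.map Complex.re)
        rw [hM, h2] at h4
        exact h4.trans Complex.ofReal_one.symm
  ext g
  rw [SOR, Submonoid.mem_units_iff, hmem, hmem, Subgroup.mem_inf, mem_SOC, mem_U]
  constructor
  · rintro ⟨⟨h1, h2, h3⟩, -⟩
    exact ⟨⟨h1, h2⟩, h3.trans (Units.inv_eq_of_mul_eq_one_left h1).symm⟩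
  · rintro ⟨⟨h1, h2⟩, h3⟩
    have h4 : (g⁻¹).val = g.val.transpose := Units.inv_eq_of_mul_eq_one_left h1
    rw [h4] at h3 ⊢
    refine ⟨⟨h1, h2, h3⟩, ?_, ?_, ?_⟩
    · rw [Matrix.transpose_transpose]; exact mul_eq_one_comm.1 h1
    · rw [Matrix.det_transpose, h2]
    · rw [← h3, star_star, h3, Matrix.transpose_transpose]

variable (l) in
/-- The projection `f⁻¹ diag(1, 0) f`, `f = cayley l`, onto an isotropic subspace. -/
def isotropicProj : Matrix (Fin l ⊕ Fin l) (Fin l ⊕ Fin l) ℂ :=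
  (cayley l)⁻¹.val * blockProj (Fin l) (Fin l) * (cayley l).val

lemma isotropicProj_eq : isotropicProj l =
    (1 / 2 : ℂ) • Matrix.fromBlocks 1 (-Complex.I • 1) (Complex.I • 1) 1 := by
  change (1 / 2 : ℂ) • Matrix.fromBlocks (-Complex.I • 1) 1 1 (-Complex.I • 1) *
    Matrix.fromBlocks 1 0 0 0 * Matrix.fromBlocks (Complex.I • 1) 1 1 (Complex.I • 1) = _
  rw [Matrix.smul_mul, Matrix.smul_mul, Matrix.fromBlocks_multiply, Matrix.fromBlocks_multiply]
  simp [smul_smul]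

lemma isotropicProj_mul_self : isotropicProj l * isotropicProj l = isotropicProj l := by
  have h : ∀ a b c : Matrix (Fin l ⊕ Fin l) (Fin l ⊕ Fin l) ℂ, a * c = 1 → b * b = b →
      c * b * a * (c * b * a) = c * b * a := fun a b c h1 h2 => by
    rw [mul_assoc (c * b), ← mul_assoc a, ← mul_assoc a, h1, one_mul, ← mul_assoc, mul_assoc c, h2]
  exact h _ _ _ (cayley l).mul_inv (blockProj_mul_self _ _)

lemma star_isotropicProj : star (isotropicProj l) = isotropicProj l := by
  rw [isotropicProj_eq, Matrix.star_eq_conjTranspose, Matrix.conjTranspose_smul,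
    Matrix.fromBlocks_conjTranspose]
  simp [Matrix.conjTranspose_smul]

lemma bilinAdjoint_isotropicProj : bilinAdjoint 1 (isotropicProj l) = 1 - isotropicProj l := by
  have h : (1 : Matrix (Fin l ⊕ Fin l) (Fin l ⊕ Fin l) ℂ) =
      (1 / 2 : ℂ) • Matrix.fromBlocks ((2 : ℂ) • 1) 0 0 ((2 : ℂ) • 1) := by
    rw [Matrix.fromBlocks_smul, smul_smul, smul_zero]
    norm_num
  rw [bilinAdjoint_one, h, isotropicProj_eq, ← smul_sub, Matrix.transpose_smul,
    Matrix.fromBlocks_transpose, sub_eq_add_neg, Matrix.fromBlocks_neg, Matrix.fromBlocks_add]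
  congr 2
  · simp only [Matrix.transpose_one]; module
  · simp
  · simp
  · simp only [Matrix.transpose_one]; module

lemma HD_eq : HD l = (Complex.I * Real.pi) • isotropicProj l +
    (-(Complex.I * Real.pi / 2)) • 1 := by
  rw [HD, isotropicProj_eq, ← Matrix.fromBlocks_one, smul_smul, Matrix.fromBlocks_smul,
    Matrix.fromBlocks_smul, Matrix.fromBlocks_smul, Matrix.fromBlocks_add, Matrix.fromBlocks_inj]
  have hI := Complex.I_mul_I
  refine ⟨by module, ?_, ?_, by module⟩
  · rw [smul_zero, add_zero, smul_smul]
    congr 1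
    linear_combination ((Real.pi : ℂ) / 2) * hI
  · rw [smul_zero, add_zero, smul_smul, smul_neg, ← neg_smul]
    congr 1
    linear_combination (-(Real.pi : ℂ) / 2) * hI

variable (l) in
/-- The conjugation `X ↦ f⁻¹ X f`, `f = cayley l`. -/
def cayleyConj : Matrix (Fin l ⊕ Fin l) (Fin l ⊕ Fin l) ℂ ≃ₐ[ℂ]
    Matrix (Fin l ⊕ Fin l) (Fin l ⊕ Fin l) ℂ :=
  AlgEquiv.ofAlgHom
    { toFun := fun X => (cayley l)⁻¹.val * X * (cayley l).val
      map_one' := by rw [mul_one, Units.inv_mul]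
      map_zero' := by rw [mul_zero, zero_mul]
      map_add' := fun X Y => by rw [mul_add, add_mul]
      map_mul' := fun X Y => by simp only [mul_assoc, Units.mul_inv_cancel_left]
      commutes' := fun c => by
        rw [← Algebra.commutes, mul_assoc, Units.inv_mul, mul_one] }
    { toFun := fun X => (cayley l).val * X * (cayley l)⁻¹.val
      map_one' := by rw [mul_one, Units.mul_inv]
      map_zero' := by rw [mul_zero, zero_mul]
      map_add' := fun X Y => by rw [mul_add, add_mul]
      map_mul' := fun X Y => by simp only [mul_assoc, Units.inv_mul_cancel_left]
      commutes' := fun c => by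
        rw [← Algebra.commutes, mul_assoc, Units.mul_inv, mul_one] }
    (by ext1 X; simp [mul_assoc])
    (by ext1 X; simp [mul_assoc])

lemma cayleyConj_apply (X : Matrix (Fin l ⊕ Fin l) (Fin l ⊕ Fin l) ℂ) :
    cayleyConj l X = (cayley l)⁻¹.val * X * (cayley l).val := rfl

lemma cayleyConj_blockProj : cayleyConj l (blockProj (Fin l) (Fin l)) = isotropicProj l := rfl

/-- The conjugation by `f` turns the transposition into the transposition with respect to the
second diagonal, since `f = fᵀ` and `f² = 2 i (0, 1; 1, 0)`. -/
lemma cayleyConj_transpose (a b c d : Matrix (Fin l) (Fin l) ℂ) :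
    (cayleyConj l (Matrix.fromBlocks a b c d)).transpose =
      cayleyConj l (Matrix.fromBlocks d.transpose b.transpose c.transpose a.transpose) := by
  set C := (cayley l).val with hC
  set C' := (cayley l)⁻¹.val with hC'
  let s : Matrix (Fin l ⊕ Fin l) (Fin l ⊕ Fin l) ℂ := Matrix.fromBlocks 0 1 1 0
  have hCval : C = Matrix.fromBlocks (Complex.I • 1) 1 1 (Complex.I • 1) := rfl
  have hCt : C.transpose = C := by
    rw [hCval, Matrix.fromBlocks_transpose]
    simp
  have hCt' : C'.transpose = C' := by
    have : C' = (1 / 2 : ℂ) • Matrix.fromBlocks (-Complex.I • 1) 1 1 (-Complex.I • 1) := rfl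
    rw [this, Matrix.transpose_smul, Matrix.fromBlocks_transpose]
    simp
  have h1 : C * C = (2 * Complex.I) • s := by
    rw [hCval, Matrix.fromBlocks_multiply, Matrix.fromBlocks_smul, Matrix.fromBlocks_inj]
    simp [smul_smul, two_mul, add_smul]
  have hss : s * s = 1 := by
    rw [Matrix.fromBlocks_multiply, ← Matrix.fromBlocks_one]
    simp
  have hI : (2 * Complex.I) ≠ 0 := mul_ne_zero two_ne_zero Complex.I_ne_zero
  have h2 : C = (2 * Complex.I) • (C' * s) := by
    rw [← mul_smul_comm, ← h1, ← mul_assoc, Units.inv_mul, one_mul]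
  have h3 : C' = (2 * Complex.I)⁻¹ • (s * C) := by
    have h4 : C = (2 * Complex.I) • (s * C') := by
      rw [← smul_mul_assoc, ← h1, mul_assoc, Units.mul_inv, mul_one]
    have h5 : s * C = (2 * Complex.I) • C' := by
      conv_lhs => rw [h4]
      rw [mul_smul_comm, ← mul_assoc, hss, one_mul]
    rw [h5, inv_smul_smul₀ hI]
  have h6 : s * (Matrix.fromBlocks a b c d).transpose * s =
      Matrix.fromBlocks d.transpose b.transpose c.transpose a.transpose := by
    rw [Matrix.fromBlocks_transpose, Matrix.fromBlocks_multiply, Matrix.fromBlocks_multiply]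
    simp
  rw [cayleyConj_apply, cayleyConj_apply, Matrix.transpose_mul, Matrix.transpose_mul, hCt, hCt',
    ← h6]
  calc C * ((Matrix.fromBlocks a b c d).transpose * C')
      = (2 * Complex.I) • (C' * s) * ((Matrix.fromBlocks a b c d).transpose *
          ((2 * Complex.I)⁻¹ • (s * C))) := by rw [← h2, ← h3]
    _ = C' * (s * (Matrix.fromBlocks a b c d).transpose * s) * C := by
      rw [smul_mul_assoc, mul_smul_comm, mul_smul_comm, smul_smul, mul_inv_cancel₀ hI, one_smul]
      simp only [mul_assoc]

lemma star_cayleyConj (X : Matrix (Fin l ⊕ Fin l) (Fin l ⊕ Fin l) ℂ) :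
    star (cayleyConj l X) = cayleyConj l (star X) := by
  have h1 : star (cayley l).val = (2 : ℂ) • (cayley l)⁻¹.val := by
    change star (Matrix.fromBlocks (Complex.I • 1) 1 1 (Complex.I • 1)) =
      (2 : ℂ) • ((1 / 2 : ℂ) • Matrix.fromBlocks (-Complex.I • 1) 1 1 (-Complex.I • 1))
    rw [smul_smul, Matrix.star_eq_conjTranspose, Matrix.fromBlocks_conjTranspose]
    simp [Matrix.conjTranspose_smul]
  have h2 : star ((cayley l)⁻¹.val) = (1 / 2 : ℂ) • (cayley l).val := by
    have h3 := congrArg star h1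
    rw [star_star, star_smul] at h3
    rw [h3, smul_smul]
    simp
  rw [cayleyConj_apply, cayleyConj_apply, star_mul, star_mul, h1, h2, smul_mul_assoc,
    mul_smul_comm, mul_smul_comm, smul_smul, mul_assoc]
  norm_num

lemma val_glToSO (a : GL (Fin l) ℂ) : (glToSO l a).val = cayleyConj l (glToSp l a).val := rfl

lemma val_glToSO_inv (a : GL (Fin l) ℂ) : ((glToSO l a)⁻¹).val =
    cayleyConj l ((glToSp l a)⁻¹).val := by
  rw [← map_inv, ← map_inv, val_glToSO]

lemma glToSO_mem_U {a : GL (Fin l) ℂ} : glToSO l a ∈ U (Fin l ⊕ Fin l) ↔ a ∈ U (Fin l) := by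
  rw [← glToSp_mem_U, mem_U, mem_U, val_glToSO, val_glToSO_inv, star_cayleyConj,
    (cayleyConj l).injective.eq_iff]

lemma glToSO_mem_SOC (a : GL (Fin l) ℂ) : glToSO l a ∈ SOC l := by
  rw [mem_SOC, val_glToSO]
  constructor
  · rw [val_glToSp, cayleyConj_transpose, ← map_mul, Matrix.fromBlocks_multiply]
    have h := congrArg Matrix.transpose a.inv_mul
    rw [Matrix.transpose_mul, Matrix.transpose_one] at h
    rw [Matrix.transpose_transpose, Units.inv_mul, h]
    simp
  · have h := mem_SL.1 ((SpC_eq (l := l) ▸ glToSp_mem_SpC a).2)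
    rw [cayleyConj_apply, Matrix.det_mul, Matrix.det_mul, h, mul_one, ← Matrix.det_mul,
      Units.inv_mul, Matrix.det_one]

lemma mem_range_glToSO (g : GL (Fin l ⊕ Fin l) ℂ) : g ∈ (glToSO l).range ↔
    g ∈ SOC l ∧ g.val * isotropicProj l = isotropicProj l * g.val := by
  constructor
  · rintro ⟨a, rfl⟩
    refine ⟨glToSO_mem_SOC a, ?_⟩
    rw [val_glToSO, ← cayleyConj_blockProj, ← map_mul, ← map_mul,
      mul_blockProj_comm_iff.2 ⟨_, _, val_glToSp a⟩]
  · rintro ⟨h1, h2⟩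
    set h := cayley l * g * (cayley l)⁻¹ with hh
    have hg : g = (cayley l)⁻¹ * h * cayley l := by rw [hh]; group
    have hgv : g.val = cayleyConj l h.val := by rw [hg]; rfl
    rw [hgv, ← cayleyConj_blockProj, ← map_mul, ← map_mul, (cayleyConj l).injective.eq_iff] at h2
    obtain ⟨⟨a, d⟩, had⟩ := mem_range_blockDiag.2 h2
    have h3 := (mem_SOC.1 h1).1
    rw [hgv, ← had, val_blockDiag, cayleyConj_transpose, ← map_mul] at h3
    have h4 := (cayleyConj l).injective (h3.trans (map_one (cayleyConj l)).symm)
    rw [Matrix.fromBlocks_multiply, ← Matrix.fromBlocks_one, Matrix.fromBlocks_inj] at h4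
    have h5 := h4.1
    rw [Matrix.mul_zero, add_zero] at h5
    change d.val.transpose * a.val = 1 at h5
    refine ⟨a, ?_⟩
    rw [hg, ← had, contragredient_eq h5]
    change (cayley l)⁻¹ * _ * ((cayley l)⁻¹)⁻¹ = _
    rw [inv_inv]
    rfl

lemma mem_map_glToSO (g : GL (Fin l ⊕ Fin l) ℂ) : g ∈ (U (Fin l)).map (glToSO l) ↔
    g ∈ SOR l ∧ g.val * isotropicProj l = isotropicProj l * g.val := by
  rw [SOR_eq, Subgroup.mem_inf, and_right_comm, ← mem_range_glToSO]
  constructor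
  · rintro ⟨a, ha, rfl⟩
    exact ⟨⟨a, rfl⟩, glToSO_mem_U.2 ha⟩
  · rintro ⟨⟨a, rfl⟩, h⟩
    exact ⟨a, glToSO_mem_U.1 h, rfl⟩

lemma isConnected_SOC : IsConnected (SOC l : Set (GL (Fin l ⊕ Fin l) ℂ)) := by
  rcases isEmpty_or_nonempty (Fin l) with h | h
  · have : Subsingleton (GL (Fin l ⊕ Fin l) ℂ) := ⟨fun a b => Units.ext (Subsingleton.elim _ _)⟩
    exact ⟨⟨1, one_mem _⟩, Set.subsingleton_of_subsingleton.isPreconnected⟩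
  · have : Nontrivial (Fin l ⊕ Fin l) := by
      obtain ⟨i⟩ := h
      exact ⟨Sum.inl i, Sum.inr i, Sum.inl_ne_inr⟩
    rw [SOC_eq]
    exact (isSelfAdjointGroup_specialIsometryGroup isFormMatrix_one).isConnected_of_unitary
      isConnected_realSpecialOrthogonal

lemma cayleyConj_upper_mem_iff {S : Matrix (Fin l) (Fin l) ℂ} :
    cayleyConj l (Matrix.fromBlocks 0 S 0 0) ∈ bilinSkew 1 ↔ S.transpose = -S := by
  rw [mem_bilinSkew, bilinAdjoint_one, cayleyConj_transpose, ← map_neg,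
    (cayleyConj l).injective.eq_iff, Matrix.fromBlocks_neg, Matrix.fromBlocks_inj]
  simp

lemma isUpper_isotropicProj_iff {X : Matrix (Fin l ⊕ Fin l) (Fin l ⊕ Fin l) ℂ} :
    IsUpper (isotropicProj l) (cayleyConj l X) ↔ IsUpper (blockProj (Fin l) (Fin l)) X := by
  rw [← cayleyConj_blockProj]
  constructor
  · intro h
    have h1 := h.left
    have h2 := h.right
    rw [← map_mul] at h1 h2
    exact ⟨(cayleyConj l).injective h1, (cayleyConj l).injective (h2.trans (map_zero _).symm)⟩
  · intro h
    exact ⟨by rw [← map_mul, h.left], by rw [← map_mul, h.right, map_zero]⟩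

/-- The upper block vanishes for `l ≤ 1`, where `SO(2l)` is a torus, and acts faithfully
otherwise. -/
lemma faithful_so : upperBlock (bilinSkew 1) (isotropicProj l) = ⊥ ∨
    ∀ a, a * isotropicProj l = isotropicProj l * a →
      (∀ X ∈ upperBlock (bilinSkew 1) (isotropicProj l), a * X = 0 ∧ X * a = 0) → a = 0 := by
  rcases subsingleton_or_nontrivial (Fin l) with hl | hl
  · refine Or.inl ((Submodule.eq_bot_iff _).2 fun X hX => ?_)
    obtain ⟨X, rfl⟩ := (cayleyConj l).surjective X
    obtain ⟨S, rfl⟩ := isUpper_blockProj_iff.1 (isUpper_isotropicProj_iff.1 hX.2)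
    have h1 := cayleyConj_upper_mem_iff.1 hX.1
    have : S = 0 := by
      ext i j
      have h2 := congrFun (congrFun h1 i) j
      rw [Matrix.transpose_apply, Subsingleton.elim j i] at h2
      rw [Subsingleton.elim j i]
      exact self_eq_neg.1 h2
    rw [this, Matrix.fromBlocks_zero, map_zero]
  · refine Or.inr fun a ha h => ?_
    obtain ⟨a, rfl⟩ := (cayleyConj l).surjective a
    rw [← cayleyConj_blockProj, ← map_mul, ← map_mul, (cayleyConj l).injective.eq_iff] at ha
    obtain ⟨b, d, rfl⟩ := mul_blockProj_comm_iff.1 ha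
    -- The upper block corresponds to the skew-symmetric matrices.
    have h1 : ∀ i j, b * (Matrix.single i j (1 : ℂ) - Matrix.single j i 1) = 0 ∧
        (Matrix.single i j (1 : ℂ) - Matrix.single j i 1) * d = 0 := fun i j => by
      have h2 := h _ ⟨cayleyConj_upper_mem_iff.2 (by simp :
        (Matrix.single i j (1 : ℂ) - Matrix.single j i 1).transpose = _),
        isUpper_isotropicProj_iff.2 (isUpper_blockProj_iff.2 ⟨_, rfl⟩)⟩
      rw [← map_mul, ← map_mul, ← map_zero (cayleyConj l), (cayleyConj l).injective.eq_iff,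
        (cayleyConj l).injective.eq_iff, Matrix.fromBlocks_multiply, Matrix.fromBlocks_multiply,
        ← Matrix.fromBlocks_zero, Matrix.fromBlocks_inj, Matrix.fromBlocks_inj] at h2
      simpa using h2
    have hb : b = 0 := by
      ext k i
      obtain ⟨j, hj⟩ := exists_ne i
      simpa [mul_sub, hj, hj.symm] using congrFun (congrFun (h1 i j).1 k) j
    have hd : d = 0 := by
      ext j k
      obtain ⟨i, hi⟩ := exists_ne j
      simpa [sub_mul, hi, hi.symm] using congrFun (congrFun (h1 i j).2 i) k
    rw [hb, hd, Matrix.fromBlocks_zero, map_zero]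

theorem isSymmetricFlag_SOC (l : ℕ) :
    IsSymmetricFlagWithSymmetricCotangent (SOC l) (SOR l) ((U (Fin l)).map (glToSO l))
      (glToSO l).range (LieAlgebra.Orthogonal.so (Fin l ⊕ Fin l) ℂ) (HD l) :=
  isSymmetricFlag_specialIsometryGroup isFormMatrix_one isotropicProj_mul_self star_isotropicProj
    bilinAdjoint_isotropicProj SOC_eq SOR_eq HD_eq isConnected_SOC mem_range_glToSO mem_map_glToSO
    faithful_so

end TypeD

end FlagCotangent

end

theorem theoremB :
    (∀ p q : ℕ,
      FlagCotangent.IsSymmetricFlagWithSymmetricCotangent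
        (G := FlagCotangent.SL (Fin p ⊕ Fin q))
        (U := FlagCotangent.SU (Fin p ⊕ Fin q))
        (K := FlagCotangent.SUU p q)
        (Z := FlagCotangent.SGLGL p q)
        (𝔤 := LieAlgebra.SpecialLinear.sl (Fin p ⊕ Fin q) ℂ)
        (H := FlagCotangent.HA p q)) ∧
    (∀ l : ℕ,
      FlagCotangent.IsSymmetricFlagWithSymmetricCotangent
        (G := FlagCotangent.SpC l)
        (U := FlagCotangent.SpCompact l)
        (K := (FlagCotangent.U (Fin l)).map (FlagCotangent.glToSp l))
        (Z := (FlagCotangent.glToSp l).range)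
        (𝔤 := LieAlgebra.Symplectic.sp (Fin l) ℂ)
        (H := FlagCotangent.HC l)) ∧
    (∀ l : ℕ,
      FlagCotangent.IsSymmetricFlagWithSymmetricCotangent
        (G := FlagCotangent.SOC l)
        (U := FlagCotangent.SOR l)
        (K := (FlagCotangent.U (Fin l)).map (FlagCotangent.glToSO l))
        (Z := (FlagCotangent.glToSO l).range)
        (𝔤 := LieAlgebra.Orthogonal.so (Fin l ⊕ Fin l) ℂ)
        (H := FlagCotangent.HD l)) := by
  exact ⟨fun p q => FlagCotangent.isSymmetricFlag_SL p q,
    fun l => FlagCotangent.isSymmetricFlag_SpC l, fun l => FlagCotangent.isSymmetricFlag_SOC l⟩
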